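/- Let $\Delta\ge 4$, $k\in\{1,0,-1\}$, and let $\gamma$ be a Riemannian Einstein metric on a $(\Delta-2)$-dimensional space, $\mathrm{Ric}(\gamma)=k(\Delta-3)\gamma$ (given in a coordinate chart; only local properties of $\gamma$ matter). Let $V\in C^1(\mathbb R)$ satisfy $V\ge -4C$ for some constant $C>0$. **Spacetime.** Let $\mathcal Q\subset\mathbb R^2_{(u,v)}$ be the quotient of an evolutionary spacetime: a surface whose boundary consists of a spacelike curve $S\subset\mathcal Q$ and a timelike curve $\Gamma\subset\mathcal Q$ (with respect to $-du\,dv$, time-oriented by $\partial_u+\partial_v$) meeting in a single point, the left end of $S$ and the past end of $\Gamma$. Let $\mathcal I$, disjoint from $\mathcal Q$ and possibly empty, be the timelike curve forming the part of infinity from which curves $v=\mathrm{const}$ emanate; if nonempty it starts where $S$ ends. Every past null ray of $\mathcal Q$ with $u$ constant ends on $S\cup\Gamma$, and every past null ray with $v$ constant ends on $S\cup\mathcal I$. Moreover $\mathcal Q$ is relatively open and past-closed in the set $E$ of all points whose two past null rays end in this way, and $\mathcal Q\setminus(S\cup\Gamma)$ is open in the plane. Consider on $\mathcal Q\setminus\Gamma$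 the metric $$ds^2=-\Omega^2\,du\,dv+r^2\gamma,\qquad \Omega>0,$$ with a scalar field $\phi$ and a Maxwell field $F$, where $\Omega,r,\phi$ depend on $(u,v)$ only. The field $F$ has component $F_{uv}=e(u,v)$ and, if $\Delta=4$, in addition $F_{ij}=q_m\sqrt{\det\gamma}\,\epsilon_{ij}$ with $q_m$ constant; all other components vanish. Assume $r\in C^2$, $e\in C^1$, and that $\Omega,\phi$ are $C^1$ with continuous mixed second derivatives (up to $S$). Assume that on $\mathcal Q\setminus\Gamma$ $$R_{\mu\nu}-\tfrac12Rg_{\mu\nu}=2T_{\mu\nu},\qquad \Box\phi=V'(\phi),\qquad \nabla^\nu F_{\mu\nu}=0,$$ $$T_{\mu\nu}=\tfrac12g_{\mu\nu}\bigl(-\tfrac12(\nabla\phi)^2-V(\phi)-\tfrac14F_{\alpha\beta}F^{\alpha\beta}\bigr)+\tfrac12\phi_{,\mu}\phi_{,\nu}+\tfrac12F_{\mu\alpha}F_\nu{}^\alpha .$$ Assume $r\ge0$ on $\mathcal Q$, that $\Gamma=\{q\in\mathcal Q: r(q)=0\}$ (the centre), that $r\to\infty$ at $\mathcal I$, and that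 $\partial_ur<0$ on $S\setminus\Gamma$ and near $\mathcal I$. **Definitions.** $J^-$ is the causal past for $-du\,dv$, and closures are taken in the plane. $D^+(X)$ is the set of $x\in\overline{\mathcal Q}$ such that every past-inextendible causal curve in $\mathcal Q\cup\{x\}$ from $x$ meets $X$. A compact set $X\subset\mathcal Q$ *generates* $J^-(p)$ if $J^-(p)\cap\mathcal Q\subset D^+(X)\cup J^-(X)$. For $p\in\overline{\mathcal Q}$, a nonempty set $J^-(p)\cap\mathcal Q$ is *eventually compactly generated* if some compact $X\subset\mathcal Q$ generates $J^-(p)$. A point $p\in\overline{\mathcal Q}\setminus\mathcal Q$ is a *first singularity* if $J^-(p)\cap\mathcal Q$ is eventually compactly generated and every eventually compactly generated proper subset of it of the form $J^-(p_1)\cap\mathcal Q$, $p_1\in\overline{\mathcal Q}$, equals $J^-(q)\cap\mathcal Q$ for some $q\in\mathcal Q$. The trapped region is $\mathcal T=\{q\in\mathcal Q:\partial_vr(q)<0\}$; points of $\Gamma$ are never counted in it. **Extension criterion (assumed).** For $Y\subset\mathcal Q\setminus\Gamma$ let $N(Y)=\sup\{|\Omega|_{C^1(Y)},|\Omega^{-1}|_{C^0(Y)},|r|_{C^2(Y)},|r^{-1}|_{C^1(Y)}\}$.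 If $p\notin\overline\Gamma$ is a first singularity and the compact set $X\subset\mathcal Q\setminus\Gamma$ generates $J^-(p)$, with $D^+(X)\setminus\{p\}\subset\mathcal Q\setminus\Gamma$, then $N(D^+(X)\setminus\{p\})=\infty$. **Theorem.** Let $p\in\overline{\mathcal Q}\setminus\mathcal Q$ be a first singularity. Then either $p\in\overline\Gamma\setminus\Gamma$, or $$J^-(p)\cap\mathcal Q\cap D^+(X)\cap\mathcal T\neq\emptyset$$ for every compact $X\subset\mathcal Q$ that generates $J^-(p)$. -/

import Mathlib

open Set Filter Topology
open scoped ENNReal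

noncomputable section

/-! ### Tensor calculus in a coordinate chart with finite index type `ι` -/

section Chart

variable {ι : Type*} [Fintype ι] [DecidableEq ι]

/-- The coordinate partial derivative `∂ᵢ f`. -/
def pd (i : ι) (f : (ι → ℝ) → ℝ) (x : ι → ℝ) : ℝ :=
  lineDeriv ℝ f x (Pi.single i 1)

/-- The Christoffel symbol `Γᵃ_{bc}` of the metric `g`. -/
def christoffel (g : (ι → ℝ) → Matrix ι ι ℝ) (a b c : ι) (x : ι → ℝ) : ℝ :=
  (1 / 2) * ∑ d, (g x)⁻¹ a d *
    (pd b (fun y => g y d c) x + pd c (fun y => g y b d) x - pd d (fun y => g y b c) x)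

/-- The Ricci tensor `R_{bc} = R^a_{bac}`. -/
def ricci (g : (ι → ℝ) → Matrix ι ι ℝ) (x : ι → ℝ) (b c : ι) : ℝ :=
  ∑ a, (pd a (christoffel g a c b) x - pd c (christoffel g a a b) x +
    ∑ e, (christoffel g a a e x * christoffel g e c b x -
      christoffel g a c e x * christoffel g e a b x))

/-- The scalar curvature. -/
def scalarCurvature (g : (ι → ℝ) → Matrix ι ι ℝ) (x : ι → ℝ) : ℝ :=
  ∑ b, ∑ c, (g x)⁻¹ b c * ricci g x b c

/-- The Einstein tensor `R_{μν} - ½ R g_{μν}`. -/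
def einsteinTensor (g : (ι → ℝ) → Matrix ι ι ℝ) (x : ι → ℝ) (μ ν : ι) : ℝ :=
  ricci g x μ ν - (1 / 2) * g x μ ν * scalarCurvature g x

/-- The volume density `√|det g|`. -/
def volDensity (g : (ι → ℝ) → Matrix ι ι ℝ) (x : ι → ℝ) : ℝ :=
  Real.sqrt |(g x).det|

/-- `(∇φ)² = g^{αβ} ∂_αφ ∂_βφ`. -/
def gradSq (g : (ι → ℝ) → Matrix ι ι ℝ) (φ : (ι → ℝ) → ℝ) (x : ι → ℝ) : ℝ :=
  ∑ α, ∑ β, (g x)⁻¹ α β * pd α φ x * pd β φ x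

/-- The covariant wave operator, `(1/√|g|) ∂_μ(√|g| g^{μν} ∂_νφ)`. -/
def waveOp (g : (ι → ℝ) → Matrix ι ι ℝ) (φ : (ι → ℝ) → ℝ) (x : ι → ℝ) : ℝ :=
  (volDensity g x)⁻¹ *
    ∑ μ, pd μ (fun y => volDensity g y * ∑ ν, (g y)⁻¹ μ ν * pd ν φ y) x

/-- The field strength with raised indices, `F^{μν} = g^{μα} g^{νβ} F_{αβ}`. -/
def raiseField (g F : (ι → ℝ) → Matrix ι ι ℝ) (x : ι → ℝ) (μ ν : ι) : ℝ :=
  ∑ α, ∑ β, (g x)⁻¹ μ α * (g x)⁻¹ ν β * F x α β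

/-- `F_{μν} F^{μν}`. -/
def fieldSq (g F : (ι → ℝ) → Matrix ι ι ℝ) (x : ι → ℝ) : ℝ :=
  ∑ μ, ∑ ν, F x μ ν * raiseField g F x μ ν

/-- The stress-energy tensor of the Lagrangian `-½(∇φ)² - V(φ) - ¼F²`, in the normalization
`T_{μν} = ½ g_{μν}(-½(∇φ)² - V(φ) - ¼F²) + ½ ∂_μφ ∂_νφ + ½ F_{μα} F_ν{}^α`. -/
def stressTensor (g F : (ι → ℝ) → Matrix ι ι ℝ) (φ : (ι → ℝ) → ℝ) (V : ℝ → ℝ)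
    (x : ι → ℝ) (μ ν : ι) : ℝ :=
  (1 / 2) * g x μ ν * (-(1 / 2) * gradSq g φ x - V (φ x) - (1 / 4) * fieldSq g F x)
    + (1 / 2) * pd μ φ x * pd ν φ x
    + (1 / 2) * ∑ α, ∑ β, (g x)⁻¹ α β * F x μ α * F x ν β

/-- The source-free Maxwell equations `∂_ν(√|g| F^{μν}) = 0` at `x`. -/
def MaxwellAt (g F : (ι → ℝ) → Matrix ι ι ℝ) (x : ι → ℝ) : Prop :=
  ∀ μ, ∑ ν, pd ν (fun y => volDensity g y * raiseField g F y μ ν) x = 0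

end Chart

/-- `γ` is a Riemannian metric on the nonempty open chart domain `W ⊆ ℝⁿ` which is Einstein with
`Ric(γ) = k (n - 1) γ`. -/
structure IsEinsteinChart {n : ℕ} (k : ℝ) (W : Set (Fin n → ℝ))
    (γ : (Fin n → ℝ) → Matrix (Fin n) (Fin n) ℝ) : Prop where
  nonempty : W.Nonempty
  isOpen : IsOpen W
  contDiffOn : ∀ i j, ContDiffOn ℝ 2 (fun y => γ y i j) W
  posDef : ∀ y ∈ W, (γ y).PosDef
  einstein : ∀ y ∈ W, ∀ i j, ricci γ y i j = k * ((n : ℝ) - 1) * γ y i j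

/-! ### The warped product spacetime -/

/-- The `(u, v)` coordinates of a spacetime point. -/
def baseCoord {n : ℕ} (x : Fin 2 ⊕ Fin n → ℝ) : ℝ × ℝ := (x (Sum.inl 0), x (Sum.inl 1))

/-- The transverse coordinates of a spacetime point. -/
def fibreCoord {n : ℕ} (x : Fin 2 ⊕ Fin n → ℝ) : Fin n → ℝ := fun i => x (Sum.inr i)

/-- The metric `-Ω² du dv + r² γ`, so `g_{uv} = g_{vu} = -Ω²/2`. -/
def warpedMetric {n : ℕ} (Ω r : ℝ × ℝ → ℝ) (γ : (Fin n → ℝ) → Matrix (Fin n) (Fin n) ℝ)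
    (x : Fin 2 ⊕ Fin n → ℝ) : Matrix (Fin 2 ⊕ Fin n) (Fin 2 ⊕ Fin n) ℝ :=
  Matrix.fromBlocks
    !![0, -(Ω (baseCoord x)) ^ 2 / 2; -(Ω (baseCoord x)) ^ 2 / 2, 0] 0
    0 ((r (baseCoord x)) ^ 2 • γ (fibreCoord x))

/-- The antisymmetric symbol on the first two indices; for `n = 2` the Levi-Civita symbol. -/
def leviCivita2 {n : ℕ} : Matrix (Fin n) (Fin n) ℝ :=
  Matrix.of fun i j =>
    if i.val = 0 ∧ j.val = 1 then 1 else if i.val = 1 ∧ j.val = 0 then -1 else 0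

/-- The field strength with electric part `F_{uv} = e(u,v)` and magnetic part
`F_{ij} = qm √det γ ε_{ij}`. The constant `qm` is taken to vanish unless `n = 2`. -/
def fieldStrength {n : ℕ} (e : ℝ × ℝ → ℝ) (qm : ℝ)
    (γ : (Fin n → ℝ) → Matrix (Fin n) (Fin n) ℝ)
    (x : Fin 2 ⊕ Fin n → ℝ) : Matrix (Fin 2 ⊕ Fin n) (Fin 2 ⊕ Fin n) ℝ :=
  Matrix.fromBlocks
    !![0, e (baseCoord x); -(e (baseCoord x)), 0] 0
    0 ((qm * Real.sqrt (γ (fibreCoord x)).det) • leviCivita2)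

/-- The Einstein equations `G_{μν} = 2 T_{μν}`, the scalar wave equation `□φ = V'(φ)` and the
Maxwell equations hold at every point of `Y × W`. -/
def SolvesEinsteinScalarMaxwell {n : ℕ} (Y : Set (ℝ × ℝ)) (W : Set (Fin n → ℝ))
    (γ : (Fin n → ℝ) → Matrix (Fin n) (Fin n) ℝ) (V : ℝ → ℝ)
    (Ω r φ e : ℝ × ℝ → ℝ) (qm : ℝ) : Prop :=
  ∀ x : Fin 2 ⊕ Fin n → ℝ, baseCoord x ∈ Y → fibreCoord x ∈ W →
    (∀ μ ν, einsteinTensor (warpedMetric Ω r γ) x μ ν =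
      2 * stressTensor (warpedMetric Ω r γ) (fieldStrength e qm γ)
        (fun y => φ (baseCoord y)) V x μ ν) ∧
    waveOp (warpedMetric Ω r γ) (fun y => φ (baseCoord y)) x = deriv V (φ (baseCoord x)) ∧
    MaxwellAt (warpedMetric Ω r γ) (fieldStrength e qm γ) x

/-! ### Functions on the `(u, v)` plane -/

/-- `∂_u f`. -/
def dU (f : ℝ × ℝ → ℝ) (x : ℝ × ℝ) : ℝ := deriv (fun u => f (u, x.2)) x.1

/-- `∂_v f`. -/
def dV (f : ℝ × ℝ → ℝ) (x : ℝ × ℝ) : ℝ := deriv (fun v => f (x.1, v)) x.2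

/-- `f` is `C¹` on the open set `O` and has continuous mixed second derivatives there. -/
structure MixedC2On (f : ℝ × ℝ → ℝ) (O : Set (ℝ × ℝ)) : Prop where
  contDiffOn : ContDiffOn ℝ 1 f O
  diff_uv : ∀ x ∈ O, DifferentiableAt ℝ (fun v => dU f (x.1, v)) x.2
  diff_vu : ∀ x ∈ O, DifferentiableAt ℝ (fun u => dV f (u, x.2)) x.1
  cont_uv : ContinuousOn (dV (dU f)) O
  cont_vu : ContinuousOn (dU (dV f)) O

/-- Classical regularity of the metric functions and the matter fields on `Y` (up to and including
any boundary points of `Y`, so on a neighbourhood of `Y`). Every component of the Einstein, wave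
and Maxwell equations makes classical sense in this class. -/
def RegularFields (Y : Set (ℝ × ℝ)) (Ω r φ e : ℝ × ℝ → ℝ) : Prop :=
  ∃ O : Set (ℝ × ℝ), IsOpen O ∧ Y ⊆ O ∧
    ContDiffOn ℝ 2 r O ∧ MixedC2On Ω O ∧ MixedC2On φ O ∧ ContDiffOn ℝ 1 e O ∧
    ∀ x ∈ Y, 0 < Ω x

/-! The conformal class of `-du dv` on the plane, time-oriented by `∂_u + ∂_v`: the causal order is
the product order on `ℝ × ℝ`, so `J⁻(p) = Set.Iic p`, and `I⁻`-related points are those with both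
coordinates strictly ordered. -/

/-- The causal past of a set. -/
def JMinus (X : Set (ℝ × ℝ)) : Set (ℝ × ℝ) := {z | ∃ x ∈ X, z ≤ x}

/-- A past-directed (continuous) causal curve in `M`, parametrized by `[0, ∞)`. -/
def IsPastCausalCurve (M : Set (ℝ × ℝ)) (c : ℝ → ℝ × ℝ) : Prop :=
  ContinuousOn c (Ici 0) ∧ AntitoneOn c (Ici 0) ∧ MapsTo c (Ici 0) M

/-- The causal curve `c` in `M` is past-inextendible: it has no past endpoint in `M` from which
a nonconstant past-directed causal curve in `M` issues. (A curve that ends on the spacelike past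
boundary is thus inextendible, one that ends at an interior point or on the timelike boundary,
away from its past end, is not.) -/
def IsPastInextendible (M : Set (ℝ × ℝ)) (c : ℝ → ℝ × ℝ) : Prop :=
  IsPastCausalCurve M c ∧
    ∀ y ∈ M, Tendsto c atTop (𝓝 y) →
      ∀ d, IsPastCausalCurve M d → d 0 = y → ∀ t, 0 ≤ t → d t = y

/-- The future domain of dependence of `X`: the points `x` of the closure of `Q` such that every
past-inextendible causal curve in `Q ∪ {x}` from `x` meets `X`. -/
def DPlus (Q X : Set (ℝ × ℝ)) : Set (ℝ × ℝ) :=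
  {x | x ∈ closure Q ∧
    ∀ c, IsPastInextendible (insert x Q) c → c 0 = x → ∃ t, 0 ≤ t ∧ c t ∈ X}

/-- The compact set `X ⊆ Q` generates `J⁻(p)`: `J⁻(p) ∩ Q ⊆ D⁺(X) ∪ J⁻(X)`. -/
def Generates (Q X : Set (ℝ × ℝ)) (p : ℝ × ℝ) : Prop :=
  IsCompact X ∧ X ⊆ Q ∧ Iic p ∩ Q ⊆ DPlus Q X ∪ JMinus X

/-- `J⁻(p) ∩ Q` is an eventually compactly generated indecomposable past set (these are
nonempty by definition). -/
def EventuallyCompactlyGenerated (Q : Set (ℝ × ℝ)) (p : ℝ × ℝ) : Prop :=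
  p ∈ closure Q ∧ (Iic p ∩ Q).Nonempty ∧ ∃ X, Generates Q X p

/-- `p` is a first singularity. -/
def IsFirstSingularity (Q : Set (ℝ × ℝ)) (p : ℝ × ℝ) : Prop :=
  p ∈ closure Q \ Q ∧ EventuallyCompactlyGenerated Q p ∧
    ∀ p₁, EventuallyCompactlyGenerated Q p₁ → Iic p₁ ∩ Q ⊂ Iic p ∩ Q →
      ∃ q ∈ Q, Iic p₁ ∩ Q = Iic q ∩ Q

/-- Any two distinct points of `S` are spacelike related, and `S` is connected. -/
def IsSpacelikeCurve (S : Set (ℝ × ℝ)) : Prop :=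
  IsPreconnected S ∧
    S.Pairwise fun a b => (a.1 < b.1 ∧ b.2 < a.2) ∨ (b.1 < a.1 ∧ a.2 < b.2)

/-- Any two distinct points of `G` are timelike related, and `G` is connected. -/
def IsTimelikeCurve (G : Set (ℝ × ℝ)) : Prop :=
  IsPreconnected G ∧
    G.Pairwise fun a b => (a.1 < b.1 ∧ a.2 < b.2) ∨ (b.1 < a.1 ∧ b.2 < a.2)

/-- The region to the future of `S`, to the right of `Γ` and to the left of `I`: the points both of
whose past null rays reach the past boundary, the ray of constant `u` in `S ∪ Γ` and the ray of
constant `v` in `S ∪ I`. -/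
def boundedRegion (S Γ I : Set (ℝ × ℝ)) : Set (ℝ × ℝ) :=
  {z | (∃ c ∈ S ∪ Γ, c.1 = z.1 ∧ c.2 ≤ z.2) ∧
    ((∃ b ∈ S, b.2 = z.2 ∧ b.1 ≤ z.1) ∨ ∃ b ∈ I, b.2 = z.2 ∧ b.1 < z.1)}

/-- The quotient `Q` of an evolutionary spacetime, as a subset of the `(u, v)` plane: a surface
with boundary consisting of a spacelike curve `S` and a timelike curve `Γ` which meet in a single
point (the left end of `S` and the past end of `Γ`). The set `I` is the part of infinity, if any,
from which ingoing null curves emanate (the timelike infinity of an asymptotically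
anti-de Sitter spacetime); it starts where `S` ends. For asymptotically flat spacetimes `I = ∅`. -/
structure IsEvolutionaryRegion (Q S Γ I : Set (ℝ × ℝ)) : Prop where
  spacelike : IsSpacelikeCurve S
  timelike : IsTimelikeCurve Γ
  timelike_infinity : IsTimelikeCurve I
  corner : ∃ o, S ∩ Γ = {o} ∧ (∀ s ∈ S, s.1 ≤ o.1) ∧ ∀ c ∈ Γ, o ≤ c
  infinity_start : I.Nonempty → ∃ i ∈ I, i ∈ closure S ∧ ∀ j ∈ I, i ≤ j
  infinity_disjoint : Disjoint I Q
  boundary_subset : S ∪ Γ ⊆ Q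
  subset_region : Q ⊆ boundedRegion S Γ I
  isOpen_interior : IsOpen (Q \ (S ∪ Γ))
  relatively_open : ∃ O, IsOpen O ∧ Q = O ∩ boundedRegion S Γ I
  past_closed : ∀ q ∈ Q, ∀ z ∈ boundedRegion S Γ I, z ≤ q → z ∈ Q

/-- The trapped region. (Points of the centre `Γ`, where `r = 0` is minimal, are never trapped.) -/
def trappedRegion (Q Γ : Set (ℝ × ℝ)) (r : ℝ × ℝ → ℝ) : Set (ℝ × ℝ) :=
  {q | q ∈ Q \ Γ ∧ dV r q < 0}

/-- `C⁰` norm on `Y`. -/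
def normC0 (f : ℝ × ℝ → ℝ) (Y : Set (ℝ × ℝ)) : ℝ≥0∞ := ⨆ x ∈ Y, ‖f x‖ₑ

/-- `C¹` norm on `Y`. -/
def normC1 (f : ℝ × ℝ → ℝ) (Y : Set (ℝ × ℝ)) : ℝ≥0∞ :=
  normC0 f Y ⊔ normC0 (dU f) Y ⊔ normC0 (dV f) Y

/-- `C²` norm on `Y`. -/
def normC2 (f : ℝ × ℝ → ℝ) (Y : Set (ℝ × ℝ)) : ℝ≥0∞ :=
  normC0 f Y ⊔ normC1 (dU f) Y ⊔ normC1 (dV f) Y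

/-- `N(Y) = sup {|Ω|₁, |Ω⁻¹|₀, |r|₂, |r⁻¹|₁}`. -/
def geomNorm (Ω r : ℝ × ℝ → ℝ) (Y : Set (ℝ × ℝ)) : ℝ≥0∞ :=
  normC1 Ω Y ⊔ normC0 (fun x => (Ω x)⁻¹) Y ⊔ normC2 r Y ⊔ normC1 (fun x => (r x)⁻¹) Y

/-- The extension criterion: for a first singularity `p` off the closure of the centre and a
compact `X ⊆ Q \ Γ` generating `J⁻(p)`, the norm `N(D⁺(X) \ {p})` (defined for subsets of
`Q \ Γ`) is infinite. -/
def ExtensionCriterion (Q Γ : Set (ℝ × ℝ)) (Ω r : ℝ × ℝ → ℝ) : Prop :=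
  ∀ p, IsFirstSingularity Q p → p ∉ closure Γ →
    ∀ X, Generates Q X p → X ⊆ Q \ Γ → DPlus Q X \ {p} ⊆ Q \ Γ →
      geomNorm Ω r (DPlus Q X \ {p}) = ⊤

/-- `r ≥ 0` on `Q`, the centre `Γ` is the set of points where `r = 0`, `r → ∞` at `I`, and
`ν = ∂_u r` is negative on the spacelike boundary `S` (off the centre) and near `I`. -/
structure RadiusConditions (Q S Γ I : Set (ℝ × ℝ)) (r : ℝ × ℝ → ℝ) : Prop where
  nonneg : ∀ x ∈ Q, 0 ≤ r x
  centre : ∀ x ∈ Q, r x = 0 ↔ x ∈ Γ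
  infinity : ∀ i ∈ I, Tendsto r (𝓝[Q] i) atTop
  nu_neg_initial : ∀ s ∈ S \ Γ, dU r s < 0
  nu_neg_infinity : ∀ i ∈ I, ∀ᶠ x in 𝓝[Q \ Γ] i, dU r x < 0

end

noncomputable section

/-! ### Coordinate derivatives of separated functions -/

section Separated

variable {n : ℕ}

/-! Suppose `p` is a first singularity off the closure of the centre and some generating compact set
`X` has no trapped point in `J⁻(p) ∩ Q ∩ D⁺(X)`. The contradiction comes from bounding the geometry
in a small characteristic rectangle with future corner `p`.

Causal geometry. A point `z ≤ p` near `p`, `z ≠ p`, is a limit of points of `Q` in its own past, and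
that past is generated by the same compact set but is strictly smaller. Since `p` is a first
singularity, `z` lies in `Q` (`IsFirstSingularity.mem_of_le`). Hence a rectangle with only its
future corner `p` removed lies in the interior of `Q` (`exists_rect_of_isFirstSingularity`); most of
the work there is to show that both past null rays of `p` reach the past boundary. As `p` is not in
`J⁻(X)`, the rectangle may be shrunk into `D⁺(X)` (`eventually_mem_dPlus`), so `∂_v r ≥ 0` on it.
Raychaudhuri's equation in `u` carries `∂_u r < 0` from `S` or infinity to all of `Q \ Γ`
(`dU_neg`).

Analysis. Write `ν = ∂_u r < 0` and `λ = ∂_v r ≥ 0`. Monotonicity bounds `r` and `1/r`, and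
Raychaudhuri in `u` gives `Ω² ≤ K(-ν)`. The lower bound on `V` and the sign of `νλ` give `-∂_v ν ≤
AΩ²`, so Gronwall's inequality bounds `ν`, and hence `Ω²`. The decisive quantity is `|∇r|² = -4νλ/Ω²
≥ 0`: Raychaudhuri in `v` gives `∂_v|∇r|² ≤ 4Aλ - c(∂_vφ)²`, which bounds `λ` and the flux of
`(∂_vφ)²` along outgoing rays (`bdd_lam_and_flux`). This controls `φ`, then `∂_uφ` and `∂_vφ` by the
wave equation; the charge is conserved; the conformal equation controls the derivatives of `log Ω`,
and Raychaudhuri the remaining second derivatives of `r` (`geomNorm_lt_top`).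

Conclusion. The past faces of the rectangle also generate `J⁻(p)`, and their domain of dependence
stays in the closed rectangle (`generates_pastFaces`, `dPlus_pastFaces_subset`). The extension
criterion for them contradicts the bound. -/

lemma continuous_baseCoord : Continuous (baseCoord : (Fin 2 ⊕ Fin n → ℝ) → ℝ × ℝ) := by
  unfold baseCoord; fun_prop

lemma continuous_fibreCoord : Continuous (fibreCoord : (Fin 2 ⊕ Fin n → ℝ) → Fin n → ℝ) := by
  unfold fibreCoord; fun_prop

lemma pd_inl_zero (H : ℝ × ℝ → (Fin n → ℝ) → ℝ) (x : Fin 2 ⊕ Fin n → ℝ) :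
    pd (Sum.inl 0) (fun y => H (baseCoord y) (fibreCoord y)) x =
      dU (fun z => H z (fibreCoord x)) (baseCoord x) := by
  have h' : ∀ t : ℝ, fibreCoord (x + t • (Pi.single (Sum.inl 0) 1 : Fin 2 ⊕ Fin n → ℝ)) =
      fibreCoord x := fun t => by ext i; simp [fibreCoord]
  simp only [pd, lineDeriv, h', dU, baseCoord]
  have := deriv_comp_const_add (fun u => H (u, x (Sum.inl 1)) (fibreCoord x)) (x (Sum.inl 0)) 0
  simpa using this

lemma pd_inl_one (H : ℝ × ℝ → (Fin n → ℝ) → ℝ) (x : Fin 2 ⊕ Fin n → ℝ) :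
    pd (Sum.inl 1) (fun y => H (baseCoord y) (fibreCoord y)) x =
      dV (fun z => H z (fibreCoord x)) (baseCoord x) := by
  have h' : ∀ t : ℝ, fibreCoord (x + t • (Pi.single (Sum.inl 1) 1 : Fin 2 ⊕ Fin n → ℝ)) =
      fibreCoord x := fun t => by ext i; simp [fibreCoord]
  simp only [pd, lineDeriv, h', dV, baseCoord]
  have := deriv_comp_const_add (fun u => H (x (Sum.inl 0), u) (fibreCoord x)) (x (Sum.inl 1)) 0
  simpa using this

lemma pd_inr (H : ℝ × ℝ → (Fin n → ℝ) → ℝ) (i : Fin n) (x : Fin 2 ⊕ Fin n → ℝ) :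
    pd (Sum.inr i) (fun y => H (baseCoord y) (fibreCoord y)) x =
      pd i (H (baseCoord x)) (fibreCoord x) := by
  have h : ∀ t : ℝ, baseCoord (x + t • (Pi.single (Sum.inr i) 1 : Fin 2 ⊕ Fin n → ℝ)) =
      baseCoord x := fun t => by simp [baseCoord]
  have h' : ∀ t : ℝ, fibreCoord (x + t • (Pi.single (Sum.inr i) 1 : Fin 2 ⊕ Fin n → ℝ)) =
      fibreCoord x + t • Pi.single i 1 := fun t => by
    ext j; simp [fibreCoord, Pi.single_apply]
  simp only [pd, lineDeriv, h, h']

lemma pd_congr {ι : Type*} [Fintype ι] [DecidableEq ι] {f g : (ι → ℝ) → ℝ} {x : ι → ℝ}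
    (h : f =ᶠ[𝓝 x] g) (i : ι) : pd i f x = pd i g x := h.lineDeriv_eq

lemma pd_const {ι : Type*} [Fintype ι] [DecidableEq ι] (c : ℝ) (i : ι) (x : ι → ℝ) :
    pd i (fun _ => c) x = 0 := by simp [pd, lineDeriv]

lemma pd_const_mul {ι : Type*} [Fintype ι] [DecidableEq ι] (c : ℝ) (f : (ι → ℝ) → ℝ) (i : ι)
    (x : ι → ℝ) : pd i (fun y => c * f y) x = c * pd i f x := by
  simp only [pd, lineDeriv]; rw [deriv_const_mul_field]

lemma dU_mul_const (f : ℝ × ℝ → ℝ) (c : ℝ) (z : ℝ × ℝ) :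
    dU (fun z => f z * c) z = dU f z * c := by
  simp only [dU]; rw [deriv_mul_const_field]

lemma dV_mul_const (f : ℝ × ℝ → ℝ) (c : ℝ) (z : ℝ × ℝ) :
    dV (fun z => f z * c) z = dV f z * c := by
  simp only [dV]; rw [deriv_mul_const_field]

lemma pd_inl_zero_sep (F : ℝ × ℝ → ℝ) (G : (Fin n → ℝ) → ℝ) (x : Fin 2 ⊕ Fin n → ℝ) :
    pd (Sum.inl 0) (fun y => F (baseCoord y) * G (fibreCoord y)) x =
      dU F (baseCoord x) * G (fibreCoord x) := by
  rw [pd_inl_zero (fun z w => F z * G w), dU_mul_const]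

lemma pd_inl_one_sep (F : ℝ × ℝ → ℝ) (G : (Fin n → ℝ) → ℝ) (x : Fin 2 ⊕ Fin n → ℝ) :
    pd (Sum.inl 1) (fun y => F (baseCoord y) * G (fibreCoord y)) x =
      dV F (baseCoord x) * G (fibreCoord x) := by
  rw [pd_inl_one (fun z w => F z * G w), dV_mul_const]

lemma pd_inr_sep (F : ℝ × ℝ → ℝ) (G : (Fin n → ℝ) → ℝ) (i : Fin n) (x : Fin 2 ⊕ Fin n → ℝ) :
    pd (Sum.inr i) (fun y => F (baseCoord y) * G (fibreCoord y)) x =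
      F (baseCoord x) * pd i G (fibreCoord x) := by
  rw [pd_inr (fun z w => F z * G w), pd_const_mul]

lemma pd_inl_zero_base (F : ℝ × ℝ → ℝ) (x : Fin 2 ⊕ Fin n → ℝ) :
    pd (Sum.inl 0) (fun y => F (baseCoord y)) x = dU F (baseCoord x) :=
  pd_inl_zero (fun z _ => F z) x

lemma pd_inl_one_base (F : ℝ × ℝ → ℝ) (x : Fin 2 ⊕ Fin n → ℝ) :
    pd (Sum.inl 1) (fun y => F (baseCoord y)) x = dV F (baseCoord x) :=
  pd_inl_one (fun z _ => F z) x

lemma pd_inr_base (F : ℝ × ℝ → ℝ) (i : Fin n) (x : Fin 2 ⊕ Fin n → ℝ) :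
    pd (Sum.inr i) (fun y => F (baseCoord y)) x = 0 := by
  rw [pd_inr (fun z _ => F z), pd_const]

lemma pd_inr_fibre (G : (Fin n → ℝ) → ℝ) (i : Fin n) (x : Fin 2 ⊕ Fin n → ℝ) :
    pd (Sum.inr i) (fun y => G (fibreCoord y)) x = pd i G (fibreCoord x) :=
  pd_inr (fun _ w => G w) i x

end Separated

/-! ### Functions of two variables -/

section Plane

variable {f : ℝ × ℝ → ℝ} {O : Set (ℝ × ℝ)} {z : ℝ × ℝ}

lemma DifferentiableAt.slice_left (h : DifferentiableAt ℝ f z) :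
    DifferentiableAt ℝ (fun u => f (u, z.2)) z.1 :=
  DifferentiableAt.comp (g := f) (f := fun u : ℝ => (u, z.2)) z.1 h (by fun_prop)

lemma DifferentiableAt.slice_right (h : DifferentiableAt ℝ f z) :
    DifferentiableAt ℝ (fun v => f (z.1, v)) z.2 :=
  DifferentiableAt.comp (g := f) (f := fun v : ℝ => (z.1, v)) z.2 h (by fun_prop)

lemma dU_eq_fderiv (h : DifferentiableAt ℝ f z) : dU f z = fderiv ℝ f z (1, 0) := by
  have h1 : HasDerivAt (fun u : ℝ => (u, z.2)) ((1 : ℝ), (0 : ℝ)) z.1 :=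
    (hasDerivAt_id z.1).prodMk (hasDerivAt_const _ _)
  exact (HasFDerivAt.comp_hasDerivAt (l := f) z.1 h.hasFDerivAt h1).deriv

lemma dV_eq_fderiv (h : DifferentiableAt ℝ f z) : dV f z = fderiv ℝ f z (0, 1) := by
  have h1 : HasDerivAt (fun v : ℝ => (z.1, v)) ((0 : ℝ), (1 : ℝ)) z.2 :=
    (hasDerivAt_const _ _).prodMk (hasDerivAt_id z.2)
  exact (HasFDerivAt.comp_hasDerivAt (l := f) z.2 h.hasFDerivAt h1).deriv

lemma hasDerivAt_left (h : DifferentiableAt ℝ (fun u => f (u, z.2)) z.1) :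
    HasDerivAt (fun u => f (u, z.2)) (dU f z) z.1 := h.hasDerivAt

lemma hasDerivAt_right (h : DifferentiableAt ℝ (fun v => f (z.1, v)) z.2) :
    HasDerivAt (fun v => f (z.1, v)) (dV f z) z.2 := h.hasDerivAt

lemma contDiffOn_dU {m : WithTop ℕ∞} (hO : IsOpen O) (h : ContDiffOn ℝ (m + 1) f O) :
    ContDiffOn ℝ m (dU f) O := by
  have h1 : ContDiffOn ℝ m (fderiv ℝ f) O := h.fderiv_of_isOpen hO le_rfl
  refine (h1.clm_apply contDiffOn_const : ContDiffOn ℝ m (fun z => fderiv ℝ f z (1, 0)) O).congr ?_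
  intro z hz
  exact dU_eq_fderiv ((h.differentiableOn (by simp)).differentiableAt (hO.mem_nhds hz))

lemma contDiffOn_dV {m : WithTop ℕ∞} (hO : IsOpen O) (h : ContDiffOn ℝ (m + 1) f O) :
    ContDiffOn ℝ m (dV f) O := by
  have h1 : ContDiffOn ℝ m (fderiv ℝ f) O := h.fderiv_of_isOpen hO le_rfl
  refine (h1.clm_apply contDiffOn_const : ContDiffOn ℝ m (fun z => fderiv ℝ f z (0, 1)) O).congr ?_
  intro z hz
  exact dV_eq_fderiv ((h.differentiableOn (by simp)).differentiableAt (hO.mem_nhds hz))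

lemma MixedC2On.mono {P : Set (ℝ × ℝ)} (h : MixedC2On f O) (hP : P ⊆ O) : MixedC2On f P where
  contDiffOn := h.contDiffOn.mono hP
  diff_uv x hx := h.diff_uv x (hP hx)
  diff_vu x hx := h.diff_vu x (hP hx)
  cont_uv := h.cont_uv.mono hP
  cont_vu := h.cont_vu.mono hP

lemma ContDiffOn.mixedC2On (hO : IsOpen O) (h : ContDiffOn ℝ 2 f O) : MixedC2On f O := by
  have hu : ContDiffOn ℝ 1 (dU f) O := contDiffOn_dU hO (by simpa [one_add_one_eq_two] using h)
  have hv : ContDiffOn ℝ 1 (dV f) O := contDiffOn_dV hO (by simpa [one_add_one_eq_two] using h)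
  refine ⟨h.of_le (by norm_num), fun x hx => ?_, fun x hx => ?_, ?_, ?_⟩
  · exact ((hu.differentiableOn (by simp)).differentiableAt (hO.mem_nhds hx)).slice_right
  · exact ((hv.differentiableOn (by simp)).differentiableAt (hO.mem_nhds hx)).slice_left
  · exact (contDiffOn_dV (m := 0) hO (by simpa using hu)).continuousOn
  · exact (contDiffOn_dU (m := 0) hO (by simpa using hv)).continuousOn

lemma MixedC2On.differentiableAt (h : MixedC2On f O) (hO : IsOpen O) (hz : z ∈ O) :
    DifferentiableAt ℝ f z :=
  (h.contDiffOn.differentiableOn (by simp)).differentiableAt (hO.mem_nhds hz)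

/-- The second difference of `f` over a small rectangle is realized by a mixed derivative. -/
lemma exists_dV_dU_eq_diff {a b c d : ℝ} (hab : a < b) (hcd : c < d)
    (h1 : ∀ z ∈ Icc a b ×ˢ Icc c d, DifferentiableAt ℝ f z)
    (h2 : ∀ z ∈ Icc a b ×ˢ Icc c d, DifferentiableAt ℝ (fun v => dU f (z.1, v)) z.2) :
    ∃ z ∈ Icc a b ×ˢ Icc c d, dV (dU f) z * ((b - a) * (d - c)) =
      f (b, d) - f (b, c) - f (a, d) + f (a, c) := by
  have hd : ∀ u ∈ Icc a b, HasDerivAt (fun u => f (u, d) - f (u, c)) (dU f (u, d) - dU f (u, c)) u :=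
    fun u hu => (h1 (u, d) ⟨hu, right_mem_Icc.2 hcd.le⟩).slice_left.hasDerivAt.sub
      (h1 (u, c) ⟨hu, left_mem_Icc.2 hcd.le⟩).slice_left.hasDerivAt
  obtain ⟨ξ, hξ, e1⟩ := exists_hasDerivAt_eq_slope _ _ hab
    (fun u hu => (hd u hu).continuousAt.continuousWithinAt)
    (fun u hu => hd u (Ioo_subset_Icc_self hu))
  have hd' : ∀ v ∈ Icc c d, HasDerivAt (fun v => dU f (ξ, v)) (dV (dU f) (ξ, v)) v :=
    fun v hv => (h2 (ξ, v) ⟨Ioo_subset_Icc_self hξ, hv⟩).hasDerivAt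
  obtain ⟨η, hη, e2⟩ := exists_hasDerivAt_eq_slope _ _ hcd
    (fun v hv => (hd' v hv).continuousAt.continuousWithinAt)
    (fun v hv => hd' v (Ioo_subset_Icc_self hv))
  refine ⟨(ξ, η), ⟨Ioo_subset_Icc_self hξ, Ioo_subset_Icc_self hη⟩, ?_⟩
  rw [eq_div_iff (by linarith)] at e1 e2
  linear_combination (b - a) * e2 + e1

lemma exists_dU_dV_eq_diff {a b c d : ℝ} (hab : a < b) (hcd : c < d)
    (h1 : ∀ z ∈ Icc a b ×ˢ Icc c d, DifferentiableAt ℝ f z)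
    (h2 : ∀ z ∈ Icc a b ×ˢ Icc c d, DifferentiableAt ℝ (fun u => dV f (u, z.2)) z.1) :
    ∃ z ∈ Icc a b ×ˢ Icc c d, dU (dV f) z * ((b - a) * (d - c)) =
      f (b, d) - f (b, c) - f (a, d) + f (a, c) := by
  have hd : ∀ v ∈ Icc c d, HasDerivAt (fun v => f (b, v) - f (a, v)) (dV f (b, v) - dV f (a, v)) v :=
    fun v hv => (h1 (b, v) ⟨right_mem_Icc.2 hab.le, hv⟩).slice_right.hasDerivAt.sub
      (h1 (a, v) ⟨left_mem_Icc.2 hab.le, hv⟩).slice_right.hasDerivAt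
  obtain ⟨η, hη, e1⟩ := exists_hasDerivAt_eq_slope _ _ hcd
    (fun v hv => (hd v hv).continuousAt.continuousWithinAt)
    (fun v hv => hd v (Ioo_subset_Icc_self hv))
  have hd' : ∀ u ∈ Icc a b, HasDerivAt (fun u => dV f (u, η)) (dU (dV f) (u, η)) u :=
    fun u hu => (h2 (u, η) ⟨hu, Ioo_subset_Icc_self hη⟩).hasDerivAt
  obtain ⟨ξ, hξ, e2⟩ := exists_hasDerivAt_eq_slope _ _ hab
    (fun u hu => (hd' u hu).continuousAt.continuousWithinAt)
    (fun u hu => hd' u (Ioo_subset_Icc_self hu))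
  refine ⟨(ξ, η), ⟨Ioo_subset_Icc_self hξ, Ioo_subset_Icc_self hη⟩, ?_⟩
  rw [eq_div_iff (by linarith)] at e1 e2
  linear_combination (d - c) * e2 + e1

/-- Continuous mixed second derivatives agree. -/
lemma MixedC2On.symm (h : MixedC2On f O) (hO : IsOpen O) (hz : z ∈ O) :
    dV (dU f) z = dU (dV f) z := by
  by_contra hne
  have c1 := h.cont_uv.continuousAt (hO.mem_nhds hz)
  have c2 := h.cont_vu.continuousAt (hO.mem_nhds hz)
  set ε := |dV (dU f) z - dU (dV f) z| / 2 with hε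
  have hpos : 0 < ε := half_pos (abs_pos.2 (sub_ne_zero.2 hne))
  obtain ⟨δ, hδ, hball⟩ := Metric.mem_nhds_iff.1 (inter_mem (hO.mem_nhds hz)
    (inter_mem (c1 (Metric.ball_mem_nhds _ hpos)) (c2 (Metric.ball_mem_nhds _ hpos))))
  have hsub : Icc z.1 (z.1 + δ / 2) ×ˢ Icc z.2 (z.2 + δ / 2) ⊆ Metric.ball z δ := by
    rintro w ⟨⟨h1, h2⟩, h3, h4⟩
    rw [Metric.mem_ball, Prod.dist_eq, max_lt_iff, Real.dist_eq, Real.dist_eq, abs_lt, abs_lt]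
    constructor <;> constructor <;> linarith
  -- Both mixed derivatives realize the same second difference over one square, though perhaps at
  -- different points. Each varies there by less than half of the supposed gap between them.
  obtain ⟨w, hw, e1⟩ := exists_dV_dU_eq_diff (f := f) (a := z.1) (b := z.1 + δ / 2) (c := z.2)
    (d := z.2 + δ / 2) (by linarith) (by linarith)
    (fun y hy => h.differentiableAt hO (hball (hsub hy)).1)
    (fun y hy => h.diff_uv y (hball (hsub hy)).1)
  obtain ⟨w', hw', e2⟩ := exists_dU_dV_eq_diff (f := f) (a := z.1) (b := z.1 + δ / 2) (c := z.2)
    (d := z.2 + δ / 2) (by linarith) (by linarith)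
    (fun y hy => h.differentiableAt hO (hball (hsub hy)).1)
    (fun y hy => h.diff_vu y (hball (hsub hy)).1)
  have e3 : dV (dU f) w = dU (dV f) w' := by
    have hp : (z.1 + δ / 2 - z.1) * (z.2 + δ / 2 - z.2) ≠ 0 := by
      have : 0 < δ / 2 * (δ / 2) := by positivity
      ring_nf at this ⊢
      exact this.ne'
    exact mul_right_cancel₀ hp (e1.trans e2.symm)
  have b1 : |dV (dU f) w - dV (dU f) z| < ε := (hball (hsub hw)).2.1
  have b2 : |dU (dV f) w' - dU (dV f) z| < ε := (hball (hsub hw')).2.2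
  rw [e3] at b1
  have : |dV (dU f) z - dU (dV f) z| < ε + ε := by
    rw [abs_lt] at b1 b2 ⊢
    constructor <;> linarith [b1.1, b1.2, b2.1, b2.2]
  rw [hε] at this
  linarith

end Plane

/-! ### Curvature of the warped metric -/

section Warped

variable {n : ℕ} {Ω r : ℝ × ℝ → ℝ} {γ : (Fin n → ℝ) → Matrix (Fin n) (Fin n) ℝ}

lemma warpedMetric_inl_inl (a b : Fin 2) (x : Fin 2 ⊕ Fin n → ℝ) :
    warpedMetric Ω r γ x (Sum.inl a) (Sum.inl b) =
      if a = b then 0 else -(Ω (baseCoord x)) ^ 2 / 2 := by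
  fin_cases a <;> fin_cases b <;> simp [warpedMetric]

lemma warpedMetric_inl_inr (a : Fin 2) (j : Fin n) (x : Fin 2 ⊕ Fin n → ℝ) :
    warpedMetric Ω r γ x (Sum.inl a) (Sum.inr j) = 0 := by
  simp [warpedMetric]

lemma warpedMetric_inr_inl (i : Fin n) (b : Fin 2) (x : Fin 2 ⊕ Fin n → ℝ) :
    warpedMetric Ω r γ x (Sum.inr i) (Sum.inl b) = 0 := by
  simp [warpedMetric]

lemma warpedMetric_inr_inr (i j : Fin n) (x : Fin 2 ⊕ Fin n → ℝ) :
    warpedMetric Ω r γ x (Sum.inr i) (Sum.inr j) = r (baseCoord x) ^ 2 * γ (fibreCoord x) i j := by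
  simp [warpedMetric]

lemma warpedMetric_inv {x : Fin 2 ⊕ Fin n → ℝ} (hΩ : Ω (baseCoord x) ≠ 0)
    (hr : r (baseCoord x) ≠ 0) (hγ : IsUnit (γ (fibreCoord x)).det) :
    (warpedMetric Ω r γ x)⁻¹ = Matrix.fromBlocks
      !![0, -2 / Ω (baseCoord x) ^ 2; -2 / Ω (baseCoord x) ^ 2, 0] 0 0
      ((r (baseCoord x) ^ 2)⁻¹ • (γ (fibreCoord x))⁻¹) := by
  apply Matrix.inv_eq_right_inv
  rw [warpedMetric, Matrix.fromBlocks_multiply, ← Matrix.fromBlocks_one]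
  congr 1
  · ext i j
    fin_cases i <;> fin_cases j <;> simp <;> field_simp
  · simp
  · simp
  · simp [smul_smul, Matrix.mul_nonsing_inv _ hγ, hr]

/-- A point at which the warped metric is regular: `Ω`, `r` are positive and differentiable and
the fibre metric is positive definite. -/
structure WarpedRegularAt (Ω r : ℝ × ℝ → ℝ) (γ : (Fin n → ℝ) → Matrix (Fin n) (Fin n) ℝ)
    (x : Fin 2 ⊕ Fin n → ℝ) : Prop where
  Ω_pos : 0 < Ω (baseCoord x)
  r_pos : 0 < r (baseCoord x)
  Ω_diff : DifferentiableAt ℝ Ω (baseCoord x)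
  r_diff : DifferentiableAt ℝ r (baseCoord x)
  posDef : (γ (fibreCoord x)).PosDef

namespace WarpedRegularAt

variable {x : Fin 2 ⊕ Fin n → ℝ}

lemma isUnit_det (h : WarpedRegularAt Ω r γ x) : IsUnit (γ (fibreCoord x)).det :=
  h.posDef.det_pos.ne'.isUnit

lemma symm (h : WarpedRegularAt Ω r γ x) (i j : Fin n) :
    γ (fibreCoord x) i j = γ (fibreCoord x) j i := by
  simpa using (h.posDef.isHermitian.apply j i)

lemma inv_eq (h : WarpedRegularAt Ω r γ x) : (warpedMetric Ω r γ x)⁻¹ = Matrix.fromBlocks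
      !![0, -2 / Ω (baseCoord x) ^ 2; -2 / Ω (baseCoord x) ^ 2, 0] 0 0
      ((r (baseCoord x) ^ 2)⁻¹ • (γ (fibreCoord x))⁻¹) :=
  warpedMetric_inv h.Ω_pos.ne' h.r_pos.ne' h.isUnit_det

lemma inv_inl_inl (h : WarpedRegularAt Ω r γ x) (a b : Fin 2) :
    (warpedMetric Ω r γ x)⁻¹ (Sum.inl a) (Sum.inl b) =
      if a = b then 0 else -2 / Ω (baseCoord x) ^ 2 := by
  rw [h.inv_eq]; fin_cases a <;> fin_cases b <;> simp

lemma inv_inl_inr (h : WarpedRegularAt Ω r γ x) (a : Fin 2) (j : Fin n) :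
    (warpedMetric Ω r γ x)⁻¹ (Sum.inl a) (Sum.inr j) = 0 := by
  rw [h.inv_eq]; simp

lemma inv_inr_inl (h : WarpedRegularAt Ω r γ x) (i : Fin n) (b : Fin 2) :
    (warpedMetric Ω r γ x)⁻¹ (Sum.inr i) (Sum.inl b) = 0 := by
  rw [h.inv_eq]; simp

lemma inv_inr_inr (h : WarpedRegularAt Ω r γ x) (i j : Fin n) :
    (warpedMetric Ω r γ x)⁻¹ (Sum.inr i) (Sum.inr j) =
      (r (baseCoord x) ^ 2)⁻¹ * (γ (fibreCoord x))⁻¹ i j := by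
  rw [h.inv_eq]; simp

lemma sum_inv_mul (h : WarpedRegularAt Ω r γ x) (i j : Fin n) :
    ∑ d, (γ (fibreCoord x))⁻¹ i d * γ (fibreCoord x) d j = if i = j then 1 else 0 := by
  rw [← Matrix.mul_apply, Matrix.nonsing_inv_mul _ h.isUnit_det, Matrix.one_apply]

lemma dU_sq_Ω (h : WarpedRegularAt Ω r γ x) : dU (fun z => -(Ω z) ^ 2 / 2) (baseCoord x) =
    -(Ω (baseCoord x) * dU Ω (baseCoord x)) := by
  have := ((hasDerivAt_left h.Ω_diff.slice_left).pow 2).neg.div_const 2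
  refine this.deriv.trans ?_
  simp; ring

lemma dV_sq_Ω (h : WarpedRegularAt Ω r γ x) : dV (fun z => -(Ω z) ^ 2 / 2) (baseCoord x) =
    -(Ω (baseCoord x) * dV Ω (baseCoord x)) := by
  have := ((hasDerivAt_right h.Ω_diff.slice_right).pow 2).neg.div_const 2
  refine this.deriv.trans ?_
  simp; ring

lemma dU_sq_r (h : WarpedRegularAt Ω r γ x) : dU (fun z => r z ^ 2) (baseCoord x) =
    2 * r (baseCoord x) * dU r (baseCoord x) := by
  have := (hasDerivAt_left h.r_diff.slice_left).pow 2
  refine this.deriv.trans ?_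
  simp

lemma dV_sq_r (h : WarpedRegularAt Ω r γ x) : dV (fun z => r z ^ 2) (baseCoord x) =
    2 * r (baseCoord x) * dV r (baseCoord x) := by
  have := (hasDerivAt_right h.r_diff.slice_right).pow 2
  refine this.deriv.trans ?_
  simp

lemma pd_zero_metric (h : WarpedRegularAt Ω r γ x) (a b : Fin 2) :
    pd (Sum.inl 0) (fun y => warpedMetric Ω r γ y (Sum.inl a) (Sum.inl b)) x =
      if a = b then 0 else -(Ω (baseCoord x) * dU Ω (baseCoord x)) := by
  simp only [warpedMetric_inl_inl]
  split_ifs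
  · exact pd_const _ _ _
  · exact (pd_inl_zero_base (fun z => -(Ω z) ^ 2 / 2) x).trans h.dU_sq_Ω

lemma pd_one_metric (h : WarpedRegularAt Ω r γ x) (a b : Fin 2) :
    pd (Sum.inl 1) (fun y => warpedMetric Ω r γ y (Sum.inl a) (Sum.inl b)) x =
      if a = b then 0 else -(Ω (baseCoord x) * dV Ω (baseCoord x)) := by
  simp only [warpedMetric_inl_inl]
  split_ifs
  · exact pd_const _ _ _
  · exact (pd_inl_one_base (fun z => -(Ω z) ^ 2 / 2) x).trans h.dV_sq_Ω

lemma pd_zero_metric_fibre (h : WarpedRegularAt Ω r γ x) (i j : Fin n) :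
    pd (Sum.inl 0) (fun y => warpedMetric Ω r γ y (Sum.inr i) (Sum.inr j)) x =
      2 * r (baseCoord x) * dU r (baseCoord x) * γ (fibreCoord x) i j := by
  simp only [warpedMetric_inr_inr]
  rw [pd_inl_zero_sep (fun z => r z ^ 2) (fun w => γ w i j), h.dU_sq_r]

lemma pd_one_metric_fibre (h : WarpedRegularAt Ω r γ x) (i j : Fin n) :
    pd (Sum.inl 1) (fun y => warpedMetric Ω r γ y (Sum.inr i) (Sum.inr j)) x =
      2 * r (baseCoord x) * dV r (baseCoord x) * γ (fibreCoord x) i j := by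
  simp only [warpedMetric_inr_inr]
  rw [pd_inl_one_sep (fun z => r z ^ 2) (fun w => γ w i j), h.dV_sq_r]

end WarpedRegularAt

lemma pd_inr_metric (k : Fin n) (a b : Fin 2) (x : Fin 2 ⊕ Fin n → ℝ) :
    pd (Sum.inr k) (fun y => warpedMetric Ω r γ y (Sum.inl a) (Sum.inl b)) x = 0 := by
  simp only [warpedMetric_inl_inl]
  exact pd_inr_base (fun z => if a = b then 0 else -(Ω z) ^ 2 / 2) k x

lemma pd_inr_metric_fibre (k i j : Fin n) (x : Fin 2 ⊕ Fin n → ℝ) :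
    pd (Sum.inr k) (fun y => warpedMetric Ω r γ y (Sum.inr i) (Sum.inr j)) x =
      r (baseCoord x) ^ 2 * pd k (fun w => γ w i j) (fibreCoord x) := by
  simp only [warpedMetric_inr_inr]
  rw [pd_inr_sep (fun z => r z ^ 2) (fun w => γ w i j)]

lemma pd_metric_inl_inr (s : Fin 2 ⊕ Fin n) (a : Fin 2) (j : Fin n) (x : Fin 2 ⊕ Fin n → ℝ) :
    pd s (fun y => warpedMetric Ω r γ y (Sum.inl a) (Sum.inr j)) x = 0 := by
  simp only [warpedMetric_inl_inr, pd_const]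

lemma pd_metric_inr_inl (s : Fin 2 ⊕ Fin n) (i : Fin n) (b : Fin 2) (x : Fin 2 ⊕ Fin n → ℝ) :
    pd s (fun y => warpedMetric Ω r γ y (Sum.inr i) (Sum.inl b)) x = 0 := by
  simp only [warpedMetric_inr_inl, pd_const]

namespace WarpedRegularAt

variable {x : Fin 2 ⊕ Fin n → ℝ}

/-- The Christoffel symbols `Γ^a_{bc}` with all indices in the base. -/
lemma christoffel_base (h : WarpedRegularAt Ω r γ x) (a b c : Fin 2) :
    christoffel (warpedMetric Ω r γ) (Sum.inl a) (Sum.inl b) (Sum.inl c) x =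
      if a = b ∧ a = c then
        2 * (if a = 0 then dU Ω (baseCoord x) else dV Ω (baseCoord x)) / Ω (baseCoord x)
      else 0 := by
  have hΩ := h.Ω_pos.ne'
  fin_cases a <;> fin_cases b <;> fin_cases c <;>
    simp [christoffel, h.inv_inl_inl, h.inv_inl_inr, h.pd_zero_metric, h.pd_one_metric] <;>
    field_simp <;> ring

lemma christoffel_inl_inl_inr (h : WarpedRegularAt Ω r γ x) (a b : Fin 2) (j : Fin n) :
    christoffel (warpedMetric Ω r γ) (Sum.inl a) (Sum.inl b) (Sum.inr j) x = 0 := by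
  simp [christoffel, h.inv_inl_inl, h.inv_inl_inr, pd_metric_inl_inr, pd_inr_metric]

lemma christoffel_inl_inr_inl (h : WarpedRegularAt Ω r γ x) (a b : Fin 2) (j : Fin n) :
    christoffel (warpedMetric Ω r γ) (Sum.inl a) (Sum.inr j) (Sum.inl b) x = 0 := by
  simp [christoffel, h.inv_inl_inl, h.inv_inl_inr, pd_metric_inr_inl, pd_inr_metric]

lemma christoffel_inr_inl_inl (h : WarpedRegularAt Ω r γ x) (a b : Fin 2) (j : Fin n) :
    christoffel (warpedMetric Ω r γ) (Sum.inr j) (Sum.inl a) (Sum.inl b) x = 0 := by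
  simp [christoffel, h.inv_inr_inr, h.inv_inr_inl, pd_metric_inl_inr, pd_metric_inr_inl,
    pd_inr_metric]

lemma christoffel_inl_inr_inr (h : WarpedRegularAt Ω r γ x) (a : Fin 2) (i j : Fin n) :
    christoffel (warpedMetric Ω r γ) (Sum.inl a) (Sum.inr i) (Sum.inr j) x =
      2 * r (baseCoord x) * (if a = 0 then dV r (baseCoord x) else dU r (baseCoord x)) /
        Ω (baseCoord x) ^ 2 * γ (fibreCoord x) i j := by
  have hΩ := h.Ω_pos.ne'
  fin_cases a <;>
    simp [christoffel, h.inv_inl_inl, h.inv_inl_inr, pd_metric_inl_inr, pd_metric_inr_inl,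
      h.pd_zero_metric_fibre, h.pd_one_metric_fibre] <;> field_simp

lemma christoffel_inr_inl_inr (h : WarpedRegularAt Ω r γ x) (a : Fin 2) (i j : Fin n) :
    christoffel (warpedMetric Ω r γ) (Sum.inr i) (Sum.inl a) (Sum.inr j) x =
      if i = j then (if a = 0 then dU r (baseCoord x) else dV r (baseCoord x)) / r (baseCoord x)
      else 0 := by
  have hr := h.r_pos.ne'
  have key : ∀ c : ℝ, 2⁻¹ * ∑ d, (r (baseCoord x) ^ 2)⁻¹ * (γ (fibreCoord x))⁻¹ i d *
      (2 * r (baseCoord x) * c * γ (fibreCoord x) d j) =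
      if i = j then c / r (baseCoord x) else 0 := by
    intro c
    have : ∀ d, (r (baseCoord x) ^ 2)⁻¹ * (γ (fibreCoord x))⁻¹ i d *
      (2 * r (baseCoord x) * c * γ (fibreCoord x) d j) =
      2 * c / r (baseCoord x) * ((γ (fibreCoord x))⁻¹ i d * γ (fibreCoord x) d j) := fun d => by
        field_simp
    simp only [this, ← Finset.mul_sum, h.sum_inv_mul]
    split_ifs
    · field_simp
    · simp
  fin_cases a <;>
    simp [christoffel, h.inv_inr_inr, h.inv_inr_inl, pd_metric_inl_inr,
      h.pd_zero_metric_fibre, h.pd_one_metric_fibre, key]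

lemma christoffel_inr_inr_inl (h : WarpedRegularAt Ω r γ x) (a : Fin 2) (i j : Fin n) :
    christoffel (warpedMetric Ω r γ) (Sum.inr i) (Sum.inr j) (Sum.inl a) x =
      if i = j then (if a = 0 then dU r (baseCoord x) else dV r (baseCoord x)) / r (baseCoord x)
      else 0 := by
  rw [← h.christoffel_inr_inl_inr]
  fin_cases a <;>
    simp [christoffel, h.inv_inr_inr, h.inv_inr_inl, pd_metric_inl_inr, pd_metric_inr_inl,
      h.pd_zero_metric_fibre, h.pd_one_metric_fibre, h.symm _ j]

lemma christoffel_fibre (h : WarpedRegularAt Ω r γ x) (i j k : Fin n) :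
    christoffel (warpedMetric Ω r γ) (Sum.inr i) (Sum.inr j) (Sum.inr k) x =
      christoffel γ i j k (fibreCoord x) := by
  have hr := h.r_pos.ne'
  simp only [christoffel, Fintype.sum_sum_type, h.inv_inr_inr, h.inv_inr_inl, pd_inr_metric_fibre,
    zero_mul, Finset.sum_const_zero, zero_add]
  congr 1
  refine Finset.sum_congr rfl fun d _ => ?_
  field_simp

end WarpedRegularAt

end Warped

/-! ### Ricci tensor of the warped product -/

section WarpedRicci

variable {n : ℕ} {Ω r : ℝ × ℝ → ℝ} {γ : (Fin n → ℝ) → Matrix (Fin n) (Fin n) ℝ}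
  {x : Fin 2 ⊕ Fin n → ℝ}

lemma pd_christoffel_base (hx : ∀ᶠ y in 𝓝 x, WarpedRegularAt Ω r γ y) (s a b c : Fin 2) :
    pd (Sum.inl s) (christoffel (warpedMetric Ω r γ) (Sum.inl a) (Sum.inl b) (Sum.inl c)) x =
      if a = b ∧ a = c then
        (if s = 0 then dU (fun z => 2 * (if a = 0 then dU Ω z else dV Ω z) / Ω z) (baseCoord x)
          else dV (fun z => 2 * (if a = 0 then dU Ω z else dV Ω z) / Ω z) (baseCoord x))
      else 0 := by
  rw [pd_congr (hx.mono fun y hy => hy.christoffel_base a b c)]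
  by_cases hbc : a = b ∧ a = c
  · simp only [if_pos hbc]
    fin_cases s
    · exact pd_inl_zero_base (fun z => 2 * (if a = 0 then dU Ω z else dV Ω z) / Ω z) x
    · exact pd_inl_one_base (fun z => 2 * (if a = 0 then dU Ω z else dV Ω z) / Ω z) x
  · simp only [if_neg hbc]
    exact pd_const _ _ _

lemma pd_christoffel_inr_inl_inl (hx : ∀ᶠ y in 𝓝 x, WarpedRegularAt Ω r γ y)
    (s : Fin 2 ⊕ Fin n) (i : Fin n) (b c : Fin 2) :
    pd s (christoffel (warpedMetric Ω r γ) (Sum.inr i) (Sum.inl b) (Sum.inl c)) x = 0 := by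
  rw [pd_congr (hx.mono fun y hy => hy.christoffel_inr_inl_inl b c i), pd_const]

lemma pd_christoffel_inl_inl_inr (hx : ∀ᶠ y in 𝓝 x, WarpedRegularAt Ω r γ y)
    (s : Fin 2 ⊕ Fin n) (i : Fin n) (a b : Fin 2) :
    pd s (christoffel (warpedMetric Ω r γ) (Sum.inl a) (Sum.inl b) (Sum.inr i)) x = 0 := by
  rw [pd_congr (hx.mono fun y hy => hy.christoffel_inl_inl_inr a b i), pd_const]

lemma pd_christoffel_inr_inr_inl (hx : ∀ᶠ y in 𝓝 x, WarpedRegularAt Ω r γ y)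
    (s c : Fin 2) (i : Fin n) :
    pd (Sum.inl s) (christoffel (warpedMetric Ω r γ) (Sum.inr i) (Sum.inr i) (Sum.inl c)) x =
      if s = 0 then dU (fun z => (if c = 0 then dU r z else dV r z) / r z) (baseCoord x)
      else dV (fun z => (if c = 0 then dU r z else dV r z) / r z) (baseCoord x) := by
  rw [pd_congr (hx.mono fun y hy => hy.christoffel_inr_inr_inl c i i)]
  simp only [if_true]
  fin_cases s
  · exact pd_inl_zero_base (fun z => (if c = 0 then dU r z else dV r z) / r z) x
  · exact pd_inl_one_base (fun z => (if c = 0 then dU r z else dV r z) / r z) x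

lemma pd_christoffel_inl_inr_inr (hx : ∀ᶠ y in 𝓝 x, WarpedRegularAt Ω r γ y)
    (a : Fin 2) (i j : Fin n) :
    pd (Sum.inl a) (christoffel (warpedMetric Ω r γ) (Sum.inl a) (Sum.inr i) (Sum.inr j)) x =
      (if a = 0 then dU (fun z => 2 * r z * dV r z / Ω z ^ 2) (baseCoord x)
        else dV (fun z => 2 * r z * dU r z / Ω z ^ 2) (baseCoord x)) * γ (fibreCoord x) i j := by
  rw [pd_congr (hx.mono fun y hy => hy.christoffel_inl_inr_inr a i j)]
  split_ifs with h1
  · subst h1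
    exact pd_inl_zero_sep (fun z => 2 * r z * dV r z / Ω z ^ 2) (fun w => γ w i j) x
  · obtain rfl : a = 1 := by omega
    exact pd_inl_one_sep (fun z => 2 * r z * dU r z / Ω z ^ 2) (fun w => γ w i j) x

lemma pd_christoffel_fibre (hx : ∀ᶠ y in 𝓝 x, WarpedRegularAt Ω r γ y) (s i j k : Fin n) :
    pd (Sum.inr s) (christoffel (warpedMetric Ω r γ) (Sum.inr i) (Sum.inr j) (Sum.inr k)) x =
      pd s (christoffel γ i j k) (fibreCoord x) := by
  rw [pd_congr (hx.mono fun y hy => hy.christoffel_fibre i j k)]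
  exact pd_inr_fibre _ s x

/-- The two-dimensional base metric contributes a multiple of itself, which has no `uu` component.
Only the fibre term `-(n/r)` times the Hessian of `r` survives, and `2 ∂_uΩ/Ω` is the sole
Christoffel symbol in it. -/
lemma ricci_uu (hx : ∀ᶠ y in 𝓝 x, WarpedRegularAt Ω r γ y)
    (hd : DifferentiableAt ℝ (fun u => dU r (u, (baseCoord x).2)) (baseCoord x).1) :
    ricci (warpedMetric Ω r γ) x (Sum.inl 0) (Sum.inl 0) =
      -(n / r (baseCoord x)) * (dU (dU r) (baseCoord x) -
        2 * dU Ω (baseCoord x) / Ω (baseCoord x) * dU r (baseCoord x)) := by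
  have h := hx.self_of_nhds
  have hr := h.r_pos.ne'
  have hΩ := h.Ω_pos.ne'
  have e1 : dU (fun z => dU r z / r z) (baseCoord x) =
      dU (dU r) (baseCoord x) / r (baseCoord x) -
        dU r (baseCoord x) ^ 2 / r (baseCoord x) ^ 2 := by
    refine ((hasDerivAt_left (f := dU r) hd).div (hasDerivAt_left h.r_diff.slice_left)
      hr).deriv.trans ?_
    simp only [Prod.mk.eta]
    field_simp
  simp [ricci, Fintype.sum_sum_type, pd_christoffel_base hx, pd_christoffel_inr_inl_inl hx,
    pd_christoffel_inr_inr_inl hx, h.christoffel_base, h.christoffel_inr_inl_inl,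
    h.christoffel_inl_inl_inr, h.christoffel_inl_inr_inl, h.christoffel_inr_inl_inr,
    h.christoffel_inr_inr_inl, e1]
  field_simp
  ring

lemma ricci_vv (hx : ∀ᶠ y in 𝓝 x, WarpedRegularAt Ω r γ y)
    (hd : DifferentiableAt ℝ (fun v => dV r ((baseCoord x).1, v)) (baseCoord x).2) :
    ricci (warpedMetric Ω r γ) x (Sum.inl 1) (Sum.inl 1) =
      -(n / r (baseCoord x)) * (dV (dV r) (baseCoord x) -
        2 * dV Ω (baseCoord x) / Ω (baseCoord x) * dV r (baseCoord x)) := by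
  have h := hx.self_of_nhds
  have hr := h.r_pos.ne'
  have hΩ := h.Ω_pos.ne'
  have e1 : dV (fun z => dV r z / r z) (baseCoord x) =
      dV (dV r) (baseCoord x) / r (baseCoord x) -
        dV r (baseCoord x) ^ 2 / r (baseCoord x) ^ 2 := by
    refine ((hasDerivAt_right (f := dV r) hd).div (hasDerivAt_right h.r_diff.slice_right)
      hr).deriv.trans ?_
    simp only [Prod.mk.eta]
    field_simp
  simp [ricci, Fintype.sum_sum_type, pd_christoffel_base hx, pd_christoffel_inr_inl_inl hx,
    pd_christoffel_inr_inr_inl hx, h.christoffel_base, h.christoffel_inr_inl_inl,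
    h.christoffel_inl_inl_inr, h.christoffel_inl_inr_inl, h.christoffel_inr_inl_inr,
    h.christoffel_inr_inr_inl, e1]
  field_simp
  ring

/-- The order of differentiation is kept as it occurs in the Ricci formula. This component becomes a
transport equation in `v` for `∂_u log Ω`, and the transposed one a transport equation in `u` for
`∂_v log Ω`. -/
lemma ricci_uv (hx : ∀ᶠ y in 𝓝 x, WarpedRegularAt Ω r γ y)
    (hd : DifferentiableAt ℝ (fun v => dU r ((baseCoord x).1, v)) (baseCoord x).2) :
    ricci (warpedMetric Ω r γ) x (Sum.inl 0) (Sum.inl 1) =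
      -dV (fun z => 2 * dU Ω z / Ω z) (baseCoord x) -
        n / r (baseCoord x) * dV (dU r) (baseCoord x) := by
  have h := hx.self_of_nhds
  have hr := h.r_pos.ne'
  have hΩ := h.Ω_pos.ne'
  have e1 : dV (fun z => dU r z / r z) (baseCoord x) =
      dV (dU r) (baseCoord x) / r (baseCoord x) -
        dU r (baseCoord x) * dV r (baseCoord x) / r (baseCoord x) ^ 2 := by
    refine ((hasDerivAt_right (f := dU r) hd).div (hasDerivAt_right h.r_diff.slice_right)
      hr).deriv.trans ?_
    simp only [Prod.mk.eta]
    field_simp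
  simp [ricci, Fintype.sum_sum_type, pd_christoffel_base hx, pd_christoffel_inr_inl_inl hx,
    pd_christoffel_inr_inr_inl hx, h.christoffel_base, h.christoffel_inr_inl_inl,
    h.christoffel_inl_inl_inr, h.christoffel_inl_inr_inl, h.christoffel_inr_inl_inr,
    h.christoffel_inr_inr_inl, e1]
  field_simp
  ring

lemma ricci_vu (hx : ∀ᶠ y in 𝓝 x, WarpedRegularAt Ω r γ y)
    (hd : DifferentiableAt ℝ (fun u => dV r (u, (baseCoord x).2)) (baseCoord x).1) :
    ricci (warpedMetric Ω r γ) x (Sum.inl 1) (Sum.inl 0) =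
      -dU (fun z => 2 * dV Ω z / Ω z) (baseCoord x) -
        n / r (baseCoord x) * dU (dV r) (baseCoord x) := by
  have h := hx.self_of_nhds
  have hr := h.r_pos.ne'
  have hΩ := h.Ω_pos.ne'
  have e1 : dU (fun z => dV r z / r z) (baseCoord x) =
      dU (dV r) (baseCoord x) / r (baseCoord x) -
        dU r (baseCoord x) * dV r (baseCoord x) / r (baseCoord x) ^ 2 := by
    refine ((hasDerivAt_left (f := dV r) hd).div (hasDerivAt_left h.r_diff.slice_left)
      hr).deriv.trans ?_
    simp only [Prod.mk.eta]
    field_simp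
  simp [ricci, Fintype.sum_sum_type, pd_christoffel_base hx, pd_christoffel_inr_inl_inl hx,
    pd_christoffel_inr_inr_inl hx, h.christoffel_base, h.christoffel_inr_inl_inl,
    h.christoffel_inl_inl_inr, h.christoffel_inl_inr_inl, h.christoffel_inr_inl_inr,
    h.christoffel_inr_inr_inl, e1]
  field_simp
  ring

/-- This is the warped product formula `Ric(γ) - (r □r + (n-1)|∇r|²) γ`, with `□` and `∇` those of
the base, where `□r = -4 ∂_u∂_v r/Ω²` and `|∇r|² = -4 ∂_u r ∂_v r/Ω²`. The symmetry `hs` merges the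
two mixed derivatives of `r`. -/
lemma ricci_fibre (hx : ∀ᶠ y in 𝓝 x, WarpedRegularAt Ω r γ y)
    (hd : DifferentiableAt ℝ (fun v => dU r ((baseCoord x).1, v)) (baseCoord x).2)
    (hd' : DifferentiableAt ℝ (fun u => dV r (u, (baseCoord x).2)) (baseCoord x).1)
    (hs : dV (dU r) (baseCoord x) = dU (dV r) (baseCoord x)) (i j : Fin n) :
    ricci (warpedMetric Ω r γ) x (Sum.inr i) (Sum.inr j) =
      ricci γ (fibreCoord x) i j + γ (fibreCoord x) i j * (4 / Ω (baseCoord x) ^ 2 *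
        (r (baseCoord x) * dV (dU r) (baseCoord x) +
          (n - 1) * (dU r (baseCoord x) * dV r (baseCoord x)))) := by
  have h := hx.self_of_nhds
  have hr := h.r_pos.ne'
  have hΩ := h.Ω_pos.ne'
  have e1 : dU (fun z => 2 * r z * dV r z / Ω z ^ 2) (baseCoord x) =
      2 * (dU r (baseCoord x) * dV r (baseCoord x) + r (baseCoord x) * dU (dV r) (baseCoord x)) /
        Ω (baseCoord x) ^ 2 - 4 * r (baseCoord x) * dV r (baseCoord x) * dU Ω (baseCoord x) /
          Ω (baseCoord x) ^ 3 := by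
    refine ((((hasDerivAt_left h.r_diff.slice_left).const_mul 2).mul
      (hasDerivAt_left (f := dV r) hd')).div ((hasDerivAt_left h.Ω_diff.slice_left).pow 2)
      (pow_ne_zero 2 hΩ)).deriv.trans ?_
    simp
    field_simp
    ring
  have e2 : dV (fun z => 2 * r z * dU r z / Ω z ^ 2) (baseCoord x) =
      2 * (dU r (baseCoord x) * dV r (baseCoord x) + r (baseCoord x) * dV (dU r) (baseCoord x)) /
        Ω (baseCoord x) ^ 2 - 4 * r (baseCoord x) * dU r (baseCoord x) * dV Ω (baseCoord x) /
          Ω (baseCoord x) ^ 3 := by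
    refine ((((hasDerivAt_right h.r_diff.slice_right).const_mul 2).mul
      (hasDerivAt_right (f := dU r) hd)).div ((hasDerivAt_right h.Ω_diff.slice_right).pow 2)
      (pow_ne_zero 2 hΩ)).deriv.trans ?_
    simp
    field_simp
    ring
  simp [ricci, Fintype.sum_sum_type, pd_christoffel_inl_inr_inr hx, pd_christoffel_fibre hx,
    pd_christoffel_inl_inl_inr hx, h.christoffel_base,
    h.christoffel_inl_inl_inr, h.christoffel_inl_inr_inl, h.christoffel_inr_inl_inr,
    h.christoffel_inr_inr_inl, h.christoffel_inl_inr_inr, h.christoffel_fibre, e1, e2, h.symm j i,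
    Finset.sum_add_distrib, Finset.sum_sub_distrib]
  rw [hs]
  field_simp
  ring

end WarpedRicci

/-! ### Stress-energy tensor of the scalar and Maxwell fields -/

section Matter

variable {n : ℕ} {Ω r φ e : ℝ × ℝ → ℝ} {γ : (Fin n → ℝ) → Matrix (Fin n) (Fin n) ℝ} {qm : ℝ}
  {V : ℝ → ℝ} {x : Fin 2 ⊕ Fin n → ℝ}

lemma fieldStrength_inl_inl (a b : Fin 2) (x : Fin 2 ⊕ Fin n → ℝ) :
    fieldStrength e qm γ x (Sum.inl a) (Sum.inl b) =
      if a = b then 0 else if a = 0 then e (baseCoord x) else -e (baseCoord x) := by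
  fin_cases a <;> fin_cases b <;> simp [fieldStrength]

lemma fieldStrength_inl_inr (a : Fin 2) (j : Fin n) (x : Fin 2 ⊕ Fin n → ℝ) :
    fieldStrength e qm γ x (Sum.inl a) (Sum.inr j) = 0 := by
  simp [fieldStrength]

lemma fieldStrength_inr_inl (i : Fin n) (b : Fin 2) (x : Fin 2 ⊕ Fin n → ℝ) :
    fieldStrength e qm γ x (Sum.inr i) (Sum.inl b) = 0 := by
  simp [fieldStrength]

/-- The magnetic part of the field strength, a two-form on the fibre. -/
def magneticField (qm : ℝ) (γ : (Fin n → ℝ) → Matrix (Fin n) (Fin n) ℝ) (w : Fin n → ℝ)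
    (i j : Fin n) : ℝ :=
  qm * Real.sqrt (γ w).det * leviCivita2 i j

lemma fieldStrength_inr_inr (i j : Fin n) (x : Fin 2 ⊕ Fin n → ℝ) :
    fieldStrength e qm γ x (Sum.inr i) (Sum.inr j) = magneticField qm γ (fibreCoord x) i j := by
  simp [fieldStrength, magneticField]

/-- The square `F_{ij} F^{ij}` of the magnetic field with respect to the fibre metric. -/
def magneticSq (qm : ℝ) (γ : (Fin n → ℝ) → Matrix (Fin n) (Fin n) ℝ) (w : Fin n → ℝ) : ℝ :=
  ∑ i, ∑ j, magneticField qm γ w i j *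
    ∑ k, ∑ l, (γ w)⁻¹ i k * (γ w)⁻¹ j l * magneticField qm γ w k l

/-- The fibre trace of `F_{iα} F_j{}^α`. -/
def magneticTrace (qm : ℝ) (γ : (Fin n → ℝ) → Matrix (Fin n) (Fin n) ℝ) (w : Fin n → ℝ) : ℝ :=
  ∑ i, ∑ j, (γ w)⁻¹ i j *
    ∑ k, ∑ l, (γ w)⁻¹ k l * magneticField qm γ w i k * magneticField qm γ w j l

/-- The Lagrangian `-½(∇φ)² - V(φ) - ¼F²` of the matter fields. -/
def lagrangian (Ω r φ e : ℝ × ℝ → ℝ) (V : ℝ → ℝ) (M : ℝ) (z : ℝ × ℝ) : ℝ :=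
  2 / Ω z ^ 2 * dU φ z * dV φ z - V (φ z) + 2 * (e z / Ω z ^ 2) ^ 2 - M / (4 * r z ^ 4)

/-- The energy flux `2 T_{uv}`. -/
def energyFlux (Ω r φ e : ℝ × ℝ → ℝ) (V : ℝ → ℝ) (M : ℝ) (z : ℝ × ℝ) : ℝ :=
  Ω z ^ 2 * (V (φ z) / 2 + (e z / Ω z ^ 2) ^ 2 + M / (8 * r z ^ 4))

namespace WarpedRegularAt

lemma gradSq_eq (h : WarpedRegularAt Ω r γ x) :
    gradSq (warpedMetric Ω r γ) (fun y => φ (baseCoord y)) x =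
      -4 / Ω (baseCoord x) ^ 2 * dU φ (baseCoord x) * dV φ (baseCoord x) := by
  simp [gradSq, Fintype.sum_sum_type, h.inv_inl_inl,
    pd_inl_zero_base φ, pd_inl_one_base φ, pd_inr_base φ]
  ring

lemma raiseField_inl_inl (h : WarpedRegularAt Ω r γ x) (a b : Fin 2) :
    raiseField (warpedMetric Ω r γ) (fieldStrength e qm γ) x (Sum.inl a) (Sum.inl b) =
      if a = b then 0 else (if a = 0 then -1 else 1) * (4 * e (baseCoord x) / Ω (baseCoord x) ^ 4) := by
  have hΩ := h.Ω_pos.ne'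
  fin_cases a <;> fin_cases b <;>
  simp [raiseField, Fintype.sum_sum_type, h.inv_inl_inl, h.inv_inl_inr,
    fieldStrength_inl_inl] <;> field_simp <;> ring

lemma raiseField_inl_inr (h : WarpedRegularAt Ω r γ x) (a : Fin 2) (j : Fin n) :
    raiseField (warpedMetric Ω r γ) (fieldStrength e qm γ) x (Sum.inl a) (Sum.inr j) = 0 := by
  simp [raiseField, Fintype.sum_sum_type, h.inv_inl_inr, h.inv_inr_inl, fieldStrength_inl_inr]

lemma raiseField_inr_inl (h : WarpedRegularAt Ω r γ x) (i : Fin n) (b : Fin 2) :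
    raiseField (warpedMetric Ω r γ) (fieldStrength e qm γ) x (Sum.inr i) (Sum.inl b) = 0 := by
  simp [raiseField, Fintype.sum_sum_type, h.inv_inl_inr, h.inv_inr_inl, fieldStrength_inr_inl]

lemma raiseField_inr_inr (h : WarpedRegularAt Ω r γ x) (i j : Fin n) :
    raiseField (warpedMetric Ω r γ) (fieldStrength e qm γ) x (Sum.inr i) (Sum.inr j) =
      (r (baseCoord x) ^ 4)⁻¹ * ∑ k, ∑ l, (γ (fibreCoord x))⁻¹ i k * (γ (fibreCoord x))⁻¹ j l *
        magneticField qm γ (fibreCoord x) k l := by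
  simp only [raiseField, Fintype.sum_sum_type, h.inv_inr_inl, h.inv_inr_inr,
    fieldStrength_inr_inr, zero_mul, mul_zero, Finset.sum_const_zero, zero_add, Finset.mul_sum]
  refine Finset.sum_congr rfl fun k _ => Finset.sum_congr rfl fun l _ => ?_
  rw [show r (baseCoord x) ^ 4 = r (baseCoord x) ^ 2 * r (baseCoord x) ^ 2 by ring, mul_inv]
  ring

lemma fieldSq_eq (h : WarpedRegularAt Ω r γ x) :
    fieldSq (warpedMetric Ω r γ) (fieldStrength e qm γ) x =
      -8 * (e (baseCoord x) / Ω (baseCoord x) ^ 2) ^ 2 +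
        magneticSq qm γ (fibreCoord x) / r (baseCoord x) ^ 4 := by
  have hΩ := h.Ω_pos.ne'
  have hm : ∑ i, ∑ j, magneticField qm γ (fibreCoord x) i j * ((r (baseCoord x) ^ 4)⁻¹ *
      ∑ k, ∑ l, (γ (fibreCoord x))⁻¹ i k * (γ (fibreCoord x))⁻¹ j l *
        magneticField qm γ (fibreCoord x) k l) =
      magneticSq qm γ (fibreCoord x) / r (baseCoord x) ^ 4 := by
    simp only [magneticSq, div_eq_inv_mul, Finset.mul_sum _ _ ((r (baseCoord x) ^ 4)⁻¹)]
    refine Finset.sum_congr rfl fun i _ => Finset.sum_congr rfl fun j _ => ?_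
    simp only [← Finset.mul_sum]
    ring
  simp only [fieldSq, Fintype.sum_sum_type, h.raiseField_inl_inl, h.raiseField_inl_inr,
    h.raiseField_inr_inl, h.raiseField_inr_inr, fieldStrength_inl_inl, fieldStrength_inr_inr,
    mul_zero, Finset.sum_const_zero, zero_add, add_zero, hm, Fin.sum_univ_two]
  simp
  field_simp
  ring

lemma lagrangian_eq (h : WarpedRegularAt Ω r γ x) :
    -(1 / 2) * gradSq (warpedMetric Ω r γ) (fun y => φ (baseCoord y)) x - V (φ (baseCoord x)) -
      (1 / 4) * fieldSq (warpedMetric Ω r γ) (fieldStrength e qm γ) x =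
      lagrangian Ω r φ e V (magneticSq qm γ (fibreCoord x)) (baseCoord x) := by
  have hr := h.r_pos.ne'
  have hΩ := h.Ω_pos.ne'
  rw [h.gradSq_eq, h.fieldSq_eq, lagrangian]
  field_simp
  ring

lemma stressTensor_uu (h : WarpedRegularAt Ω r γ x) :
    stressTensor (warpedMetric Ω r γ) (fieldStrength e qm γ) (fun y => φ (baseCoord y)) V x
      (Sum.inl 0) (Sum.inl 0) = 1 / 2 * dU φ (baseCoord x) ^ 2 := by
  simp [stressTensor, Fintype.sum_sum_type, h.inv_inl_inl, h.inv_inr_inl,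
    fieldStrength_inl_inl, fieldStrength_inl_inr, warpedMetric_inl_inl, pd_inl_zero_base φ]
  ring

lemma stressTensor_vv (h : WarpedRegularAt Ω r γ x) :
    stressTensor (warpedMetric Ω r γ) (fieldStrength e qm γ) (fun y => φ (baseCoord y)) V x
      (Sum.inl 1) (Sum.inl 1) = 1 / 2 * dV φ (baseCoord x) ^ 2 := by
  simp [stressTensor, Fintype.sum_sum_type, h.inv_inl_inl, h.inv_inr_inl,
    fieldStrength_inl_inl, fieldStrength_inl_inr, warpedMetric_inl_inl, pd_inl_one_base φ]
  ring

lemma stressTensor_uv (h : WarpedRegularAt Ω r γ x) :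
    2 * stressTensor (warpedMetric Ω r γ) (fieldStrength e qm γ) (fun y => φ (baseCoord y)) V x
      (Sum.inl 0) (Sum.inl 1) =
      energyFlux Ω r φ e V (magneticSq qm γ (fibreCoord x)) (baseCoord x) := by
  have hr := h.r_pos.ne'
  have hΩ := h.Ω_pos.ne'
  rw [stressTensor, h.lagrangian_eq]
  simp [Fintype.sum_sum_type, h.inv_inl_inl, h.inv_inr_inl,
    fieldStrength_inl_inl, fieldStrength_inl_inr, warpedMetric_inl_inl, pd_inl_one_base φ,
    pd_inl_zero_base φ, lagrangian, energyFlux]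
  field_simp
  ring

lemma stressTensor_vu (h : WarpedRegularAt Ω r γ x) :
    2 * stressTensor (warpedMetric Ω r γ) (fieldStrength e qm γ) (fun y => φ (baseCoord y)) V x
      (Sum.inl 1) (Sum.inl 0) =
      energyFlux Ω r φ e V (magneticSq qm γ (fibreCoord x)) (baseCoord x) := by
  have hr := h.r_pos.ne'
  have hΩ := h.Ω_pos.ne'
  rw [stressTensor, h.lagrangian_eq]
  simp [Fintype.sum_sum_type, h.inv_inl_inl, h.inv_inr_inl,
    fieldStrength_inl_inl, fieldStrength_inl_inr, warpedMetric_inl_inl, pd_inl_one_base φ,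
    pd_inl_zero_base φ, lagrangian, energyFlux]
  field_simp
  ring

lemma sum_inv_mul_metric (h : WarpedRegularAt Ω r γ x) :
    ∑ i, ∑ j, (γ (fibreCoord x))⁻¹ i j * γ (fibreCoord x) i j = n := by
  have : ∀ i, ∑ j, (γ (fibreCoord x))⁻¹ i j * γ (fibreCoord x) i j = 1 := fun i => by
    simp_rw [h.symm i]
    simpa using h.sum_inv_mul i i
  simp [this]

/-- Only the fibre trace of the Einstein equations is needed. After tracing, the magnetic field
enters through two scalars of the fibre, so its explicit form never has to be computed. -/
lemma trace_stressTensor (h : WarpedRegularAt Ω r γ x) :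
    ∑ i, ∑ j, (γ (fibreCoord x))⁻¹ i j * (2 * stressTensor (warpedMetric Ω r γ)
      (fieldStrength e qm γ) (fun y => φ (baseCoord y)) V x (Sum.inr i) (Sum.inr j)) =
      n * r (baseCoord x) ^ 2 *
        lagrangian Ω r φ e V (magneticSq qm γ (fibreCoord x)) (baseCoord x) +
      magneticTrace qm γ (fibreCoord x) / r (baseCoord x) ^ 2 := by
  have hr := h.r_pos.ne'
  set L := lagrangian Ω r φ e V (magneticSq qm γ (fibreCoord x)) (baseCoord x) with hL
  have hT : ∀ i j, 2 * stressTensor (warpedMetric Ω r γ)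
      (fieldStrength e qm γ) (fun y => φ (baseCoord y)) V x (Sum.inr i) (Sum.inr j) =
      r (baseCoord x) ^ 2 * L * γ (fibreCoord x) i j + (r (baseCoord x) ^ 2)⁻¹ *
        ∑ k, ∑ l, (γ (fibreCoord x))⁻¹ k l * magneticField qm γ (fibreCoord x) i k *
          magneticField qm γ (fibreCoord x) j l := by
    intro i j
    rw [stressTensor, h.lagrangian_eq, ← hL]
    simp only [Fintype.sum_sum_type, h.inv_inr_inr, fieldStrength_inr_inl,
      fieldStrength_inr_inr, warpedMetric_inr_inr, pd_inr_base φ, mul_zero, zero_mul,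
      Finset.sum_const_zero, zero_add, add_zero, mul_assoc, ← Finset.mul_sum]
    ring
  have hsum : ∀ a b : ℝ, ∑ i, ∑ j, (γ (fibreCoord x))⁻¹ i j * (a * γ (fibreCoord x) i j + b *
      ∑ k, ∑ l, (γ (fibreCoord x))⁻¹ k l * magneticField qm γ (fibreCoord x) i k *
          magneticField qm γ (fibreCoord x) j l) =
      a * n + b * magneticTrace qm γ (fibreCoord x) := by
    intro a b
    rw [← h.sum_inv_mul_metric, magneticTrace, Finset.mul_sum, Finset.mul_sum,
      ← Finset.sum_add_distrib]
    refine Finset.sum_congr rfl fun i _ => ?_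
    rw [Finset.mul_sum, Finset.mul_sum, ← Finset.sum_add_distrib]
    refine Finset.sum_congr rfl fun j _ => ?_
    ring
  simp only [hT, hsum]
  field_simp

end WarpedRegularAt

end Matter

/-! ### Reduction of the field equations to the `(u, v)` plane -/

section FieldEquations

variable {n : ℕ} {Ω r φ e : ℝ × ℝ → ℝ} {γ : (Fin n → ℝ) → Matrix (Fin n) (Fin n) ℝ} {qm k : ℝ}
  {V : ℝ → ℝ} {x : Fin 2 ⊕ Fin n → ℝ} {O : Set (ℝ × ℝ)} {W : Set (Fin n → ℝ)}

lemma WarpedRegularAt.volDensity_eq (h : WarpedRegularAt Ω r γ x) :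
    volDensity (warpedMetric Ω r γ) x =
      Ω (baseCoord x) ^ 2 / 2 * r (baseCoord x) ^ n * Real.sqrt (γ (fibreCoord x)).det := by
  have h1 : (warpedMetric Ω r γ x).det = -((Ω (baseCoord x) ^ 2 / 2 * r (baseCoord x) ^ n) ^ 2 *
      (γ (fibreCoord x)).det) := by
    rw [warpedMetric, Matrix.det_fromBlocks_zero₂₁, Matrix.det_smul, Matrix.det_fin_two]
    simp
    ring
  rw [volDensity, h1, abs_neg, abs_of_nonneg (mul_nonneg (sq_nonneg _) h.posDef.det_pos.le),
    Real.sqrt_mul (sq_nonneg _), Real.sqrt_sq]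
  have := h.Ω_pos
  have := h.r_pos
  positivity

/-- The functions `Ω`, `r`, `φ`, `e` on the open set `O` are of the class in which the reduced
field equations make sense. -/
structure RegularOn (Ω r φ e : ℝ × ℝ → ℝ) (O : Set (ℝ × ℝ)) : Prop where
  isOpen : IsOpen O
  Ω_pos : ∀ z ∈ O, 0 < Ω z
  r_pos : ∀ z ∈ O, 0 < r z
  r_reg : ContDiffOn ℝ 2 r O
  Ω_reg : MixedC2On Ω O
  φ_reg : MixedC2On φ O
  e_reg : ContDiffOn ℝ 1 e O

lemma RegularOn.eventually_regular (h : RegularOn Ω r φ e O) (hγ : IsEinsteinChart k W γ)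
    (hx : baseCoord x ∈ O) (hw : fibreCoord x ∈ W) : ∀ᶠ y in 𝓝 x, WarpedRegularAt Ω r γ y := by
  filter_upwards [continuous_baseCoord.continuousAt.eventually_mem (h.isOpen.mem_nhds hx),
    continuous_fibreCoord.continuousAt.eventually_mem (hγ.isOpen.mem_nhds hw)] with y h1 h2
  exact ⟨h.Ω_pos _ h1, h.r_pos _ h1, h.Ω_reg.differentiableAt h.isOpen h1,
    (h.r_reg.mixedC2On h.isOpen).differentiableAt h.isOpen h1, hγ.posDef _ h2⟩

/-- The reduced Einstein–scalar–Maxwell equations at `z`. -/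
structure ReducedEquationsAt (n : ℕ) (k M M' : ℝ) (V : ℝ → ℝ) (Ω r φ e : ℝ × ℝ → ℝ)
    (z : ℝ × ℝ) : Prop where
  raychaudhuri_u : n * (dU (dU r) z - 2 * dU Ω z / Ω z * dU r z) = -(r z * dU φ z ^ 2)
  raychaudhuri_v : n * (dV (dV r) z - 2 * dV Ω z / Ω z * dV r z) = -(r z * dV φ z ^ 2)
  radius : n * (k * (n - 1) + 4 / Ω z ^ 2 * (r z * dV (dU r) z + (n - 1) * (dU r z * dV r z))) =
    4 * r z ^ 2 * energyFlux Ω r φ e V M z / Ω z ^ 2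
  conformal_uv : -dV (fun z => 2 * dU Ω z / Ω z) z - n / r z * dV (dU r) z =
    energyFlux Ω r φ e V M z - 2 * energyFlux Ω r φ e V M z / n +
      Ω z ^ 2 / 2 * lagrangian Ω r φ e V M z + Ω z ^ 2 * M' / (2 * n * r z ^ 4)
  conformal_vu : -dU (fun z => 2 * dV Ω z / Ω z) z - n / r z * dU (dV r) z =
    energyFlux Ω r φ e V M z - 2 * energyFlux Ω r φ e V M z / n +
      Ω z ^ 2 / 2 * lagrangian Ω r φ e V M z + Ω z ^ 2 * M' / (2 * n * r z ^ 4)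
  wave : dV (dU φ) z = -(n / 2) * (dU r z * dV φ z + dV r z * dU φ z) / r z -
    Ω z ^ 2 * deriv V (φ z) / 4
  charge_u : dU (fun z => r z ^ n * e z / Ω z ^ 2) z = 0
  charge_v : dV (fun z => r z ^ n * e z / Ω z ^ 2) z = 0

lemma WarpedRegularAt.scalarCurvature_eq (h : WarpedRegularAt Ω r γ x) :
    scalarCurvature (warpedMetric Ω r γ) x =
      -2 / Ω (baseCoord x) ^ 2 * (ricci (warpedMetric Ω r γ) x (Sum.inl 0) (Sum.inl 1) +
        ricci (warpedMetric Ω r γ) x (Sum.inl 1) (Sum.inl 0)) +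
      (r (baseCoord x) ^ 2)⁻¹ * ∑ i, ∑ j, (γ (fibreCoord x))⁻¹ i j *
        ricci (warpedMetric Ω r γ) x (Sum.inr i) (Sum.inr j) := by
  simp [scalarCurvature, Fintype.sum_sum_type, h.inv_inl_inl, h.inv_inl_inr, h.inv_inr_inl,
    h.inv_inr_inr, Finset.mul_sum, mul_assoc]
  ring

lemma WarpedRegularAt.trace_einsteinTensor (h : WarpedRegularAt Ω r γ x) :
    ∑ i, ∑ j, (γ (fibreCoord x))⁻¹ i j *
      einsteinTensor (warpedMetric Ω r γ) x (Sum.inr i) (Sum.inr j) =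
    ∑ i, ∑ j, (γ (fibreCoord x))⁻¹ i j *
        ricci (warpedMetric Ω r γ) x (Sum.inr i) (Sum.inr j) -
      n * r (baseCoord x) ^ 2 / 2 * scalarCurvature (warpedMetric Ω r γ) x := by
  simp only [einsteinTensor, warpedMetric_inr_inr]
  rw [show n * r (baseCoord x) ^ 2 / 2 * scalarCurvature (warpedMetric Ω r γ) x =
    (r (baseCoord x) ^ 2 / 2 * scalarCurvature (warpedMetric Ω r γ) x) * n by ring,
    ← h.sum_inv_mul_metric, Finset.mul_sum, ← Finset.sum_sub_distrib]
  refine Finset.sum_congr rfl fun i _ => ?_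
  rw [Finset.mul_sum, ← Finset.sum_sub_distrib]
  refine Finset.sum_congr rfl fun j _ => ?_
  ring

/-- In `√|g| g^{uv} = -r^n √det γ` the conformal factor cancels, so inside the divergence only the
weight `r^n` is differentiated. -/
lemma RegularOn.waveOp_eq (h : RegularOn Ω r φ e O) (hγ : IsEinsteinChart k W γ) (hn : n ≠ 0)
    (hx : baseCoord x ∈ O) (hw : fibreCoord x ∈ W) :
    waveOp (warpedMetric Ω r γ) (fun y => φ (baseCoord y)) x =
      -4 / Ω (baseCoord x) ^ 2 * (dV (dU φ) (baseCoord x) + n / 2 *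
        (dU r (baseCoord x) * dV φ (baseCoord x) + dV r (baseCoord x) * dU φ (baseCoord x)) /
          r (baseCoord x)) := by
  have hev := h.eventually_regular hγ hx hw
  have hreg := hev.self_of_nhds
  have hΩ := hreg.Ω_pos.ne'
  have hr := hreg.r_pos.ne'
  have hγ0 : Real.sqrt (γ (fibreCoord x)).det ≠ 0 := (Real.sqrt_pos.2 hreg.posDef.det_pos).ne'
  have f0 : (fun y => volDensity (warpedMetric Ω r γ) y * ∑ ν, (warpedMetric Ω r γ y)⁻¹
      (Sum.inl 0) ν * pd ν (fun y => φ (baseCoord y)) y) =ᶠ[𝓝 x] fun y =>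
      -(r (baseCoord y) ^ n * dV φ (baseCoord y)) * Real.sqrt (γ (fibreCoord y)).det := by
    filter_upwards [hev] with y hy
    have := hy.Ω_pos.ne'
    rw [hy.volDensity_eq]
    simp [Fintype.sum_sum_type, hy.inv_inl_inl, hy.inv_inl_inr, pd_inl_one_base φ]
    field_simp
  have f1 : (fun y => volDensity (warpedMetric Ω r γ) y * ∑ ν, (warpedMetric Ω r γ y)⁻¹
      (Sum.inl 1) ν * pd ν (fun y => φ (baseCoord y)) y) =ᶠ[𝓝 x] fun y =>
      -(r (baseCoord y) ^ n * dU φ (baseCoord y)) * Real.sqrt (γ (fibreCoord y)).det := by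
    filter_upwards [hev] with y hy
    have := hy.Ω_pos.ne'
    rw [hy.volDensity_eq]
    simp [Fintype.sum_sum_type, hy.inv_inl_inl, hy.inv_inl_inr, pd_inl_zero_base φ]
    field_simp
  have f2 : ∀ i, (fun y => volDensity (warpedMetric Ω r γ) y * ∑ ν, (warpedMetric Ω r γ y)⁻¹
      (Sum.inr i) ν * pd ν (fun y => φ (baseCoord y)) y) =ᶠ[𝓝 x] fun _ => 0 := fun i => by
    filter_upwards [hev] with y hy
    simp [Fintype.sum_sum_type, hy.inv_inr_inl, pd_inr_base φ]
  have d0 : dU (fun z => -(r z ^ n * dV φ z)) (baseCoord x) =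
      -(n * r (baseCoord x) ^ (n - 1) * dU r (baseCoord x) * dV φ (baseCoord x) +
        r (baseCoord x) ^ n * dU (dV φ) (baseCoord x)) :=
    (((hasDerivAt_left hreg.r_diff.slice_left).pow n).mul
      (hasDerivAt_left (f := dV φ) (h.φ_reg.diff_vu _ hx))).neg.deriv
  have d1 : dV (fun z => -(r z ^ n * dU φ z)) (baseCoord x) =
      -(n * r (baseCoord x) ^ (n - 1) * dV r (baseCoord x) * dU φ (baseCoord x) +
        r (baseCoord x) ^ n * dV (dU φ) (baseCoord x)) :=
    (((hasDerivAt_right hreg.r_diff.slice_right).pow n).mul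
      (hasDerivAt_right (f := dU φ) (h.φ_reg.diff_uv _ hx))).neg.deriv
  have hpow : r (baseCoord x) ^ n = r (baseCoord x) ^ (n - 1) * r (baseCoord x) := by
    rw [← pow_succ, Nat.sub_add_cancel (Nat.one_le_iff_ne_zero.2 hn)]
  rw [waveOp, hreg.volDensity_eq, Fintype.sum_sum_type, Fin.sum_univ_two, pd_congr f0, pd_congr f1,
    Finset.sum_congr rfl fun i _ => pd_congr (f2 i) (Sum.inr i),
    pd_inl_zero_sep (fun z => -(r z ^ n * dV φ z)) (fun w => Real.sqrt (γ w).det),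
    pd_inl_one_sep (fun z => -(r z ^ n * dU φ z)) (fun w => Real.sqrt (γ w).det), d0, d1,
    ← h.φ_reg.symm h.isOpen hx, hpow]
  simp only [pd_const, Finset.sum_const_zero]
  field_simp
  ring

/-- Since `√|g| F^{uv} = -2 (r^n e/Ω²) √det γ` and the components of `F` mixing base and fibre
vanish, the `u` and `v` components of Maxwell's equations say that the charge `r^n e/Ω²` has zero
derivative in `v` and in `u`. -/
lemma RegularOn.charge_eq (h : RegularOn Ω r φ e O) (hγ : IsEinsteinChart k W γ)
    (hx : baseCoord x ∈ O) (hw : fibreCoord x ∈ W)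
    (hM : MaxwellAt (warpedMetric Ω r γ) (fieldStrength e qm γ) x) :
    dU (fun z => r z ^ n * e z / Ω z ^ 2) (baseCoord x) = 0 ∧
      dV (fun z => r z ^ n * e z / Ω z ^ 2) (baseCoord x) = 0 := by
  have hev := h.eventually_regular hγ hx hw
  have hreg := hev.self_of_nhds
  have hγ0 : Real.sqrt (γ (fibreCoord x)).det ≠ 0 := (Real.sqrt_pos.2 hreg.posDef.det_pos).ne'
  have f1 : ∀ a b : Fin 2, (fun y => volDensity (warpedMetric Ω r γ) y *
      raiseField (warpedMetric Ω r γ) (fieldStrength e qm γ) y (Sum.inl a) (Sum.inl b)) =ᶠ[𝓝 x]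
      fun y => (r (baseCoord y) ^ n * e (baseCoord y) / Ω (baseCoord y) ^ 2) *
        ((if a = b then 0 else if a = 0 then -2 else 2) * Real.sqrt (γ (fibreCoord y)).det) := by
    intro a b
    filter_upwards [hev] with y hy
    have := hy.Ω_pos.ne'
    rw [hy.volDensity_eq, hy.raiseField_inl_inl]
    split_ifs <;> field_simp <;> ring
  have f2 : ∀ (a : Fin 2) (i : Fin n), (fun y => volDensity (warpedMetric Ω r γ) y *
      raiseField (warpedMetric Ω r γ) (fieldStrength e qm γ) y (Sum.inl a) (Sum.inr i)) =ᶠ[𝓝 x]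
      fun _ => 0 := by
    intro a i
    filter_upwards [hev] with y hy
    rw [hy.raiseField_inl_inr, mul_zero]
  have key : ∀ a : Fin 2, _ := fun a => hM (Sum.inl a)
  simp only [Fintype.sum_sum_type, pd_congr (f2 _ _), pd_const, Finset.sum_const_zero, add_zero,
    Fin.sum_univ_two, pd_congr (f1 _ _)] at key
  have p0 := fun c : ℝ => pd_inl_zero_sep (fun z => r z ^ n * e z / Ω z ^ 2)
    (fun w => c * Real.sqrt (γ w).det) x
  have p1 := fun c : ℝ => pd_inl_one_sep (fun z => r z ^ n * e z / Ω z ^ 2)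
    (fun w => c * Real.sqrt (γ w).det) x
  simp only [p0, p1] at key
  have k0 := key 0
  have k1 := key 1
  simp [hγ0] at k0 k1
  exact ⟨k1, k0⟩

/-- One point `w` of the fibre is enough: the magnetic scalars at `w` are constants as far as the
`(u, v)` plane is concerned. -/
theorem RegularOn.reducedEquationsAt (h : RegularOn Ω r φ e O) (hγ : IsEinsteinChart k W γ)
    (hn : n ≠ 0) (hsol : SolvesEinsteinScalarMaxwell O W γ V Ω r φ e qm) {w : Fin n → ℝ}
    (hw : w ∈ W) {z : ℝ × ℝ} (hz : z ∈ O) :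
    ReducedEquationsAt n k (magneticSq qm γ w) (magneticTrace qm γ w) V Ω r φ e z := by
  obtain ⟨x, hxz, hxw⟩ : ∃ x : Fin 2 ⊕ Fin n → ℝ, baseCoord x = z ∧ fibreCoord x = w :=
    ⟨Sum.elim ![z.1, z.2] w, by simp [baseCoord], by ext i; simp [fibreCoord]⟩
  subst hxz hxw
  obtain ⟨hE, hW, hM⟩ := hsol x hz hw
  have hev := h.eventually_regular hγ hz hw
  have hreg := hev.self_of_nhds
  have hΩ := hreg.Ω_pos.ne'
  have hr := hreg.r_pos.ne'
  have hn' : (n : ℝ) ≠ 0 := Nat.cast_ne_zero.2 hn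
  have hr2 := h.r_reg.mixedC2On h.isOpen
  have hrU : ContDiffOn ℝ 1 (dU r) O :=
    contDiffOn_dU h.isOpen (by simpa [one_add_one_eq_two] using h.r_reg)
  have hrV : ContDiffOn ℝ 1 (dV r) O :=
    contDiffOn_dV h.isOpen (by simpa [one_add_one_eq_two] using h.r_reg)
  have hs := hr2.symm h.isOpen hz
  have duu := ((hrU.differentiableOn (by simp)).differentiableAt (h.isOpen.mem_nhds hz)).slice_left
  have dvv := ((hrV.differentiableOn (by simp)).differentiableAt (h.isOpen.mem_nhds hz)).slice_right
  have duv := hr2.diff_uv _ hz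
  have dvu := hr2.diff_vu _ hz
  have Euu := hE (Sum.inl 0) (Sum.inl 0)
  have Evv := hE (Sum.inl 1) (Sum.inl 1)
  have Euv := hE (Sum.inl 0) (Sum.inl 1)
  have Evu := hE (Sum.inl 1) (Sum.inl 0)
  rw [hreg.stressTensor_uu, einsteinTensor, warpedMetric_inl_inl, ricci_uu hev duu] at Euu
  rw [hreg.stressTensor_vv, einsteinTensor, warpedMetric_inl_inl, ricci_vv hev dvv] at Evv
  rw [hreg.stressTensor_uv, einsteinTensor, warpedMetric_inl_inl] at Euv
  rw [hreg.stressTensor_vu, einsteinTensor, warpedMetric_inl_inl] at Evu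
  have Etr := hreg.trace_einsteinTensor
  simp only [hE] at Etr
  rw [hreg.trace_stressTensor] at Etr
  have hR := hreg.scalarCurvature_eq
  have hA : ∑ i, ∑ j, (γ (fibreCoord x))⁻¹ i j *
      ricci (warpedMetric Ω r γ) x (Sum.inr i) (Sum.inr j) =
      n * (k * (n - 1) + 4 / Ω (baseCoord x) ^ 2 * (r (baseCoord x) * dV (dU r) (baseCoord x) +
          (n - 1) * (dU r (baseCoord x) * dV r (baseCoord x)))) := by
    obtain ⟨B, hB⟩ : ∃ B, B = k * (n - 1) + 4 / Ω (baseCoord x) ^ 2 * (r (baseCoord x) *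
      dV (dU r) (baseCoord x) + (n - 1) * (dU r (baseCoord x) * dV r (baseCoord x))) := ⟨_, rfl⟩
    have hij : ∀ i j, ricci (warpedMetric Ω r γ) x (Sum.inr i) (Sum.inr j) =
        B * γ (fibreCoord x) i j := fun i j => by
      rw [ricci_fibre hev duv dvu hs, hγ.einstein _ hw, hB]; ring
    simp only [hij, ← hB]
    rw [← hreg.sum_inv_mul_metric, Finset.sum_mul]
    refine Finset.sum_congr rfl fun i _ => ?_
    rw [Finset.sum_mul]
    refine Finset.sum_congr rfl fun j _ => ?_
    ring
  simp only [zero_ne_one, one_ne_zero, if_false, if_true] at Euu Evv Euv Evu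
  set A := ∑ i, ∑ j, (γ (fibreCoord x))⁻¹ i j *
      ricci (warpedMetric Ω r γ) x (Sum.inr i) (Sum.inr j) with hAdef
  set R := scalarCurvature (warpedMetric Ω r γ) x with hRdef
  set τ := energyFlux Ω r φ e V (magneticSq qm γ (fibreCoord x)) (baseCoord x) with hτ
  -- Substitute the `uv` and `vu` equations into the expression of `R` as a trace. As the base has
  -- dimension two, `R` cancels, and the fibre part `A` is determined by the flux alone.
  have hAτ : A = 4 * r (baseCoord x) ^ 2 * τ / Ω (baseCoord x) ^ 2 := by
    have h1 : ricci (warpedMetric Ω r γ) x (Sum.inl 0) (Sum.inl 1) =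
      τ - Ω (baseCoord x) ^ 2 / 4 * R := by linear_combination Euv
    have h2 : ricci (warpedMetric Ω r γ) x (Sum.inl 1) (Sum.inl 0) =
      τ - Ω (baseCoord x) ^ 2 / 4 * R := by linear_combination Evu
    rw [h1, h2] at hR
    have h3 : -2 / Ω (baseCoord x) ^ 2 * (τ - Ω (baseCoord x) ^ 2 / 4 * R +
        (τ - Ω (baseCoord x) ^ 2 / 4 * R)) = -4 * τ / Ω (baseCoord x) ^ 2 + R := by
      field_simp; ring
    rw [h3] at hR
    calc A = r (baseCoord x) ^ 2 * ((r (baseCoord x) ^ 2)⁻¹ * A) := by field_simp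
      _ = 4 * r (baseCoord x) ^ 2 * τ / Ω (baseCoord x) ^ 2 := by
        linear_combination -(r (baseCoord x) ^ 2) * hR
  -- With `A` known, the traced fibre equations can be solved for `R`; inserted in the `uv` and `vu`
  -- equations this yields the conformal equations.
  have hRτ : Ω (baseCoord x) ^ 2 / 4 * R = 2 * τ / n - Ω (baseCoord x) ^ 2 / 2 *
      lagrangian Ω r φ e V (magneticSq qm γ (fibreCoord x)) (baseCoord x) -
      Ω (baseCoord x) ^ 2 * magneticTrace qm γ (fibreCoord x) /
        (2 * n * r (baseCoord x) ^ 4) := by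
    rw [hAτ] at Etr
    field_simp at Etr ⊢
    linear_combination 2 * Etr
  obtain ⟨hqu, hqv⟩ := h.charge_eq hγ hz hw hM
  refine ⟨?_, ?_, ?_, ?_, ?_, ?_, hqu, hqv⟩
  · field_simp at Euu ⊢
    linear_combination -Euu / 2
  · field_simp at Evv ⊢
    linear_combination -Evv / 2
  · rw [← hA, hAτ]
  · rw [ricci_uv hev duv] at Euv
    linear_combination Euv - hRτ
  · rw [ricci_vu hev dvu] at Evu
    linear_combination Evu - hRτ
  · rw [h.waveOp_eq hγ hn hz hw] at hW
    rw [← hW]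
    field_simp
    ring

end FieldEquations

/-! ### Bounds on a characteristic rectangle -/

/-- `f` is bounded on `Y`. -/
def BddOn (f : ℝ × ℝ → ℝ) (Y : Set (ℝ × ℝ)) : Prop := ∃ B, ∀ z ∈ Y, |f z| ≤ B

namespace BddOn

variable {f g : ℝ × ℝ → ℝ} {Y : Set (ℝ × ℝ)}

lemma congr (hf : BddOn f Y) (h : ∀ z ∈ Y, g z = f z) : BddOn g Y :=
  hf.imp fun _ hB z hz => (h z hz) ▸ hB z hz

lemma of_le (hg : BddOn g Y) (h : ∀ z ∈ Y, |f z| ≤ |g z|) : BddOn f Y :=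
  hg.imp fun _ hB z hz => (h z hz).trans (hB z hz)

lemma const (c : ℝ) : BddOn (fun _ => c) Y := ⟨|c|, fun _ _ => le_rfl⟩

lemma add (hf : BddOn f Y) (hg : BddOn g Y) : BddOn (fun z => f z + g z) Y := by
  obtain ⟨A, hA⟩ := hf
  obtain ⟨B, hB⟩ := hg
  exact ⟨A + B, fun z hz => (abs_add_le _ _).trans (add_le_add (hA z hz) (hB z hz))⟩

lemma neg (hf : BddOn f Y) : BddOn (fun z => -f z) Y := by
  simpa [BddOn] using hf

lemma sub (hf : BddOn f Y) (hg : BddOn g Y) : BddOn (fun z => f z - g z) Y := by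
  simpa [sub_eq_add_neg] using hf.add hg.neg

lemma mul (hf : BddOn f Y) (hg : BddOn g Y) : BddOn (fun z => f z * g z) Y := by
  obtain ⟨A, hA⟩ := hf
  obtain ⟨B, hB⟩ := hg
  refine ⟨A * B, fun z hz => ?_⟩
  rw [abs_mul]
  exact mul_le_mul (hA z hz) (hB z hz) (abs_nonneg _) ((abs_nonneg _).trans (hA z hz))

lemma pow (hf : BddOn f Y) (m : ℕ) : BddOn (fun z => f z ^ m) Y := by
  obtain ⟨A, hA⟩ := hf
  refine ⟨A ^ m, fun z hz => ?_⟩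
  rw [abs_pow]
  exact pow_le_pow_left₀ (abs_nonneg _) (hA z hz) m

lemma comp_continuous {V : ℝ → ℝ} (hV : Continuous V) (hf : BddOn f Y) :
    BddOn (fun z => V (f z)) Y := by
  obtain ⟨A, hA⟩ := hf
  obtain ⟨B, hB⟩ := (isCompact_Icc (a := -A) (b := A)).exists_bound_of_continuousOn hV.continuousOn
  exact ⟨B, fun z hz => hB _ (abs_le.1 (hA z hz))⟩

lemma log (hf : BddOn f Y) (hi : BddOn (fun z => (f z)⁻¹) Y) (hp : ∀ z ∈ Y, 0 < f z) :
    BddOn (fun z => Real.log (f z)) Y := by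
  refine (hf.add hi).of_le fun z hz => ?_
  have h1 := Real.log_le_sub_one_of_pos (hp z hz)
  have h2 := Real.log_le_sub_one_of_pos (inv_pos.2 (hp z hz))
  rw [Real.log_inv] at h2
  have h3 := hp z hz
  have h4 := inv_pos.2 h3
  rw [abs_of_pos (add_pos h3 h4), abs_le]
  constructor <;> linarith

lemma of_nonneg_of_le (h0 : ∀ z ∈ Y, 0 ≤ f z) (h : ∃ B, ∀ z ∈ Y, f z ≤ B) : BddOn f Y :=
  h.imp fun _ hB z hz => (abs_of_nonneg (h0 z hz)).le.trans (hB z hz)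

lemma normC0_lt_top (hf : BddOn f Y) : normC0 f Y < ⊤ := by
  obtain ⟨B, hB⟩ := hf
  refine lt_of_le_of_lt (iSup₂_le fun z hz => ?_) (ENNReal.ofReal_lt_top (r := B))
  rw [Real.enorm_eq_ofReal_abs]
  exact ENNReal.ofReal_le_ofReal (hB z hz)

end BddOn

/-- The characteristic rectangle with past corner `o` and future corner `p`, the latter removed. -/
def puncturedRect (o p : ℝ × ℝ) : Set (ℝ × ℝ) := Icc o p \ {p}

section Rect

variable {o p : ℝ × ℝ} {f g f' g' : ℝ × ℝ → ℝ}

/-- As only the future corner is missing, the past-directed null segment from any point to the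
opposite past face stays in the set. Transport estimates in either direction can therefore start
from a compact edge. -/
lemma mem_puncturedRect_right (ho : o.1 < p.1 ∧ o.2 < p.2) {z : ℝ × ℝ}
    (hz : z ∈ puncturedRect o p) {t : ℝ} (ht : t ∈ Icc o.2 z.2) : (z.1, t) ∈ puncturedRect o p := by
  obtain ⟨⟨h1, h2⟩, h3⟩ := hz
  refine ⟨⟨⟨h1.1, ht.1⟩, ⟨h2.1, ht.2.trans h2.2⟩⟩, fun h => h3 ?_⟩
  obtain ⟨rfl⟩ : (z.1, t) = p := h
  exact Prod.ext rfl (le_antisymm h2.2 ht.2)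

lemma mem_puncturedRect_left (ho : o.1 < p.1 ∧ o.2 < p.2) {z : ℝ × ℝ}
    (hz : z ∈ puncturedRect o p) {t : ℝ} (ht : t ∈ Icc o.1 z.1) : (t, z.2) ∈ puncturedRect o p := by
  obtain ⟨⟨h1, h2⟩, h3⟩ := hz
  refine ⟨⟨⟨ht.1, h1.2⟩, ⟨ht.2.trans h2.1, h2.2⟩⟩, fun h => h3 ?_⟩
  obtain ⟨rfl⟩ : (t, z.2) = p := h
  exact Prod.ext (le_antisymm h2.1 ht.2) rfl

lemma sub_le_sub_of_hasDerivAt {f g f' g' : ℝ → ℝ} {a b : ℝ} (hab : a ≤ b)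
    (hf : ∀ t ∈ Icc a b, HasDerivAt f (f' t) t) (hg : ∀ t ∈ Icc a b, HasDerivAt g (g' t) t)
    (h : ∀ t ∈ Icc a b, f' t ≤ g' t) : f b - f a ≤ g b - g a := by
  have hd : ∀ t ∈ Icc a b, HasDerivAt (fun t => g t - f t) (g' t - f' t) t :=
    fun t ht => (hg t ht).sub (hf t ht)
  have := monotoneOn_of_deriv_nonneg (convex_Icc a b)
    (fun t ht => (hd t ht).continuousAt.continuousWithinAt)
    (fun t ht => (hd t (interior_subset ht)).differentiableAt.differentiableWithinAt)
    (fun t ht => by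
      rw [(hd t (interior_subset ht)).deriv]; linarith [h t (interior_subset ht)])
    (left_mem_Icc.2 hab) (right_mem_Icc.2 hab) hab
  simp only at this
  linarith

/-- An upper bound on `f` from an upper bound on `∂_v f`. -/
lemma exists_le_of_dV_le (ho : o.1 < p.1 ∧ o.2 < p.2) (hc : ContinuousOn f (puncturedRect o p))
    (hf : ∀ z ∈ puncturedRect o p, HasDerivAt (fun t => f (z.1, t)) (f' z) z.2)
    (hg : ∀ z ∈ puncturedRect o p, HasDerivAt (fun t => g (z.1, t)) (g' z) z.2)
    (h : ∀ z ∈ puncturedRect o p, f' z ≤ g' z) (hb : BddOn g (puncturedRect o p)) :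
    ∃ B, ∀ z ∈ puncturedRect o p, f z ≤ B := by
  have hK : Icc o.1 p.1 ×ˢ {o.2} ⊆ puncturedRect o p := by
    rintro ⟨u, v⟩ ⟨⟨h1, h2⟩, rfl⟩
    exact ⟨⟨⟨h1, le_rfl⟩, ⟨h2, ho.2.le⟩⟩, fun h => ho.2.ne (Prod.ext_iff.1 h).2⟩
  obtain ⟨A, hA⟩ := (isCompact_Icc.prod isCompact_singleton).exists_bound_of_continuousOn
    (hc.mono hK)
  obtain ⟨B, hB⟩ := hb
  -- `A` bounds `f` on the edge `v = o.2`, and `g` changes by at most `2B` along the ray.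
  refine ⟨A + 2 * B, fun z hz => ?_⟩
  have hm : (z.1, o.2) ∈ Icc o.1 p.1 ×ˢ {o.2} := ⟨⟨hz.1.1.1, hz.1.2.1⟩, rfl⟩
  have key := sub_le_sub_of_hasDerivAt (f := fun t => f (z.1, t)) (g := fun t => g (z.1, t))
    (f' := fun t => f' (z.1, t)) (g' := fun t => g' (z.1, t)) (a := o.2) (b := z.2) hz.1.1.2
    (fun t ht => hf (z.1, t) (mem_puncturedRect_right ho hz ht))
    (fun t ht => hg (z.1, t) (mem_puncturedRect_right ho hz ht))
    (fun t ht => h (z.1, t) (mem_puncturedRect_right ho hz ht))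
  have h1 := (le_abs_self _).trans (hA _ hm)
  have h2 := (abs_le.1 (hB _ (hK hm))).1
  have h3 := (le_abs_self _).trans (hB z hz)
  simp only [Prod.mk.eta] at key
  linarith

lemma exists_le_of_dU_le (ho : o.1 < p.1 ∧ o.2 < p.2) (hc : ContinuousOn f (puncturedRect o p))
    (hf : ∀ z ∈ puncturedRect o p, HasDerivAt (fun t => f (t, z.2)) (f' z) z.1)
    (hg : ∀ z ∈ puncturedRect o p, HasDerivAt (fun t => g (t, z.2)) (g' z) z.1)
    (h : ∀ z ∈ puncturedRect o p, f' z ≤ g' z) (hb : BddOn g (puncturedRect o p)) :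
    ∃ B, ∀ z ∈ puncturedRect o p, f z ≤ B := by
  have hK : {o.1} ×ˢ Icc o.2 p.2 ⊆ puncturedRect o p := by
    rintro ⟨u, v⟩ ⟨rfl, ⟨h1, h2⟩⟩
    exact ⟨⟨⟨le_rfl, h1⟩, ⟨ho.1.le, h2⟩⟩, fun h => ho.1.ne (Prod.ext_iff.1 h).1⟩
  obtain ⟨A, hA⟩ := (isCompact_singleton.prod isCompact_Icc).exists_bound_of_continuousOn
    (hc.mono hK)
  obtain ⟨B, hB⟩ := hb
  refine ⟨A + 2 * B, fun z hz => ?_⟩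
  have hm : (o.1, z.2) ∈ {o.1} ×ˢ Icc o.2 p.2 := ⟨rfl, ⟨hz.1.1.2, hz.1.2.2⟩⟩
  have key := sub_le_sub_of_hasDerivAt (f := fun t => f (t, z.2)) (g := fun t => g (t, z.2))
    (f' := fun t => f' (t, z.2)) (g' := fun t => g' (t, z.2)) (a := o.1) (b := z.1) hz.1.1.1
    (fun t ht => hf (t, z.2) (mem_puncturedRect_left ho hz ht))
    (fun t ht => hg (t, z.2) (mem_puncturedRect_left ho hz ht))
    (fun t ht => h (t, z.2) (mem_puncturedRect_left ho hz ht))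
  have h1 := (le_abs_self _).trans (hA _ hm)
  have h2 := (abs_le.1 (hB _ (hK hm))).1
  have h3 := (le_abs_self _).trans (hB z hz)
  simp only [Prod.mk.eta] at key
  linarith

lemma bddOn_of_le_of_neg_le {Y : Set (ℝ × ℝ)} (h1 : ∃ B, ∀ z ∈ Y, f z ≤ B)
    (h2 : ∃ B, ∀ z ∈ Y, -f z ≤ B) : BddOn f Y := by
  obtain ⟨A, hA⟩ := h1
  obtain ⟨B, hB⟩ := h2
  exact ⟨max A B, fun z hz => abs_le'.2
    ⟨(hA z hz).trans (le_max_left _ _), (hB z hz).trans (le_max_right _ _)⟩⟩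

lemma bddOn_of_abs_dV_le (ho : o.1 < p.1 ∧ o.2 < p.2) (hc : ContinuousOn f (puncturedRect o p))
    (hf : ∀ z ∈ puncturedRect o p, HasDerivAt (fun t => f (z.1, t)) (f' z) z.2)
    (hg : ∀ z ∈ puncturedRect o p, HasDerivAt (fun t => g (z.1, t)) (g' z) z.2)
    (h : ∀ z ∈ puncturedRect o p, |f' z| ≤ g' z) (hb : BddOn g (puncturedRect o p)) :
    BddOn f (puncturedRect o p) :=
  bddOn_of_le_of_neg_le
    (exists_le_of_dV_le ho hc hf hg (fun z hz => (abs_le'.1 (h z hz)).1) hb)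
    (exists_le_of_dV_le ho hc.neg (fun z hz => (hf z hz).neg) hg
      (fun z hz => (abs_le'.1 (h z hz)).2) hb)

lemma bddOn_fst : BddOn Prod.fst (puncturedRect o p) :=
  ⟨max |o.1| |p.1|, fun _ hz => abs_le_max_abs_abs hz.1.1.1 hz.1.2.1⟩

lemma bddOn_snd : BddOn Prod.snd (puncturedRect o p) :=
  ⟨max |o.2| |p.2|, fun _ hz => abs_le_max_abs_abs hz.1.1.2 hz.1.2.2⟩

lemma bddOn_of_bddOn_dV (ho : o.1 < p.1 ∧ o.2 < p.2) (hc : ContinuousOn f (puncturedRect o p))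
    (hf : ∀ z ∈ puncturedRect o p, HasDerivAt (fun t => f (z.1, t)) (f' z) z.2)
    (hb : BddOn f' (puncturedRect o p)) : BddOn f (puncturedRect o p) := by
  obtain ⟨B, hB⟩ := hb
  exact bddOn_of_abs_dV_le (g := fun z => B * z.2) (g' := fun _ => B) ho hc hf
    (fun z _ => by simpa using (hasDerivAt_id z.2).const_mul B) hB ((BddOn.const B).mul bddOn_snd)

lemma bddOn_of_bddOn_dU (ho : o.1 < p.1 ∧ o.2 < p.2) (hc : ContinuousOn f (puncturedRect o p))
    (hf : ∀ z ∈ puncturedRect o p, HasDerivAt (fun t => f (t, z.2)) (f' z) z.1)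
    (hb : BddOn f' (puncturedRect o p)) : BddOn f (puncturedRect o p) := by
  obtain ⟨B, hB⟩ := hb
  have hg : ∀ z ∈ puncturedRect o p, HasDerivAt (fun t => B * t) ((fun _ => B) z) z.1 :=
    fun z _ => by simpa using (hasDerivAt_id z.1).const_mul B
  have hb : BddOn (fun z => B * z.1) (puncturedRect o p) := (BddOn.const B).mul bddOn_fst
  exact bddOn_of_le_of_neg_le
    (exists_le_of_dU_le (g := fun z => B * z.1) (g' := fun _ => B) ho hc hf hg
      (fun z hz => (abs_le'.1 (hB z hz)).1) hb)
    (exists_le_of_dU_le (g := fun z => B * z.1) (g' := fun _ => B) ho hc.neg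
      (fun z hz => (hf z hz).neg) hg (fun z hz => (abs_le'.1 (hB z hz)).2) hb)

end Rect

/-! ### A priori estimates in an untrapped rectangle -/

/-- A characteristic rectangle, punctured at its future corner, in which the reduced equations
hold and which contains no trapped points. -/
structure UntrappedRect (n : ℕ) (k C M M' : ℝ) (V : ℝ → ℝ) (Ω r φ e : ℝ × ℝ → ℝ)
    (O : Set (ℝ × ℝ)) (o p : ℝ × ℝ) : Prop where
  reg : RegularOn Ω r φ e O
  sub : puncturedRect o p ⊆ O
  corner : o.1 < p.1 ∧ o.2 < p.2
  eqs : ∀ z ∈ puncturedRect o p, ReducedEquationsAt n k M M' V Ω r φ e z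
  ν_neg : ∀ z ∈ puncturedRect o p, dU r z < 0
  lam_nonneg : ∀ z ∈ puncturedRect o p, 0 ≤ dV r z
  one_le : 1 ≤ n
  V_reg : ContDiff ℝ 1 V
  V_ge : ∀ s, -4 * C ≤ V s

namespace UntrappedRect

variable {n : ℕ} {k C M M' : ℝ} {V : ℝ → ℝ} {Ω r φ e : ℝ × ℝ → ℝ} {O : Set (ℝ × ℝ)}
  {o p : ℝ × ℝ} {z : ℝ × ℝ}

lemma Ω_pos (h : UntrappedRect n k C M M' V Ω r φ e O o p)
    (hz : z ∈ puncturedRect o p) : 0 < Ω z := h.reg.Ω_pos z (h.sub hz)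

lemma r_pos (h : UntrappedRect n k C M M' V Ω r φ e O o p)
    (hz : z ∈ puncturedRect o p) : 0 < r z := h.reg.r_pos z (h.sub hz)

lemma n_pos (h : UntrappedRect n k C M M' V Ω r φ e O o p) : (0 : ℝ) < n := Nat.cast_pos.2 h.one_le

lemma r_mixed (h : UntrappedRect n k C M M' V Ω r φ e O o p)
    : MixedC2On r O := h.reg.r_reg.mixedC2On h.reg.isOpen

lemma ν_reg (h : UntrappedRect n k C M M' V Ω r φ e O o p) : ContDiffOn ℝ 1 (dU r) O :=
  contDiffOn_dU h.reg.isOpen (by simpa [one_add_one_eq_two] using h.reg.r_reg)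

lemma lam_reg (h : UntrappedRect n k C M M' V Ω r φ e O o p) : ContDiffOn ℝ 1 (dV r) O :=
  contDiffOn_dV h.reg.isOpen (by simpa [one_add_one_eq_two] using h.reg.r_reg)

lemma r_u (h : UntrappedRect n k C M M' V Ω r φ e O o p)
    (hz : z ∈ puncturedRect o p) : HasDerivAt (fun t => r (t, z.2)) (dU r z) z.1 :=
  hasDerivAt_left (h.r_mixed.differentiableAt h.reg.isOpen (h.sub hz)).slice_left

lemma r_v (h : UntrappedRect n k C M M' V Ω r φ e O o p)
    (hz : z ∈ puncturedRect o p) : HasDerivAt (fun t => r (z.1, t)) (dV r z) z.2 :=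
  hasDerivAt_right (h.r_mixed.differentiableAt h.reg.isOpen (h.sub hz)).slice_right

lemma Ω_u (h : UntrappedRect n k C M M' V Ω r φ e O o p)
    (hz : z ∈ puncturedRect o p) : HasDerivAt (fun t => Ω (t, z.2)) (dU Ω z) z.1 :=
  hasDerivAt_left (h.reg.Ω_reg.differentiableAt h.reg.isOpen (h.sub hz)).slice_left

lemma Ω_v (h : UntrappedRect n k C M M' V Ω r φ e O o p)
    (hz : z ∈ puncturedRect o p) : HasDerivAt (fun t => Ω (z.1, t)) (dV Ω z) z.2 :=
  hasDerivAt_right (h.reg.Ω_reg.differentiableAt h.reg.isOpen (h.sub hz)).slice_right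

lemma φ_v (h : UntrappedRect n k C M M' V Ω r φ e O o p)
    (hz : z ∈ puncturedRect o p) : HasDerivAt (fun t => φ (z.1, t)) (dV φ z) z.2 :=
  hasDerivAt_right (h.reg.φ_reg.differentiableAt h.reg.isOpen (h.sub hz)).slice_right

lemma e_v (h : UntrappedRect n k C M M' V Ω r φ e O o p)
    (hz : z ∈ puncturedRect o p) : HasDerivAt (fun t => e (z.1, t)) (dV e z) z.2 :=
  hasDerivAt_right ((h.reg.e_reg.differentiableOn (by simp)).differentiableAt
    (h.reg.isOpen.mem_nhds (h.sub hz))).slice_right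

lemma ν_v (h : UntrappedRect n k C M M' V Ω r φ e O o p) (hz : z ∈ puncturedRect o p) :
    HasDerivAt (fun t => dU r (z.1, t)) (dV (dU r) z) z.2 :=
  hasDerivAt_right (h.r_mixed.diff_uv z (h.sub hz))

lemma ν_u (h : UntrappedRect n k C M M' V Ω r φ e O o p) (hz : z ∈ puncturedRect o p) :
    HasDerivAt (fun t => dU r (t, z.2)) (dU (dU r) z) z.1 :=
  hasDerivAt_left ((h.ν_reg.differentiableOn (by simp)).differentiableAt
    (h.reg.isOpen.mem_nhds (h.sub hz))).slice_left

lemma lam_v (h : UntrappedRect n k C M M' V Ω r φ e O o p) (hz : z ∈ puncturedRect o p) :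
    HasDerivAt (fun t => dV r (z.1, t)) (dV (dV r) z) z.2 :=
  hasDerivAt_right ((h.lam_reg.differentiableOn (by simp)).differentiableAt
    (h.reg.isOpen.mem_nhds (h.sub hz))).slice_right

lemma φu_v (h : UntrappedRect n k C M M' V Ω r φ e O o p) (hz : z ∈ puncturedRect o p) :
    HasDerivAt (fun t => dU φ (z.1, t)) (dV (dU φ) z) z.2 :=
  hasDerivAt_right (h.reg.φ_reg.diff_uv z (h.sub hz))

lemma φv_u (h : UntrappedRect n k C M M' V Ω r φ e O o p) (hz : z ∈ puncturedRect o p) :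
    HasDerivAt (fun t => dV φ (t, z.2)) (dV (dU φ) z) z.1 :=
  h.reg.φ_reg.symm h.reg.isOpen (h.sub hz) ▸ hasDerivAt_left (h.reg.φ_reg.diff_vu z (h.sub hz))

lemma logΩu_v (h : UntrappedRect n k C M M' V Ω r φ e O o p) (hz : z ∈ puncturedRect o p) :
    HasDerivAt (fun t => 2 * dU Ω (z.1, t) / Ω (z.1, t)) (dV (fun z => 2 * dU Ω z / Ω z) z) z.2 :=
  hasDerivAt_right (f := fun z => 2 * dU Ω z / Ω z)
    (((h.reg.Ω_reg.diff_uv z (h.sub hz)).const_mul 2).div (h.Ω_v hz).differentiableAt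
      (h.Ω_pos hz).ne')

lemma logΩv_u (h : UntrappedRect n k C M M' V Ω r φ e O o p) (hz : z ∈ puncturedRect o p) :
    HasDerivAt (fun t => 2 * dV Ω (t, z.2) / Ω (t, z.2)) (dU (fun z => 2 * dV Ω z / Ω z) z) z.1 :=
  hasDerivAt_left (f := fun z => 2 * dV Ω z / Ω z)
    (((h.reg.Ω_reg.diff_vu z (h.sub hz)).const_mul 2).div (h.Ω_u hz).differentiableAt
      (h.Ω_pos hz).ne')

lemma continuousOn_r (h : UntrappedRect n k C M M' V Ω r φ e O o p)
    : ContinuousOn r (puncturedRect o p) := h.reg.r_reg.continuousOn.mono h.sub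

lemma continuousOn_ν (h : UntrappedRect n k C M M' V Ω r φ e O o p)
    : ContinuousOn (dU r) (puncturedRect o p) := h.ν_reg.continuousOn.mono h.sub

lemma continuousOn_lam (h : UntrappedRect n k C M M' V Ω r φ e O o p)
    : ContinuousOn (dV r) (puncturedRect o p) :=
  h.lam_reg.continuousOn.mono h.sub

lemma continuousOn_Ω (h : UntrappedRect n k C M M' V Ω r φ e O o p)
    : ContinuousOn Ω (puncturedRect o p) :=
  h.reg.Ω_reg.contDiffOn.continuousOn.mono h.sub

lemma continuousOn_φ (h : UntrappedRect n k C M M' V Ω r φ e O o p)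
    : ContinuousOn φ (puncturedRect o p) :=
  h.reg.φ_reg.contDiffOn.continuousOn.mono h.sub

lemma continuousOn_dU (h : UntrappedRect n k C M M' V Ω r φ e O o p)
    {f : ℝ × ℝ → ℝ} (hf : MixedC2On f O) :
    ContinuousOn (dU f) (puncturedRect o p) :=
  (contDiffOn_dU (m := 0) h.reg.isOpen (by simpa using hf.contDiffOn)).continuousOn.mono h.sub

lemma continuousOn_dV (h : UntrappedRect n k C M M' V Ω r φ e O o p)
    {f : ℝ × ℝ → ℝ} (hf : MixedC2On f O) :
    ContinuousOn (dV f) (puncturedRect o p) :=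
  (contDiffOn_dV (m := 0) h.reg.isOpen (by simpa using hf.contDiffOn)).continuousOn.mono h.sub

/-- The equation for `∂_u ∂_v r`. -/
lemma dV_dU_r (h : UntrappedRect n k C M M' V Ω r φ e O o p)
    (hz : z ∈ puncturedRect o p) : dV (dU r) z =
    Ω z ^ 2 * (r z / n * (V (φ z) / 2 + (e z / Ω z ^ 2) ^ 2 + M / (8 * r z ^ 4)) -
      k * (n - 1) / (4 * r z)) - (n - 1) / r z * (dU r z * dV r z) := by
  have h1 := (h.eqs z hz).radius
  have hr := (h.r_pos hz).ne'
  have hΩ := (h.Ω_pos hz).ne'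
  have hn := h.n_pos.ne'
  rw [energyFlux] at h1
  generalize V (φ z) / 2 + (e z / Ω z ^ 2) ^ 2 + M / (8 * r z ^ 4) = F at h1 ⊢
  have h2 : 4 * r z ^ 2 * (Ω z ^ 2 * F) / Ω z ^ 2 = 4 * r z ^ 2 * F := by field_simp
  rw [h2] at h1
  have h3 : dV (dU r) z = Ω z ^ 2 / (4 * n * r z) * (n * (k * (n - 1) + 4 / Ω z ^ 2 *
      (r z * dV (dU r) z + (n - 1) * (dU r z * dV r z)))) - Ω z ^ 2 / (4 * r z) * k * (n - 1) -
      (n - 1) / r z * (dU r z * dV r z) := by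
    field_simp
    ring
  rw [h3, h1]
  field_simp

/-- Raychaudhuri's equation for `∂_u² r`. -/
lemma dU_dU_r (h : UntrappedRect n k C M M' V Ω r φ e O o p)
    (hz : z ∈ puncturedRect o p) : dU (dU r) z =
    2 * dU Ω z / Ω z * dU r z - r z / n * dU φ z ^ 2 := by
  have h1 := (h.eqs z hz).raychaudhuri_u
  have hn := h.n_pos.ne'
  field_simp at h1 ⊢
  linear_combination h1

lemma dV_dV_r (h : UntrappedRect n k C M M' V Ω r φ e O o p)
    (hz : z ∈ puncturedRect o p) : dV (dV r) z =
    2 * dV Ω z / Ω z * dV r z - r z / n * dV φ z ^ 2 := by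
  have h1 := (h.eqs z hz).raychaudhuri_v
  have hn := h.n_pos.ne'
  field_simp at h1 ⊢
  linear_combination h1

/-! #### Bounds on the metric -/

/-- In the absence of trapped points `r` does not decrease in `v`, so it is bounded below by its
minimum on the compact edge `v = o.2`. -/
lemma bdd_r_inv (h : UntrappedRect n k C M M' V Ω r φ e O o p) :
    BddOn (fun z => (r z)⁻¹) (puncturedRect o p) := by
  refine .of_nonneg_of_le (fun z hz => (inv_pos.2 (h.r_pos hz)).le) ?_
  refine exists_le_of_dV_le (f := fun z => (r z)⁻¹) (g := fun _ => 0) (g' := fun _ => 0) h.corner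
    (h.continuousOn_r.inv₀ fun z hz => (h.r_pos hz).ne')
    (fun z hz => (h.r_v hz).inv (h.r_pos hz).ne') (fun z _ => hasDerivAt_const _ _)
    (fun z hz => ?_) (.const 0)
  have := h.r_pos hz
  exact div_nonpos_of_nonpos_of_nonneg (neg_nonpos.2 (h.lam_nonneg z hz)) (by positivity)

/-- As `∂_u r < 0`, the largest values of `r` are taken on the edge `u = o.1`. -/
lemma bdd_r (h : UntrappedRect n k C M M' V Ω r φ e O o p) : BddOn r (puncturedRect o p) := by
  refine .of_nonneg_of_le (fun z hz => (h.r_pos hz).le) ?_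
  exact exists_le_of_dU_le (g := fun _ => 0) (g' := fun _ => 0) h.corner
    h.continuousOn_r (fun z hz => h.r_u hz) (fun z _ => hasDerivAt_const _ _)
    (fun z hz => (h.ν_neg z hz).le) (.const 0)

/-- The quantity `Ω² / (-∂_u r)` is nonincreasing in `u`, hence bounded. -/
lemma exists_Ω_sq_le (h : UntrappedRect n k C M M' V Ω r φ e O o p) :
    ∃ K, 0 < K ∧ ∀ z ∈ puncturedRect o p, Ω z ^ 2 ≤ K * (-dU r z) := by
  have hle : ∀ z ∈ puncturedRect o p, (-(2 * Ω z * dU Ω z) * dU r z -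
      -(Ω z ^ 2) * dU (dU r) z) / dU r z ^ 2 ≤ 0 := by
    intro z hz
    have hr := h.r_pos hz
    have hΩ := h.Ω_pos hz
    have hn := h.n_pos
    have h2 := h.ν_neg z hz
    rw [h.dU_dU_r hz]
    -- By Raychaudhuri's equation the terms with `∂_uΩ` cancel, and only a term with a sign is left.
    have : -(2 * Ω z * dU Ω z) * dU r z -
        -(Ω z ^ 2) * (2 * dU Ω z / Ω z * dU r z - r z / n * dU φ z ^ 2) =
        -(Ω z ^ 2 * (r z / n * dU φ z ^ 2)) := by field_simp; ring
    rw [this]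
    exact div_nonpos_of_nonpos_of_nonneg (neg_nonpos.2 (by positivity)) (sq_nonneg _)
  obtain ⟨K, hK⟩ := exists_le_of_dU_le (f := fun z => -(Ω z ^ 2) / dU r z) (g := fun _ => 0)
    (g' := fun _ => 0) h.corner
    (((h.continuousOn_Ω.pow 2).neg).div h.continuousOn_ν fun z hz => (h.ν_neg z hz).ne)
    (fun z hz => ((((h.Ω_u hz).pow 2).neg).div (h.ν_u hz) (h.ν_neg z hz).ne).congr_deriv
      (by simp))
    (fun z _ => hasDerivAt_const _ _) hle (.const 0)
  refine ⟨max K 1, by positivity, fun z hz => ?_⟩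
  have h1 := (hK z hz).trans (le_max_left K 1)
  have h2 := h.ν_neg z hz
  rw [neg_div, ← div_neg, div_le_iff₀ (by linarith)] at h1
  exact h1

/-- A lower bound for `∂_u ∂_v r` in terms of `Ω²`. -/
lemma exists_neg_dV_dU_r_le (h : UntrappedRect n k C M M' V Ω r φ e O o p) :
    ∃ A, 0 ≤ A ∧ ∀ z ∈ puncturedRect o p, -dV (dU r) z ≤ A * Ω z ^ 2 := by
  -- This is minus the coefficient of `Ω²` in `dV_dU_r`, with `V` replaced by its lower bound `-4C`
  -- and the nonnegative electric energy dropped. What remains involves only `r` and `1/r`, both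
  -- already bounded.
  have hb : BddOn (fun z => r z * (2 * C / n) - M / (8 * n) * (r z)⁻¹ ^ 3 +
      k * (n - 1) / 4 * (r z)⁻¹) (puncturedRect o p) :=
    ((h.bdd_r.mul (.const _)).sub ((BddOn.const _).mul (h.bdd_r_inv.pow 3))).add
      ((BddOn.const _).mul h.bdd_r_inv)
  obtain ⟨A, hA⟩ := hb
  refine ⟨max A 0, le_max_right _ _, fun z hz => ?_⟩
  have hr := h.r_pos hz
  have hΩ := h.Ω_pos hz
  have hn := h.n_pos
  have h1 : (1 : ℝ) ≤ n := by exact_mod_cast h.one_le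
  -- The quadratic term has a favourable sign because the rectangle is untrapped.
  have h2 : (n - 1) / r z * (dU r z * dV r z) ≤ 0 :=
    mul_nonpos_of_nonneg_of_nonpos (div_nonneg (by linarith) hr.le)
      (mul_nonpos_of_nonpos_of_nonneg (h.ν_neg z hz).le (h.lam_nonneg z hz))
  have h3 : -(r z / n * (V (φ z) / 2 + (e z / Ω z ^ 2) ^ 2 + M / (8 * r z ^ 4)) -
      k * (n - 1) / (4 * r z)) ≤ r z * (2 * C / n) - M / (8 * n) * (r z)⁻¹ ^ 3 +
      k * (n - 1) / 4 * (r z)⁻¹ := by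
    have h4 : 0 ≤ r z / n * ((V (φ z) + 4 * C) / 2 + (e z / Ω z ^ 2) ^ 2) := by
      have := h.V_ge (φ z)
      have : 0 ≤ V (φ z) + 4 * C := by linarith
      positivity
    have h5 : r z * (2 * C / n) - M / (8 * n) * (r z)⁻¹ ^ 3 + k * (n - 1) / 4 * (r z)⁻¹ +
      (r z / n * (V (φ z) / 2 + (e z / Ω z ^ 2) ^ 2 + M / (8 * r z ^ 4)) -
      k * (n - 1) / (4 * r z)) = r z / n * ((V (φ z) + 4 * C) / 2 + (e z / Ω z ^ 2) ^ 2) := by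
      field_simp
      ring
    linarith
  have h6 := ((h3.trans (le_abs_self _)).trans (hA z hz)).trans (le_max_left A 0)
  rw [h.dV_dU_r hz]
  have h7 := mul_le_mul_of_nonneg_left h6 (sq_nonneg (Ω z))
  linarith

/-- Gronwall's inequality in `v`: `-∂_v ν ≤ AΩ² ≤ AK(-ν)` makes `-ν exp(-AKv)` nonincreasing, and
the exponential is bounded above and below on the rectangle. -/
lemma bdd_ν (h : UntrappedRect n k C M M' V Ω r φ e O o p) : BddOn (dU r) (puncturedRect o p) := by
  obtain ⟨K, hK0, hK⟩ := h.exists_Ω_sq_le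
  obtain ⟨A, hA0, hA⟩ := h.exists_neg_dV_dU_r_le
  have hexp : ∀ z : ℝ × ℝ, HasDerivAt (fun t => Real.exp (-(A * K) * t))
      (Real.exp (-(A * K) * z.2) * (-(A * K))) z.2 := fun z => by
    simpa using ((hasDerivAt_id z.2).const_mul (-(A * K))).exp
  have hb : BddOn (fun z => dU r z * Real.exp (-(A * K) * z.2)) (puncturedRect o p) := by
    refine bddOn_of_le_of_neg_le ⟨0, fun z hz => mul_nonpos_of_nonpos_of_nonneg (h.ν_neg z hz).le
      (Real.exp_pos _).le⟩ ?_
    refine exists_le_of_dV_le (f := fun z => -(dU r z * Real.exp (-(A * K) * z.2)))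
      (g := fun _ => 0) (g' := fun _ => 0)
      h.corner (h.continuousOn_ν.mul (by fun_prop)).neg
      (fun z hz => ((h.ν_v hz).mul (hexp z)).neg) (fun z _ => hasDerivAt_const _ _)
      (fun z hz => ?_) (.const 0)
    have h1 := hA z hz
    have h2 := mul_le_mul_of_nonneg_left (hK z hz) hA0
    have h3 : -(dV (dU r) z * Real.exp (-(A * K) * z.2) +
        dU r z * (Real.exp (-(A * K) * z.2) * (-(A * K)))) =
        (-dV (dU r) z - A * (K * -dU r z)) * Real.exp (-(A * K) * z.2) := by ring
    simp only [Prod.mk.eta]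
    rw [h3]
    exact mul_nonpos_of_nonpos_of_nonneg (by linarith) (Real.exp_pos _).le
  refine (hb.mul (BddOn.comp_continuous (V := fun t => Real.exp (A * K * t)) (by fun_prop)
    bddOn_snd)).congr fun z _ => ?_
  rw [mul_assoc, ← Real.exp_add]
  simp

lemma bdd_Ω_sq (h : UntrappedRect n k C M M' V Ω r φ e O o p) :
    BddOn (fun z => Ω z ^ 2) (puncturedRect o p) := by
  obtain ⟨K, hK0, hK⟩ := h.exists_Ω_sq_le
  refine ((BddOn.const K).mul h.bdd_ν).of_le fun z hz => ?_
  rw [abs_of_nonneg (sq_nonneg _)]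
  have h1 := hK z hz
  exact h1.trans (by rw [mul_neg]; exact neg_le_abs _)

/-- The boundedness of `∂_v r`, together with a bounded function whose `v`-derivative controls
`(∂_v φ)²`. -/
lemma bdd_lam_and_flux (h : UntrappedRect n k C M M' V Ω r φ e O o p) :
    BddOn (dV r) (puncturedRect o p) ∧ ∃ G G' : ℝ × ℝ → ℝ, BddOn G (puncturedRect o p) ∧
      (∀ z ∈ puncturedRect o p, HasDerivAt (fun t => G (z.1, t)) (G' z) z.2) ∧
      ∀ z ∈ puncturedRect o p, dV φ z ^ 2 ≤ G' z := by
  obtain ⟨K, hK0, hK⟩ := h.exists_Ω_sq_le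
  obtain ⟨A, hA0, hA⟩ := h.exists_neg_dV_dU_r_le
  obtain ⟨B, hB⟩ := h.bdd_r_inv
  have hB1 : 0 < max B 1 := by positivity
  -- `c` is a lower bound for `4r(-∂_u r)/(nΩ²)`, from `r ≥ 1/max B 1` and `-∂_u r/Ω² ≥ 1/K`.
  set c := 4 / (n * K * max B 1) with hc
  have hn := h.n_pos
  have hc0 : 0 < c := by positivity
  -- `H = |∇r|²` plays the role of the Hawking mass. Raychaudhuri's equation in `v` removes `∂_v²r`
  -- and `∂_vΩ` from its `v`-derivative, which is `H'`.
  set H : ℝ × ℝ → ℝ := fun z => -4 * (dU r z * dV r z) / Ω z ^ 2 with hH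
  set H' : ℝ × ℝ → ℝ := fun z => 4 * r z * dU r z * dV φ z ^ 2 / (n * Ω z ^ 2) -
    4 * dV r z * dV (dU r) z / Ω z ^ 2 with hH'
  have hder : ∀ z ∈ puncturedRect o p, HasDerivAt (fun t => H (z.1, t)) (H' z) z.2 := by
    intro z hz
    have hΩ := (h.Ω_pos hz).ne'
    have hd := ((((h.ν_v hz).mul (h.lam_v hz)).const_mul (-4)).div ((h.Ω_v hz).pow 2)
      (pow_ne_zero 2 hΩ))
    refine hd.congr_deriv ?_
    simp only [Prod.mk.eta, hH', h.dV_dV_r hz, Pi.mul_apply, Pi.pow_apply]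
    push_cast
    field_simp
    ring
  have hle : ∀ z ∈ puncturedRect o p, H' z ≤ 4 * A * dV r z - c * dV φ z ^ 2 := by
    intro z hz
    have hΩ := h.Ω_pos hz
    have hr := h.r_pos hz
    have h1 : -(4 * dV r z * dV (dU r) z / Ω z ^ 2) ≤ 4 * A * dV r z := by
      have e1 : -(4 * dV r z * dV (dU r) z / Ω z ^ 2) =
        4 * dV r z * (-dV (dU r) z) / Ω z ^ 2 := by ring
      rw [e1, div_le_iff₀ (by positivity)]
      have := mul_le_mul_of_nonneg_left (hA z hz) (mul_nonneg zero_le_four (h.lam_nonneg z hz))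
      linarith
    have h2 : c * dV φ z ^ 2 ≤ -(4 * r z * dU r z * dV φ z ^ 2 / (n * Ω z ^ 2)) := by
      have hrB : 1 ≤ r z * max B 1 := by
        have := (le_abs_self _).trans (hB z hz)
        have h3 : (r z)⁻¹ ≤ max B 1 := this.trans (le_max_left _ _)
        calc (1 : ℝ) = r z * (r z)⁻¹ := (mul_inv_cancel₀ hr.ne').symm
          _ ≤ _ := mul_le_mul_of_nonneg_left h3 hr.le
      have e2 : -(4 * r z * dU r z * dV φ z ^ 2 / (n * Ω z ^ 2)) =
        (4 * r z * (-dU r z) / (n * Ω z ^ 2)) * dV φ z ^ 2 := by ring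
      rw [e2]
      refine mul_le_mul_of_nonneg_right ?_ (sq_nonneg _)
      rw [hc, div_le_div_iff₀ (by positivity) (by positivity)]
      have h4 := hK z hz
      have h5 : 0 ≤ -dU r z := by linarith [h.ν_neg z hz]
      calc 4 * (n * Ω z ^ 2) ≤ 4 * (n * (K * -dU r z)) := by gcongr
        _ = 4 * n * K * (-dU r z) * 1 := by ring
        _ ≤ 4 * n * K * (-dU r z) * (r z * max B 1) := by gcongr
        _ = _ := by ring
    simp only [hH']
    linarith
  have hcH : ContinuousOn H (puncturedRect o p) :=
    (continuousOn_const.mul (h.continuousOn_ν.mul h.continuousOn_lam)).div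
      (h.continuousOn_Ω.pow 2) fun z hz => pow_ne_zero 2 (h.Ω_pos hz).ne'
  have hH0 : ∀ z ∈ puncturedRect o p, 0 ≤ H z := fun z hz => by
    have h1 := mul_nonpos_of_nonpos_of_nonneg (h.ν_neg z hz).le (h.lam_nonneg z hz)
    exact div_nonneg (by linarith) (sq_nonneg _)
  have hbH : BddOn H (puncturedRect o p) := by
    refine .of_nonneg_of_le hH0 (exists_le_of_dV_le h.corner hcH hder
      (g := fun z => 4 * A * r z) (fun z hz => (h.r_v hz).const_mul (4 * A)) (fun z hz => ?_)
      ((BddOn.const _).mul h.bdd_r))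
    have := hle z hz
    have h2 : 0 ≤ c * dV φ z ^ 2 := by positivity
    linarith
  -- Rearranging `H' ≤ 4A ∂_v r - c(∂_vφ)²` bounds `(∂_vφ)²` by the `v`-derivative of `c⁻¹(4A r -
  -- H)`. The bound on `∂_v r` follows from `∂_v r ≤ (K/4) H`.
  refine ⟨?_, fun z => c⁻¹ * (4 * A * r z - H z), fun z => c⁻¹ * (4 * A * dV r z - H' z),
    (BddOn.const _).mul (((BddOn.const _).mul h.bdd_r).sub hbH),
    fun z hz => (((h.r_v hz).const_mul (4 * A)).sub (hder z hz)).const_mul c⁻¹, fun z hz => ?_⟩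
  · refine ((BddOn.const (K / 4)).mul hbH).of_le fun z hz => ?_
    have hν := h.ν_neg z hz
    have hΩ := h.Ω_pos hz
    rw [abs_of_nonneg (h.lam_nonneg z hz), abs_of_nonneg (mul_nonneg (by positivity) (hH0 z hz))]
    have e1 : K / 4 * H z = dV r z * ((K * -dU r z) / Ω z ^ 2) := by simp only [hH]; ring
    rw [e1]
    exact le_mul_of_one_le_right (h.lam_nonneg z hz) ((one_le_div (by positivity)).2 (hK z hz))
  · change dV φ z ^ 2 ≤ c⁻¹ * (4 * A * dV r z - H' z)
    rw [← div_eq_inv_mul, le_div_iff₀ hc0]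
    linarith [hle z hz]

end UntrappedRect

/-! #### Bounds on the matter fields and on the conformal factor -/

namespace UntrappedRect

variable {n : ℕ} {k C M M' : ℝ} {V : ℝ → ℝ} {Ω r φ e : ℝ × ℝ → ℝ} {O : Set (ℝ × ℝ)}
  {o p : ℝ × ℝ} {z : ℝ × ℝ}

/-- A function whose `v`-derivative is bounded by a multiple of `1 + (∂_v φ)²` is bounded. -/
lemma bdd_of_flux (h : UntrappedRect n k C M M' V Ω r φ e O o p) {f f' : ℝ × ℝ → ℝ}
    (hc : ContinuousOn f (puncturedRect o p))
    (hf : ∀ z ∈ puncturedRect o p, HasDerivAt (fun t => f (z.1, t)) (f' z) z.2)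
    {B : ℝ} (hB0 : 0 ≤ B) (hB : ∀ z ∈ puncturedRect o p, |f' z| ≤ B * (1 + dV φ z ^ 2)) :
    BddOn f (puncturedRect o p) := by
  obtain ⟨-, G, G', hG, hGd, hGle⟩ := h.bdd_lam_and_flux
  refine bddOn_of_abs_dV_le (g := fun z => B * (z.2 + G z)) (g' := fun z => B * (1 + G' z))
    h.corner hc hf (fun z hz => ((hasDerivAt_id z.2).add (hGd z hz)).const_mul B)
    (fun z hz => (hB z hz).trans ?_) ((BddOn.const _).mul (bddOn_snd.add hG))
  have := hGle z hz
  gcongr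

/-- `|x| ≤ 1 + x²`, so the flux bound controls the variation of `φ` along outgoing rays. -/
lemma bdd_φ (h : UntrappedRect n k C M M' V Ω r φ e O o p) : BddOn φ (puncturedRect o p) := by
  refine h.bdd_of_flux h.continuousOn_φ (fun z hz => h.φ_v hz) zero_le_one fun z hz => ?_
  rw [abs_le]
  constructor <;> nlinarith [sq_nonneg (dV φ z - 1), sq_nonneg (dV φ z + 1)]

lemma bdd_V (h : UntrappedRect n k C M M' V Ω r φ e O o p) :
    BddOn (fun z => V (φ z)) (puncturedRect o p) :=
  .comp_continuous h.V_reg.continuous h.bdd_φ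

lemma bdd_deriv_V (h : UntrappedRect n k C M M' V Ω r φ e O o p) :
    BddOn (fun z => deriv V (φ z)) (puncturedRect o p) :=
  .comp_continuous (h.V_reg.continuous_deriv le_rfl) h.bdd_φ

/-- The weight `r^{n/2}`. -/
def weight (n : ℕ) (r : ℝ × ℝ → ℝ) (z : ℝ × ℝ) : ℝ := Real.exp (n / 2 * Real.log (r z))

lemma weight_pos : 0 < weight n r z := Real.exp_pos _

lemma bdd_log_r (h : UntrappedRect n k C M M' V Ω r φ e O o p) :
    BddOn (fun z => Real.log (r z)) (puncturedRect o p) :=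
  h.bdd_r.log h.bdd_r_inv fun _ hz => h.r_pos hz

lemma bdd_weight (h : UntrappedRect n k C M M' V Ω r φ e O o p) :
    BddOn (weight n r) (puncturedRect o p) :=
  .comp_continuous (V := fun t => Real.exp (n / 2 * t)) (by fun_prop) h.bdd_log_r

lemma bdd_weight_inv (h : UntrappedRect n k C M M' V Ω r φ e O o p) :
    BddOn (fun z => (weight n r z)⁻¹) (puncturedRect o p) :=
  (BddOn.comp_continuous (V := fun t => Real.exp (-(n / 2 * t))) (by fun_prop) h.bdd_log_r).congr
    fun _ _ => (Real.exp_neg _).symm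

lemma continuousOn_weight (h : UntrappedRect n k C M M' V Ω r φ e O o p) :
    ContinuousOn (weight n r) (puncturedRect o p) :=
  Real.continuous_exp.comp_continuousOn
    (continuousOn_const.mul (h.continuousOn_r.log fun _ hz => (h.r_pos hz).ne'))

lemma weight_v (h : UntrappedRect n k C M M' V Ω r φ e O o p) (hz : z ∈ puncturedRect o p) :
    HasDerivAt (fun t => weight n r (z.1, t)) (weight n r z * (n / 2 * (dV r z / r z))) z.2 :=
  (((h.r_v hz).log (h.r_pos hz).ne').const_mul (n / 2 : ℝ)).exp

lemma weight_u (h : UntrappedRect n k C M M' V Ω r φ e O o p) (hz : z ∈ puncturedRect o p) :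
    HasDerivAt (fun t => weight n r (t, z.2)) (weight n r z * (n / 2 * (dU r z / r z))) z.1 :=
  (((h.r_u hz).log (h.r_pos hz).ne').const_mul (n / 2 : ℝ)).exp

/-- The weight `r^{n/2}` absorbs the `∂_uφ` term of the wave equation. What drives `r^{n/2} ∂_uφ`
along outgoing rays is then a bounded multiple of `∂_vφ` plus a bounded term; no pointwise bound on
`∂_vφ` is available yet, but the flux bound suffices. -/
lemma bdd_φu (h : UntrappedRect n k C M M' V Ω r φ e O o p) :
    BddOn (dU φ) (puncturedRect o p) := by
  have b1 : BddOn (fun z => weight n r z * (n / 2 * (dU r z * (r z)⁻¹))) (puncturedRect o p) :=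
    h.bdd_weight.mul ((BddOn.const _).mul (h.bdd_ν.mul h.bdd_r_inv))
  have b2 : BddOn (fun z => weight n r z * (1 / 4 * (Ω z ^ 2 * deriv V (φ z))))
      (puncturedRect o p) :=
    h.bdd_weight.mul ((BddOn.const _).mul (h.bdd_Ω_sq.mul h.bdd_deriv_V))
  obtain ⟨A, hA⟩ := b1
  obtain ⟨B, hB⟩ := b2
  have key : BddOn (fun z => weight n r z * dU φ z) (puncturedRect o p) := by
    refine h.bdd_of_flux (f' := fun z => weight n r z * (n / 2 * (dV r z / r z)) * dU φ z +
        weight n r z * dV (dU φ) z) (h.continuousOn_weight.mul (h.continuousOn_dU h.reg.φ_reg))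
      (fun z hz => (h.weight_v hz).mul (h.φu_v hz)) (B := |A| + |B|) (by positivity)
      fun z hz => ?_
    have e1 : weight n r z * (n / 2 * (dV r z / r z)) * dU φ z + weight n r z * dV (dU φ) z =
        -(weight n r z * (n / 2 * (dU r z * (r z)⁻¹)) * dV φ z) -
          weight n r z * (1 / 4 * (Ω z ^ 2 * deriv V (φ z))) := by
      rw [(h.eqs z hz).wave]
      have := (h.r_pos hz).ne'
      field_simp
      ring
    rw [e1]
    have h1 : |dV φ z| ≤ 1 + dV φ z ^ 2 := by
      rw [abs_le]
      constructor <;> nlinarith [sq_nonneg (dV φ z - 1), sq_nonneg (dV φ z + 1)]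
    calc _ ≤ |weight n r z * (n / 2 * (dU r z * (r z)⁻¹))| * |dV φ z| +
          |weight n r z * (1 / 4 * (Ω z ^ 2 * deriv V (φ z)))| := by
            refine (abs_sub _ _).trans ?_
            rw [abs_neg, abs_mul]
      _ ≤ |A| * (1 + dV φ z ^ 2) + |B| * (1 + dV φ z ^ 2) := by
            refine add_le_add (mul_le_mul ((hA z hz).trans (le_abs_self _)) h1 (abs_nonneg _)
              (abs_nonneg _)) ?_
            exact ((hB z hz).trans (le_abs_self _)).trans
              (le_mul_of_one_le_right (abs_nonneg _) (by nlinarith [sq_nonneg (dV φ z)]))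
      _ = _ := by ring
  exact (key.mul h.bdd_weight_inv).congr fun z _ => by
    have := (weight_pos (n := n) (r := r) (z := z)).ne'
    field_simp

lemma bdd_lam (h : UntrappedRect n k C M M' V Ω r φ e O o p) :
    BddOn (dV r) (puncturedRect o p) := h.bdd_lam_and_flux.1

/-- The same weight absorbs the `∂_vφ` term when the wave equation is integrated in `u`. The source
now contains `∂_uφ`, already bounded pointwise, so no flux bound in the ingoing direction is needed.
-/
lemma bdd_φv (h : UntrappedRect n k C M M' V Ω r φ e O o p) :
    BddOn (dV φ) (puncturedRect o p) := by
  have key : BddOn (fun z => weight n r z * dV φ z) (puncturedRect o p) := by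
    refine bddOn_of_bddOn_dU (f' := fun z => weight n r z * (n / 2 * (dU r z / r z)) * dV φ z +
        weight n r z * dV (dU φ) z) h.corner
      (h.continuousOn_weight.mul (h.continuousOn_dV h.reg.φ_reg))
      (fun z hz => (h.weight_u hz).mul (h.φv_u hz)) ?_
    refine (h.bdd_weight.mul (((BddOn.const (-(n / 2 : ℝ))).mul
      ((h.bdd_lam.mul h.bdd_φu).mul h.bdd_r_inv)).sub
        ((BddOn.const (1 / 4)).mul (h.bdd_Ω_sq.mul h.bdd_deriv_V)))).congr fun z hz => ?_
    rw [(h.eqs z hz).wave]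
    have := (h.r_pos hz).ne'
    field_simp
    ring
  exact (key.mul h.bdd_weight_inv).congr fun z _ => by
    have := (weight_pos (n := n) (r := r) (z := z)).ne'
    field_simp

/-- The electric field is bounded, as the charge is conserved. -/
lemma bdd_electric (h : UntrappedRect n k C M M' V Ω r φ e O o p) :
    BddOn (fun z => e z / Ω z ^ 2) (puncturedRect o p) := by
  have key : BddOn (fun z => r z ^ n * e z / Ω z ^ 2) (puncturedRect o p) := by
    refine bddOn_of_bddOn_dV (f' := fun _ => 0) h.corner
      (((h.continuousOn_r.pow n).mul (h.reg.e_reg.continuousOn.mono h.sub)).div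
        (h.continuousOn_Ω.pow 2) fun z hz => pow_ne_zero 2 (h.Ω_pos hz).ne') (fun z hz => ?_)
      (.const 0)
    rw [← (h.eqs z hz).charge_v]
    exact hasDerivAt_right (f := fun z => r z ^ n * e z / Ω z ^ 2)
      ((((h.r_v hz).differentiableAt.pow n).mul (h.e_v hz).differentiableAt).div
        ((h.Ω_v hz).differentiableAt.pow 2) (pow_ne_zero 2 (h.Ω_pos hz).ne'))
  refine (key.mul (h.bdd_r_inv.pow n)).congr fun z hz => ?_
  have := (h.r_pos hz).ne'
  have := (h.Ω_pos hz).ne'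
  rw [inv_pow]
  field_simp

lemma bdd_energyDensity (h : UntrappedRect n k C M M' V Ω r φ e O o p) :
    BddOn (fun z => V (φ z) / 2 + (e z / Ω z ^ 2) ^ 2 + M / (8 * r z ^ 4)) (puncturedRect o p) := by
  refine ((((BddOn.const (1 / 2)).mul h.bdd_V).add (h.bdd_electric.pow 2)).add
    ((BddOn.const (M / 8)).mul (h.bdd_r_inv.pow 4))).congr fun z hz => ?_
  have := (h.r_pos hz).ne'
  field_simp

lemma bdd_r_uv (h : UntrappedRect n k C M M' V Ω r φ e O o p) :
    BddOn (dV (dU r)) (puncturedRect o p) := by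
  refine ((h.bdd_Ω_sq.mul (((h.bdd_r.mul (.const (n : ℝ)⁻¹)).mul h.bdd_energyDensity).sub
    ((BddOn.const (k * (n - 1) / 4)).mul h.bdd_r_inv))).sub
    (((BddOn.const (n - 1 : ℝ)).mul h.bdd_r_inv).mul (h.bdd_ν.mul h.bdd_lam))).congr fun z hz => ?_
  rw [h.dV_dU_r hz]
  have := (h.r_pos hz).ne'
  have := h.n_pos.ne'
  generalize V (φ z) / 2 + (e z / Ω z ^ 2) ^ 2 + M / (8 * r z ^ 4) = F
  field_simp

lemma bdd_conformal_source (h : UntrappedRect n k C M M' V Ω r φ e O o p) :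
    BddOn (fun z => energyFlux Ω r φ e V M z - 2 * energyFlux Ω r φ e V M z / n +
      Ω z ^ 2 / 2 * lagrangian Ω r φ e V M z + Ω z ^ 2 * M' / (2 * n * r z ^ 4))
      (puncturedRect o p) := by
  have b1 : BddOn (energyFlux Ω r φ e V M) (puncturedRect o p) :=
    h.bdd_Ω_sq.mul h.bdd_energyDensity
  have b2 : BddOn (fun z => Ω z ^ 2 / 2 * lagrangian Ω r φ e V M z) (puncturedRect o p) := by
    refine ((h.bdd_φu.mul h.bdd_φv).add ((h.bdd_Ω_sq.mul (.const (1 / 2))).mul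
      ((((BddOn.const 2).mul (h.bdd_electric.pow 2)).sub h.bdd_V).sub
        ((BddOn.const (M / 4)).mul (h.bdd_r_inv.pow 4))))).congr fun z hz => ?_
    rw [lagrangian]
    have := (h.r_pos hz).ne'
    have := (h.Ω_pos hz).ne'
    field_simp
    ring
  refine (((b1.sub ((BddOn.const (2 / n : ℝ)).mul b1)).add b2).add
    ((h.bdd_Ω_sq.mul (.const (M' / (2 * n)))).mul (h.bdd_r_inv.pow 4))).congr fun z hz => ?_
  have := (h.r_pos hz).ne'
  have := h.n_pos.ne'
  field_simp

/-- The conformal equation expresses the `v`-derivative of this quantity through terms that are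
already bounded: `r`, `∂_u∂_v r`, `Ω²` and the matter fields. -/
lemma bdd_logΩu (h : UntrappedRect n k C M M' V Ω r φ e O o p) :
    BddOn (fun z => 2 * dU Ω z / Ω z) (puncturedRect o p) := by
  refine bddOn_of_bddOn_dV h.corner ((continuousOn_const.mul (h.continuousOn_dU h.reg.Ω_reg)).div
    h.continuousOn_Ω fun z hz => (h.Ω_pos hz).ne') (fun z hz => h.logΩu_v hz) ?_
  refine (h.bdd_conformal_source.add ((BddOn.const (n : ℝ)).mul
    (h.bdd_r_inv.mul h.bdd_r_uv))).neg.congr fun z hz => ?_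
  linear_combination -(h.eqs z hz).conformal_uv

lemma bdd_logΩv (h : UntrappedRect n k C M M' V Ω r φ e O o p) :
    BddOn (fun z => 2 * dV Ω z / Ω z) (puncturedRect o p) := by
  refine bddOn_of_bddOn_dU h.corner ((continuousOn_const.mul (h.continuousOn_dV h.reg.Ω_reg)).div
    h.continuousOn_Ω fun z hz => (h.Ω_pos hz).ne') (fun z hz => h.logΩv_u hz) ?_
  refine (h.bdd_conformal_source.add ((BddOn.const (n : ℝ)).mul
    (h.bdd_r_inv.mul h.bdd_r_uv))).neg.congr fun z hz => ?_
  have := (h.eqs z hz).conformal_vu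
  rw [← h.r_mixed.symm h.reg.isOpen (h.sub hz)] at this
  linear_combination -this

/-- Passing to the logarithm gives the positive lower bound on `Ω` together with the upper one; the
earlier estimates bounded `Ω²` only from above. -/
lemma bdd_logΩ (h : UntrappedRect n k C M M' V Ω r φ e O o p) :
    BddOn (fun z => Real.log (Ω z)) (puncturedRect o p) :=
  bddOn_of_bddOn_dV h.corner (h.continuousOn_Ω.log fun z hz => (h.Ω_pos hz).ne')
    (fun z hz => (h.Ω_v hz).log (h.Ω_pos hz).ne')
    (((BddOn.const (1 / 2)).mul h.bdd_logΩv).congr fun z hz => by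
      simp only [Prod.mk.eta]; ring)

lemma bdd_Ω (h : UntrappedRect n k C M M' V Ω r φ e O o p) : BddOn Ω (puncturedRect o p) :=
  (BddOn.comp_continuous Real.continuous_exp h.bdd_logΩ).congr
    fun _ hz => (Real.exp_log (h.Ω_pos hz)).symm

lemma bdd_Ω_inv (h : UntrappedRect n k C M M' V Ω r φ e O o p) :
    BddOn (fun z => (Ω z)⁻¹) (puncturedRect o p) :=
  (BddOn.comp_continuous Real.continuous_exp h.bdd_logΩ.neg).congr fun _ hz => by
    rw [Real.exp_neg, Real.exp_log (h.Ω_pos hz)]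

/-- In an untrapped rectangle the geometry is bounded up to the future corner. -/
theorem geomNorm_lt_top (h : UntrappedRect n k C M M' V Ω r φ e O o p) :
    geomNorm Ω r (puncturedRect o p) < ⊤ := by
  have bΩu : BddOn (dU Ω) (puncturedRect o p) :=
    (((BddOn.const (1 / 2)).mul h.bdd_logΩu).mul h.bdd_Ω).congr fun z hz => by
      have := (h.Ω_pos hz).ne'
      field_simp
  have bΩv : BddOn (dV Ω) (puncturedRect o p) :=
    (((BddOn.const (1 / 2)).mul h.bdd_logΩv).mul h.bdd_Ω).congr fun z hz => by
      have := (h.Ω_pos hz).ne'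
      field_simp
  -- The pure second derivatives of `r` need no integration: Raychaudhuri's equations express them
  -- algebraically in bounded quantities.
  have bruu : BddOn (dU (dU r)) (puncturedRect o p) :=
    ((h.bdd_logΩu.mul h.bdd_ν).sub ((h.bdd_r.mul (.const (n : ℝ)⁻¹)).mul
      (h.bdd_φu.pow 2))).congr fun z hz => by
        rw [h.dU_dU_r hz]; ring
  have brvv : BddOn (dV (dV r)) (puncturedRect o p) :=
    ((h.bdd_logΩv.mul h.bdd_lam).sub ((h.bdd_r.mul (.const (n : ℝ)⁻¹)).mul
      (h.bdd_φv.pow 2))).congr fun z hz => by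
        rw [h.dV_dV_r hz]; ring
  have brvu : BddOn (dU (dV r)) (puncturedRect o p) :=
    h.bdd_r_uv.congr fun z hz => (h.r_mixed.symm h.reg.isOpen (h.sub hz)).symm
  have biu : BddOn (dU fun z => (r z)⁻¹) (puncturedRect o p) :=
    ((h.bdd_ν.mul (h.bdd_r_inv.pow 2)).neg).congr fun z hz => by
      refine ((h.r_u hz).inv (h.r_pos hz).ne').deriv.trans ?_
      simp only [Prod.mk.eta]
      rw [inv_pow]
      ring
  have biv : BddOn (dV fun z => (r z)⁻¹) (puncturedRect o p) :=
    ((h.bdd_lam.mul (h.bdd_r_inv.pow 2)).neg).congr fun z hz => by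
      refine ((h.r_v hz).inv (h.r_pos hz).ne').deriv.trans ?_
      simp only [Prod.mk.eta]
      rw [inv_pow]
      ring
  simp only [geomNorm, normC2, normC1, sup_lt_iff]
  exact ⟨⟨⟨⟨⟨h.bdd_Ω.normC0_lt_top, bΩu.normC0_lt_top⟩, bΩv.normC0_lt_top⟩,
    h.bdd_Ω_inv.normC0_lt_top⟩, ⟨⟨h.bdd_r.normC0_lt_top, ⟨h.bdd_ν.normC0_lt_top,
      bruu.normC0_lt_top⟩, h.bdd_r_uv.normC0_lt_top⟩, ⟨h.bdd_lam.normC0_lt_top,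
        brvu.normC0_lt_top⟩, brvv.normC0_lt_top⟩⟩, ⟨h.bdd_r_inv.normC0_lt_top, biu.normC0_lt_top⟩,
    biv.normC0_lt_top⟩

end UntrappedRect

/-! ### Causal geometry of an evolutionary region -/

lemma IsPreconnected.exists_fst_eq {K : Set (ℝ × ℝ)} (hK : IsPreconnected K) {a b : ℝ × ℝ}
    (ha : a ∈ K) (hb : b ∈ K) {t : ℝ} (h1 : a.1 ≤ t) (h2 : t ≤ b.1) : ∃ c ∈ K, c.1 = t :=
  (isPreconnected_iff_ordConnected.1 (hK.image Prod.fst continuous_fst.continuousOn)).out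
    (mem_image_of_mem _ ha) (mem_image_of_mem _ hb) ⟨h1, h2⟩

lemma IsPreconnected.exists_snd_eq {K : Set (ℝ × ℝ)} (hK : IsPreconnected K) {a b : ℝ × ℝ}
    (ha : a ∈ K) (hb : b ∈ K) {t : ℝ} (h1 : a.2 ≤ t) (h2 : t ≤ b.2) : ∃ c ∈ K, c.2 = t :=
  (isPreconnected_iff_ordConnected.1 (hK.image Prod.snd continuous_snd.continuousOn)).out
    (mem_image_of_mem _ ha) (mem_image_of_mem _ hb) ⟨h1, h2⟩

namespace IsSpacelikeCurve

variable {S : Set (ℝ × ℝ)} {a b : ℝ × ℝ}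

lemma snd_lt (hS : IsSpacelikeCurve S) (ha : a ∈ S) (hb : b ∈ S) (h : a.1 < b.1) : b.2 < a.2 := by
  rcases hS.2 ha hb (fun e => h.ne (congrArg Prod.fst e)) with h' | h'
  · exact h'.2
  · linarith [h'.1]

lemma fst_lt (hS : IsSpacelikeCurve S) (ha : a ∈ S) (hb : b ∈ S) (h : a.2 < b.2) : b.1 < a.1 := by
  rcases hS.2 ha hb (fun e => h.ne (congrArg Prod.snd e)) with h' | h'
  · linarith [h'.2]
  · exact h'.1

lemma eq_of_fst (hS : IsSpacelikeCurve S) (ha : a ∈ S) (hb : b ∈ S) (h : a.1 = b.1) : a = b := by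
  by_contra hne
  rcases hS.2 ha hb hne with h' | h' <;> linarith [h'.1]

lemma eq_of_le (hS : IsSpacelikeCurve S) (ha : a ∈ S) (hb : b ∈ S) (h : a ≤ b) : a = b := by
  by_contra hne
  rcases hS.2 ha hb hne with h' | h'
  · linarith [h'.2, h.2]
  · linarith [h'.1, h.1]

lemma snd_le (hS : IsSpacelikeCurve S) (ha : a ∈ S) (hb : b ∈ S) (h : a.1 ≤ b.1) : b.2 ≤ a.2 := by
  by_contra! h'
  exact (hS.fst_lt ha hb h').not_ge h

lemma fst_le (hS : IsSpacelikeCurve S) (ha : a ∈ S) (hb : b ∈ S) (h : a.2 ≤ b.2) : b.1 ≤ a.1 := by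
  by_contra! h'
  exact (hS.snd_lt ha hb h').not_ge h

end IsSpacelikeCurve

namespace IsTimelikeCurve

variable {Γ : Set (ℝ × ℝ)} {a b : ℝ × ℝ}

lemma snd_lt (hΓ : IsTimelikeCurve Γ) (ha : a ∈ Γ) (hb : b ∈ Γ) (h : a.1 < b.1) : a.2 < b.2 := by
  rcases hΓ.2 ha hb (fun e => h.ne (congrArg Prod.fst e)) with h' | h'
  · exact h'.2
  · linarith [h'.1]

lemma fst_lt (hΓ : IsTimelikeCurve Γ) (ha : a ∈ Γ) (hb : b ∈ Γ) (h : a.2 < b.2) : a.1 < b.1 := by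
  rcases hΓ.2 ha hb (fun e => h.ne (congrArg Prod.snd e)) with h' | h'
  · exact h'.1
  · linarith [h'.2]

lemma eq_of_fst (hΓ : IsTimelikeCurve Γ) (ha : a ∈ Γ) (hb : b ∈ Γ) (h : a.1 = b.1) : a = b := by
  by_contra hne
  rcases hΓ.2 ha hb hne with h' | h' <;> linarith [h'.1]

lemma snd_le (hΓ : IsTimelikeCurve Γ) (ha : a ∈ Γ) (hb : b ∈ Γ) (h : a.1 ≤ b.1) : a.2 ≤ b.2 := by
  by_contra! h'
  exact (hΓ.fst_lt hb ha h').not_ge h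

lemma fst_le (hΓ : IsTimelikeCurve Γ) (ha : a ∈ Γ) (hb : b ∈ Γ) (h : a.2 ≤ b.2) : a.1 ≤ b.1 := by
  by_contra! h'
  exact (hΓ.snd_lt hb ha h').not_ge h

end IsTimelikeCurve

/-- `o` is the common left end of `S` and past end of `Γ`. -/
structure IsRegionCorner (S Γ : Set (ℝ × ℝ)) (o : ℝ × ℝ) : Prop where
  mem_left : o ∈ S
  mem_right : o ∈ Γ
  fst_le : ∀ s ∈ S, s.1 ≤ o.1
  le : ∀ c ∈ Γ, o ≤ c

namespace IsEvolutionaryRegion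

variable {Q S Γ I : Set (ℝ × ℝ)} {o i z p : ℝ × ℝ}

lemma exists_corner (hQ : IsEvolutionaryRegion Q S Γ I) : ∃ o, IsRegionCorner S Γ o := by
  obtain ⟨o, ho, h1, h2⟩ := hQ.corner
  have : o ∈ S ∩ Γ := ho ▸ mem_singleton o
  exact ⟨o, this.1, this.2, h1, h2⟩

/-- In the coordinate `u`, `S` lies at or before the corner `o` and `Γ` at or after it, so the two
graphs overlap only over `o`. -/
lemma eq_of_fst (hQ : IsEvolutionaryRegion Q S Γ I) {c d : ℝ × ℝ} (hc : c ∈ S ∪ Γ)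
    (hd : d ∈ S ∪ Γ) (h : c.1 = d.1) : c = d := by
  obtain ⟨o, ho⟩ := hQ.exists_corner
  have key : ∀ c ∈ S, ∀ d ∈ Γ, c.1 = d.1 → c = d := fun c hc d hd h => by
    have h1 := ho.fst_le c hc
    have h2 := (ho.le d hd).1
    rw [hQ.spacelike.eq_of_fst hc ho.mem_left (by linarith),
      hQ.timelike.eq_of_fst hd ho.mem_right (by linarith)]
  rcases hc with hc | hc <;> rcases hd with hd | hd
  · exact hQ.spacelike.eq_of_fst hc hd h
  · exact key c hc d hd h
  · exact (key d hd c hc h.symm).symm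
  · exact hQ.timelike.eq_of_fst hc hd h

/-- The curve `S ∪ Γ` is a graph over the `u` axis which lies below its chords. -/
lemma exists_fst_eq (hQ : IsEvolutionaryRegion Q S Γ I) {c d : ℝ × ℝ} (hc : c ∈ S ∪ Γ)
    (hd : d ∈ S ∪ Γ) {t : ℝ} (h1 : c.1 ≤ t) (h2 : t ≤ d.1) :
    ∃ x ∈ S ∪ Γ, x.1 = t ∧ x.2 ≤ max c.2 d.2 := by
  obtain ⟨o, ho⟩ := hQ.exists_corner
  have kS : ∀ c ∈ S, ∀ d ∈ S, c.1 ≤ t → t ≤ d.1 → ∃ x ∈ S ∪ Γ, x.1 = t ∧ x.2 ≤ c.2 := by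
    intro c hc d hd h1 h2
    obtain ⟨x, hx, rfl⟩ := hQ.spacelike.1.exists_fst_eq hc hd h1 h2
    exact ⟨x, Or.inl hx, rfl, hQ.spacelike.snd_le hc hx h1⟩
  have kΓ : ∀ c ∈ Γ, ∀ d ∈ Γ, c.1 ≤ t → t ≤ d.1 → ∃ x ∈ S ∪ Γ, x.1 = t ∧ x.2 ≤ d.2 := by
    intro c hc d hd h1 h2
    obtain ⟨x, hx, rfl⟩ := hQ.timelike.1.exists_fst_eq hc hd h1 h2
    exact ⟨x, Or.inr hx, rfl, hQ.timelike.snd_le hx hd h2⟩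
  rcases hc with hc | hc <;> rcases hd with hd | hd
  · obtain ⟨x, hx, e, hle⟩ := kS c hc d hd h1 h2
    exact ⟨x, hx, e, le_max_of_le_left hle⟩
  · rcases le_total t o.1 with h | h
    · obtain ⟨x, hx, e, hle⟩ := kS c hc o ho.mem_left h1 h
      exact ⟨x, hx, e, le_max_of_le_left hle⟩
    · obtain ⟨x, hx, e, hle⟩ := kΓ o ho.mem_right d hd h h2
      exact ⟨x, hx, e, le_max_of_le_right hle⟩
  · have h3 := ho.fst_le d hd
    have h4 := (ho.le c hc).1
    exact ⟨c, Or.inr hc, by linarith, le_max_left _ _⟩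
  · obtain ⟨x, hx, e, hle⟩ := kΓ c hc d hd h1 h2
    exact ⟨x, hx, e, le_max_of_le_right hle⟩

/-- `i` is the past end of `I`, at the right end of `S`. -/
structure IsStart (S I : Set (ℝ × ℝ)) (i : ℝ × ℝ) : Prop where
  mem : i ∈ I
  mem_closure : i ∈ closure S
  le : ∀ j ∈ I, i ≤ j
  lt_fst : ∀ s ∈ S, i.1 < s.1
  snd_lt : ∀ s ∈ S, s.2 < i.2

lemma exists_mem_of_mem_closure {K : Set (ℝ × ℝ)} (hi : i ∈ closure K) {a b c d : ℝ}
    (h1 : a < i.1) (h2 : i.1 < b) (h3 : c < i.2) (h4 : i.2 < d) :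
    ∃ s ∈ K, a < s.1 ∧ s.1 < b ∧ c < s.2 ∧ s.2 < d := by
  obtain ⟨s, ⟨hs1, hs2⟩, hs⟩ := mem_closure_iff.1 hi (Ioo a b ×ˢ Ioo c d)
    (isOpen_Ioo.prod isOpen_Ioo) ⟨⟨h1, h2⟩, ⟨h3, h4⟩⟩
  exact ⟨s, hs, hs1.1, hs1.2, hs2.1, hs2.2⟩

/-- `i` is a limit of the decreasing graph `S` without belonging to it, since `I` is disjoint from
`Q`. If `S` attained the height of `i`, it would do so to the left or to the right of `i`. A point
of `S` with `u` strictly in between would then, by monotonicity, keep `S` away from `i`. The same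
idea applies to the other coordinate. -/
lemma exists_isStart (hQ : IsEvolutionaryRegion Q S Γ I) (hI : I.Nonempty) : ∃ i, IsStart S I i := by
  obtain ⟨i, hi, hcl, hle⟩ := hQ.infinity_start hI
  obtain ⟨o, ho⟩ := hQ.exists_corner
  have hiS : i ∉ S := fun h => hQ.infinity_disjoint.le_bot ⟨hi, hQ.boundary_subset (Or.inl h)⟩
  have io1 : i.1 ≤ o.1 := closure_minimal (fun s hs => ho.fst_le s hs)
    (isClosed_le continuous_fst continuous_const) hcl
  have io2 : o.2 ≤ i.2 := closure_minimal
    (fun s hs => hQ.spacelike.snd_le hs ho.mem_left (ho.fst_le s hs))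
    (isClosed_le continuous_const continuous_snd) hcl
  have h2 : ∀ s ∈ S, s.2 < i.2 := by
    intro s hs
    by_contra! hlt
    obtain ⟨t, ht, e⟩ := hQ.spacelike.1.exists_snd_eq ho.mem_left hs io2 hlt
    have hne : t.1 ≠ i.1 := fun h => hiS (by rwa [← Prod.ext h e])
    rcases hne.lt_or_gt with h | h
    · obtain ⟨t', ht', e'⟩ := hQ.spacelike.1.exists_fst_eq ht ho.mem_left
        (t := (t.1 + i.1) / 2) (by linarith) (by linarith)
      have h3 := hQ.spacelike.snd_lt ht ht' (by linarith)
      obtain ⟨s', hs', g1, -, g3, -⟩ := exists_mem_of_mem_closure hcl (a := t'.1) (b := i.1 + 1)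
        (c := t'.2) (d := i.2 + 1) (by linarith) (by linarith) (by linarith) (by linarith)
      linarith [hQ.spacelike.snd_lt ht' hs' g1]
    · obtain ⟨s', hs', g1, g2, -, -⟩ := exists_mem_of_mem_closure hcl (a := i.1 - 1)
        (b := (t.1 + i.1) / 2) (c := i.2 - 1) (d := i.2 + 1) (by linarith) (by linarith)
        (by linarith) (by linarith)
      obtain ⟨t', ht', e'⟩ := hQ.spacelike.1.exists_fst_eq hs' ht
        (t := (t.1 + i.1) / 2) (by linarith) (by linarith)
      have h3 := hQ.spacelike.snd_lt ht' ht (by linarith)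
      obtain ⟨s'', hs'', -, g2, -, g4⟩ := exists_mem_of_mem_closure hcl (a := i.1 - 1) (b := t'.1)
        (c := i.2 - 1) (d := t'.2) (by linarith) (by linarith) (by linarith) (by linarith)
      linarith [hQ.spacelike.snd_lt hs'' ht' g2]
  refine ⟨i, hi, hcl, hle, fun s hs => ?_, h2⟩
  by_contra! hlt
  obtain ⟨t, ht, e⟩ := hQ.spacelike.1.exists_fst_eq hs ho.mem_left hlt io1
  have h3 := h2 t ht
  obtain ⟨s', hs', -, -, g3, -⟩ := exists_mem_of_mem_closure hcl (a := i.1 - 1) (b := i.1 + 1)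
    (c := (t.2 + i.2) / 2) (d := i.2 + 1) (by linarith) (by linarith) (by linarith) (by linarith)
  obtain ⟨t', ht', e'⟩ := hQ.spacelike.1.exists_snd_eq ht hs' (t := (t.2 + i.2) / 2)
    (by linarith) (by linarith)
  have h4 := hQ.spacelike.fst_lt ht ht' (by linarith)
  obtain ⟨s'', hs'', g1, -, g3', -⟩ := exists_mem_of_mem_closure hcl (a := t'.1) (b := i.1 + 1)
    (c := t'.2) (d := i.2 + 1) (by linarith) (by linarith) (by linarith) (by linarith)
  linarith [hQ.spacelike.fst_lt ht' hs'' g3']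

lemma IsStart.exists_left (hi : IsStart S I i) {t v : ℝ} (h : i.1 < t) (hv : v < i.2) :
    ∃ s ∈ S, s.1 < t ∧ v < s.2 := by
  obtain ⟨s, hs, -, g2, g3, -⟩ := exists_mem_of_mem_closure hi.mem_closure (a := i.1 - 1) (b := t)
    (c := v) (d := i.2 + 1) (by linarith) h hv (by linarith)
  exact ⟨s, hs, g2, g3⟩

/-- The curve `S ∪ I` is a graph over the `v` axis which lies to the left of its chords. -/
lemma exists_snd_eq (hQ : IsEvolutionaryRegion Q S Γ I) {b d : ℝ × ℝ} (hb : b ∈ S ∪ I)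
    (hd : d ∈ S ∪ I) {t : ℝ} (h1 : b.2 ≤ t) (h2 : t ≤ d.2) :
    ∃ x ∈ S ∪ I, x.2 = t ∧ x.1 ≤ max b.1 d.1 := by
  have kS : ∀ b ∈ S, ∀ d ∈ S, b.2 ≤ t → t ≤ d.2 → ∃ x ∈ S ∪ I, x.2 = t ∧ x.1 ≤ b.1 := by
    intro b hb d hd h1 h2
    obtain ⟨x, hx, rfl⟩ := hQ.spacelike.1.exists_snd_eq hb hd h1 h2
    exact ⟨x, Or.inl hx, rfl, hQ.spacelike.fst_le hb hx h1⟩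
  have kI : ∀ b ∈ I, ∀ d ∈ I, b.2 ≤ t → t ≤ d.2 → ∃ x ∈ S ∪ I, x.2 = t ∧ x.1 ≤ d.1 := by
    intro b hb d hd h1 h2
    obtain ⟨x, hx, rfl⟩ := hQ.timelike_infinity.1.exists_snd_eq hb hd h1 h2
    exact ⟨x, Or.inr hx, rfl, hQ.timelike_infinity.fst_le hx hd h2⟩
  rcases hb with hb | hb <;> rcases hd with hd | hd
  · obtain ⟨x, hx, e, hle⟩ := kS b hb d hd h1 h2
    exact ⟨x, hx, e, le_max_of_le_left hle⟩
  · obtain ⟨i, hi⟩ := hQ.exists_isStart ⟨d, hd⟩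
    rcases lt_or_ge t i.2 with h | h
    · obtain ⟨s, hs, -, g⟩ := hi.exists_left (lt_add_one _) h
      obtain ⟨x, hx, e, hle⟩ := kS b hb s hs h1 g.le
      exact ⟨x, hx, e, le_max_of_le_left hle⟩
    · obtain ⟨x, hx, e, hle⟩ := kI i hi.mem d hd h h2
      exact ⟨x, hx, e, le_max_of_le_right hle⟩
  · obtain ⟨i, hi⟩ := hQ.exists_isStart ⟨b, hb⟩
    have := hi.snd_lt d hd
    have := (hi.le b hb).2
    linarith
  · obtain ⟨x, hx, e, hle⟩ := kI b hb d hd h1 h2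
    exact ⟨x, hx, e, le_max_of_le_right hle⟩

lemma exists_below (hQ : IsEvolutionaryRegion Q S Γ I) (hz : z ∈ Q) :
    ∃ c ∈ S ∪ Γ, c.1 = z.1 ∧ c.2 ≤ z.2 := (hQ.subset_region hz).1

lemma exists_right (hQ : IsEvolutionaryRegion Q S Γ I) (hz : z ∈ Q) :
    ∃ b ∈ S ∪ I, b.2 = z.2 ∧ b.1 ≤ z.1 ∧ (b ∈ I → b.1 < z.1) := by
  rcases (hQ.subset_region hz).2 with ⟨b, hb, e, hle⟩ | ⟨b, hb, e, hlt⟩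
  · exact ⟨b, Or.inl hb, e, hle, fun hI => absurd (hQ.boundary_subset (Or.inl hb))
      fun h => hQ.infinity_disjoint.le_bot ⟨hI, h⟩⟩
  · exact ⟨b, Or.inr hb, e, hlt.le, fun _ => hlt⟩

lemma mem_region {c b : ℝ × ℝ} (hc : c ∈ S ∪ Γ) (hc1 : c.1 = z.1) (hc2 : c.2 ≤ z.2)
    (hb : b ∈ S ∪ I) (hb2 : b.2 = z.2) (hb1 : b.1 ≤ z.1) (hbI : b ∈ I → b.1 < z.1) :
    z ∈ boundedRegion S Γ I :=
  ⟨⟨c, hc, hc1, hc2⟩, hb.elim (fun h => Or.inl ⟨b, h, hb2, hb1⟩)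
    fun h => Or.inr ⟨b, h, hb2, hbI h⟩⟩

/-- Points of `Q` can be moved along ingoing null rays towards the past boundary. -/
lemma ray_left_mem (hQ : IsEvolutionaryRegion Q S Γ I) (hz : z ∈ Q) {b : ℝ × ℝ} (hb : b ∈ S ∪ I)
    (hb2 : b.2 = z.2) {t : ℝ} (h1 : b.1 ≤ t) (hI : b ∈ I → b.1 < t) (h2 : t ≤ z.1) :
    (t, z.2) ∈ Q := by
  obtain ⟨c, hc, hc1, hc2⟩ := hQ.exists_below hz
  refine hQ.past_closed z hz _ ?_ ⟨h2, le_rfl⟩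
  -- A point of `S` in the past of `(t, z.2)` and the foot `c` of `z` bracket the value `t`, so `S ∪
  -- Γ` has a point over `t` that is low enough.
  have : ∃ s ∈ S, s.1 ≤ t ∧ s.2 ≤ z.2 := by
    rcases hb with hb | hb
    · exact ⟨b, hb, h1, hb2.le⟩
    · obtain ⟨i, hi⟩ := hQ.exists_isStart ⟨b, hb⟩
      obtain ⟨s, hs, g1, -⟩ := hi.exists_left ((hi.le b hb).1.trans_lt (hI hb)) (sub_one_lt i.2)
      exact ⟨s, hs, g1.le, hb2 ▸ (hi.snd_lt s hs).le.trans (hi.le b hb).2⟩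
  obtain ⟨s, hs, hs1, hs2⟩ := this
  obtain ⟨x, hx, hx1, hx2⟩ := hQ.exists_fst_eq (Or.inl hs) hc hs1 (h2.trans hc1.ge)
  exact mem_region hx hx1 (hx2.trans (max_le hs2 hc2)) hb hb2 h1 hI

/-- Points of `Q` can be moved along outgoing null rays towards the past boundary. -/
lemma ray_down_mem (hQ : IsEvolutionaryRegion Q S Γ I) (hz : z ∈ Q) {c : ℝ × ℝ} (hc : c ∈ S ∪ Γ)
    (hc1 : c.1 = z.1) {t : ℝ} (h1 : c.2 ≤ t) (h2 : t ≤ z.2) : (z.1, t) ∈ Q := by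
  obtain ⟨b, hb, hb2, hb1, hbI⟩ := hQ.exists_right hz
  refine hQ.past_closed z hz _ ?_ ⟨le_rfl, h2⟩
  have : ∃ s ∈ S, s.1 ≤ z.1 ∧ s.2 ≤ t := by
    rcases hc with hc | hc
    · exact ⟨c, hc, hc1.le, h1⟩
    · obtain ⟨o, ho⟩ := hQ.exists_corner
      exact ⟨o, ho.mem_left, hc1 ▸ (ho.le c hc).1, (ho.le c hc).2.trans h1⟩
  obtain ⟨s, hs, hs1, hs2⟩ := this
  obtain ⟨x, hx, hx2, hx1⟩ := hQ.exists_snd_eq (Or.inl hs) hb hs2 (h2.trans hb2.ge)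
  refine mem_region hc hc1 h1 hx hx2 (hx1.trans (max_le hs1 hb1)) fun hxI => ?_
  rcases hb with hb | hb
  · obtain ⟨i, hi⟩ := hQ.exists_isStart ⟨x, hxI⟩
    have := hi.snd_lt b hb
    have := (hi.le x hxI).2
    linarith
  · exact (hQ.timelike_infinity.fst_le hxI hb (by linarith)).trans_lt (hbI hb)

/-- No point of `Q` lies to the past of a point of `S`. -/
lemma eq_of_le_mem (hQ : IsEvolutionaryRegion Q S Γ I) {y : ℝ × ℝ} (hy : y ∈ S) (hz : z ∈ Q)
    (h : z ≤ y) : z = y := by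
  obtain ⟨b, hb, hb2, hb1, hbI⟩ := hQ.exists_right hz
  rcases hb with hb | hb
  · obtain rfl := hQ.spacelike.eq_of_le hb hy ⟨hb1.trans h.1, hb2.le.trans h.2⟩
    exact le_antisymm h ⟨hb1, hb2.le⟩
  · obtain ⟨i, hi⟩ := hQ.exists_isStart ⟨b, hb⟩
    have := hi.snd_lt y hy
    have := (hi.le b hb).2
    linarith [h.2]

end IsEvolutionaryRegion

/-- A point to the past of a first singularity which is a limit of points of `Q` in its own past
belongs to `Q`, unless it has the same past as the singularity. -/
lemma IsFirstSingularity.mem_of_le {Q : Set (ℝ × ℝ)} {p p₁ : ℝ × ℝ} (hp : IsFirstSingularity Q p)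
    (hle : p₁ ≤ p) (hcl : p₁ ∈ closure (Iic p₁ ∩ Q)) (hne : ∃ q ∈ Q, q ≤ p ∧ ¬ q ≤ p₁) :
    p₁ ∈ Q := by
  obtain ⟨-, ⟨-, -, X, hX⟩, hfirst⟩ := hp
  have hsub : Iic p₁ ∩ Q ⊆ Iic p ∩ Q := inter_subset_inter_left _ (Iic_subset_Iic.2 hle)
  -- The compact set that generates `J⁻(p)` also generates the smaller past `J⁻(p₁)`, so the
  -- defining property of a first singularity applies to `p₁`.
  obtain ⟨q, hq, e⟩ := hfirst p₁ ⟨closure_mono inter_subset_right hcl,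
    closure_nonempty_iff.1 ⟨p₁, hcl⟩, X, hX.1, hX.2.1, hsub.trans hX.2.2⟩
    ⟨hsub, fun h => by
      obtain ⟨q, hq, h1, h2⟩ := hne
      exact h2 (h ⟨h1, hq⟩).1⟩
  have h1 : q ≤ p₁ := (e.symm ▸ (⟨self_mem_Iic, hq⟩ : q ∈ Iic q ∩ Q) : q ∈ Iic p₁ ∩ Q).1
  -- `p₁` is a limit of points of its own past, all of which lie below `q`; the two points therefore
  -- coincide.
  have h2 : p₁ ≤ q := by
    rw [e] at hcl
    exact closure_minimal inter_subset_left isClosed_Iic hcl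
  rwa [le_antisymm h2 h1]

/-! ### Past-inextendible causal curves -/

section Curves

variable {M Q S Γ I X : Set (ℝ × ℝ)} {c d : ℝ → ℝ × ℝ} {x y z p o : ℝ × ℝ}

/-- A limit that is outside `M`, or that has no other point of `M` in its past, leaves no room for a
nonconstant continuation. This covers rays ending at `I` and at `S`. -/
lemma isPastInextendible_of_tendsto (hc : IsPastCausalCurve M c) (ht : Tendsto c atTop (𝓝 y))
    (hy : y ∈ M → ∀ z ∈ M, z ≤ y → z = y) : IsPastInextendible M c := by
  refine ⟨hc, fun y' hy' ht' d hd hd0 t h0 => ?_⟩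
  obtain rfl := tendsto_nhds_unique ht ht'
  exact hy hy' _ (hd.2.2 h0) (hd0 ▸ hd.2.1 self_mem_Ici h0 h0)

/-- The segment from `z` to `y`, parametrized so that `y` is approached at infinity. -/
def asymptoticSegment (z y : ℝ × ℝ) (t : ℝ) : ℝ × ℝ :=
  (y.1 + (z.1 - y.1) / (1 + t), y.2 + (z.2 - y.2) / (1 + t))

lemma tendsto_add_div (a b : ℝ) : Tendsto (fun t : ℝ => a + b / (1 + t)) atTop (𝓝 a) := by
  have : Tendsto (fun t : ℝ => b / (1 + t)) atTop (𝓝 0) :=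
    tendsto_const_nhds.div_atTop (tendsto_atTop_add_const_left _ _ tendsto_id)
  simpa using this.const_add a

lemma continuousOn_add_div (a b : ℝ) : ContinuousOn (fun t : ℝ => a + b / (1 + t)) (Ici 0) :=
  continuousOn_const.add (continuousOn_const.div (by fun_prop) fun t ht => by
    have : (0 : ℝ) ≤ t := ht
    positivity)

lemma antitoneOn_add_div (a : ℝ) {b : ℝ} (hb : 0 ≤ b) :
    AntitoneOn (fun t : ℝ => a + b / (1 + t)) (Ici 0) := by
  intro s hs t ht hst
  have : (0 : ℝ) ≤ s := hs
  have : b / (1 + t) ≤ b / (1 + s) := by gcongr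
  simp only
  linarith

lemma add_div_mem {a b : ℝ} (hb : 0 ≤ b) {t : ℝ} (ht : 0 ≤ t) : a + b / (1 + t) ∈ Icc a (a + b) := by
  constructor
  · have : 0 ≤ b / (1 + t) := by positivity
    linarith
  · have : b / (1 + t) ≤ b := div_le_self hb (by linarith)
    linarith

lemma isPastCausalCurve_asymptoticSegment (h : y ≤ z)
    (hM : ∀ t, 0 ≤ t → asymptoticSegment z y t ∈ M) :
    IsPastCausalCurve M (asymptoticSegment z y) :=
  ⟨(continuousOn_add_div _ _).prodMk (continuousOn_add_div _ _),
    fun _ hs _ ht hst => ⟨antitoneOn_add_div _ (sub_nonneg.2 h.1) hs ht hst,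
      antitoneOn_add_div _ (sub_nonneg.2 h.2) hs ht hst⟩, fun t ht => hM t ht⟩

lemma asymptoticSegment_zero : asymptoticSegment z y 0 = z := by simp [asymptoticSegment]

lemma tendsto_asymptoticSegment : Tendsto (asymptoticSegment z y) atTop (𝓝 y) :=
  (tendsto_add_div _ _).prodMk_nhds (tendsto_add_div _ _)

/-- Follow `d` up to the parameter `T`, and then `c`. -/
def concatCurve (d c : ℝ → ℝ × ℝ) (T t : ℝ) : ℝ × ℝ := d (min t T) + (c (max (t - T) 0) - c 0)

lemma concatCurve_of_le {T t : ℝ} (h : t ≤ T) : concatCurve d c T t = d t := by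
  simp [concatCurve, h]

lemma concatCurve_of_ge {T t : ℝ} (hT : c 0 = d T) (h : T ≤ t) :
    concatCurve d c T t = c (t - T) := by
  simp [concatCurve, h, hT]

/-- Past-inextendibility depends only on the end of the curve, and the concatenation is eventually a
reparametrization of `c`. -/
lemma IsPastInextendible.concat {T : ℝ} (hT0 : 0 ≤ T) (hd : IsPastCausalCurve M d)
    (hc : IsPastInextendible M c) (hT : c 0 = d T) :
    IsPastInextendible M (concatCurve d c T) := by
  have m1 : MapsTo (fun t => min t T) (Ici 0) (Ici 0) := fun t ht => le_min ht hT0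
  have m2 : MapsTo (fun t : ℝ => max (t - T) 0) (Ici 0) (Ici 0) :=
    fun t _ => mem_Ici.2 (le_max_right _ _)
  refine ⟨⟨?_, ?_, ?_⟩, fun y hy ht => hc.2 y hy ?_⟩
  · exact (hd.1.comp (by fun_prop) m1).add ((hc.1.1.comp (by fun_prop) m2).sub continuousOn_const)
  · intro s hs t ht hst
    have h1 := hd.2.1 (m1 hs) (m1 ht) (min_le_min_right T hst)
    have h2 := hc.1.2.1 (m2 hs) (m2 ht) (max_le_max_right 0 (sub_le_sub_right hst T))
    exact add_le_add h1 (sub_le_sub_right h2 _)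
  · intro t ht
    rcases le_total t T with h | h
    · rw [concatCurve_of_le h]; exact hd.2.2 ht
    · rw [concatCurve_of_ge hT h]; exact hc.1.2.2 (sub_nonneg.2 h)
  · refine (ht.comp (tendsto_atTop_add_const_right _ T tendsto_id)).congr' ?_
    filter_upwards [eventually_ge_atTop 0] with t ht0
    simp only [Function.comp_apply, id]
    rw [concatCurve_of_ge hT (by linarith)]
    simp

/-- A curve which is past-inextendible in `Q` remains so after adding a point which is not to its
past. -/
lemma IsPastInextendible.insert (hc : IsPastInextendible Q c) (h : ¬ x ≤ c 0) :
    IsPastInextendible (insert x Q) c := by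
  refine ⟨⟨hc.1.1, hc.1.2.1, hc.1.2.2.mono_right (subset_insert _ _)⟩,
    fun y hy ht d hd hd0 t h0 => ?_⟩
  have hy0 : y ≤ c 0 := le_of_tendsto ht (by
    filter_upwards [eventually_ge_atTop 0] with t ht0 using hc.1.2.1 self_mem_Ici ht0 ht0)
  have hdQ : MapsTo d (Ici 0) Q := fun s hs => (hd.2.2 hs).resolve_left fun e =>
    h (e ▸ (hd.2.1 self_mem_Ici hs hs).trans (hd0 ▸ hy0))
  exact hc.2 y (hy.resolve_left fun e => h (e ▸ hy0)) ht d ⟨hd.1, hd.2.1, hdQ⟩ hd0 t h0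

/-- The past-directed outgoing curve along a timelike curve `Γ` towards its past end. -/
lemma IsTimelikeCurve.exists_curve (hΓ : IsTimelikeCurve Γ) (ho : o ∈ Γ) (hz : z ∈ Γ)
    (hle : o ≤ z) : ∃ c, IsPastCausalCurve Γ c ∧ c 0 = z ∧ Tendsto c atTop (𝓝 o) := by
  -- `Γ` is parametrized by `u + v`: connectedness provides every intermediate value, and timelike
  -- separation makes the parametrization injective and order preserving.
  have hsum : ∀ σ ∈ Icc (o.1 + o.2) (z.1 + z.2), ∃ x ∈ Γ, x.1 + x.2 = σ := fun σ hσ =>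
    (isPreconnected_iff_ordConnected.1 (hΓ.1.image (fun x : ℝ × ℝ => x.1 + x.2)
      (by fun_prop))).out (mem_image_of_mem _ ho) (mem_image_of_mem _ hz) hσ
  choose! h hmem hval using hsum
  have hinj : ∀ a ∈ Γ, ∀ b ∈ Γ, a.1 + a.2 ≤ b.1 + b.2 → a ≤ b := by
    intro a ha b hb hab
    by_contra hne
    rcases hΓ.2 ha hb (fun e => hne e.le) with h' | h'
    · exact hne ⟨h'.1.le, h'.2.le⟩
    · linarith [h'.1, h'.2]
  -- Along `Γ` both coordinate increments are nonnegative and add up to the increment of `u + v`, so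
  -- neither exceeds it.
  have hlip : LipschitzOnWith 1 h (Icc (o.1 + o.2) (z.1 + z.2)) := by
    refine LipschitzOnWith.of_dist_le_mul fun σ hσ τ hτ => ?_
    have key : ∀ σ ∈ Icc (o.1 + o.2) (z.1 + z.2), ∀ τ ∈ Icc (o.1 + o.2) (z.1 + z.2), σ ≤ τ →
        dist (h σ) (h τ) ≤ dist σ τ := by
      intro σ hσ τ hτ hle
      have h1 := hinj _ (hmem σ hσ) _ (hmem τ hτ) (by rw [hval σ hσ, hval τ hτ]; exact hle)
      have h2 := hval σ hσ
      have h3 := hval τ hτ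
      rw [Prod.dist_eq, Real.dist_eq, Real.dist_eq, Real.dist_eq, abs_sub_comm, abs_sub_comm _ (h τ).2,
        abs_sub_comm σ, abs_of_nonneg (sub_nonneg.2 h1.1), abs_of_nonneg (sub_nonneg.2 h1.2),
        abs_of_nonneg (sub_nonneg.2 hle)]
      exact max_le (by linarith [h1.2]) (by linarith [h1.1])
    rw [NNReal.coe_one, one_mul]
    rcases le_total σ τ with h' | h'
    · exact key σ hσ τ hτ h'
    · rw [dist_comm, dist_comm σ]; exact key τ hτ σ hσ h'
  have hσ : o.1 + o.2 ≤ z.1 + z.2 := add_le_add hle.1 hle.2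
  set g : ℝ → ℝ := fun t => (o.1 + o.2) + ((z.1 + z.2) - (o.1 + o.2)) / (1 + t) with hg
  have hgm : ∀ t, 0 ≤ t → g t ∈ Icc (o.1 + o.2) (z.1 + z.2) := fun t ht => by
    have := add_div_mem (a := o.1 + o.2) (sub_nonneg.2 hσ) ht
    rwa [add_sub_cancel] at this
  have hend : ∀ x ∈ Γ, x.1 + x.2 ∈ Icc (o.1 + o.2) (z.1 + z.2) → h (x.1 + x.2) = x :=
    fun x hx hxm => le_antisymm (hinj _ (hmem _ hxm) _ hx (hval _ hxm).le)
      (hinj _ hx _ (hmem _ hxm) (hval _ hxm).ge)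
  refine ⟨fun t => h (g t), ⟨hlip.continuousOn.comp (continuousOn_add_div _ _) fun t ht => hgm t ht,
    fun s hs t ht hst => ?_, fun t ht => hmem _ (hgm t ht)⟩, ?_, ?_⟩
  · refine hinj _ (hmem _ (hgm t ht)) _ (hmem _ (hgm s hs)) ?_
    rw [hval _ (hgm t ht), hval _ (hgm s hs)]
    exact antitoneOn_add_div _ (sub_nonneg.2 hσ) hs ht hst
  · have : g 0 = z.1 + z.2 := by simp [hg]
    simp only [this]
    exact hend z hz (right_mem_Icc.2 hσ)
  · have h1 : Tendsto g atTop (𝓝[Icc (o.1 + o.2) (z.1 + z.2)] (o.1 + o.2)) :=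
      tendsto_nhdsWithin_iff.2 ⟨tendsto_add_div _ _, by
        filter_upwards [eventually_ge_atTop 0] with t ht using hgm t ht⟩
    have h2 := (hlip.continuousOn _ (left_mem_Icc.2 hσ)).tendsto.comp h1
    rwa [hend o ho (left_mem_Icc.2 hσ)] at h2

namespace IsEvolutionaryRegion

/-- The past-inextendible ingoing null ray from a point of `Q`. -/
lemma exists_curve_left (hQ : IsEvolutionaryRegion Q S Γ I) (hz : z ∈ Q) :
    ∃ c, IsPastInextendible Q c ∧ c 0 = z ∧ ∀ t, 0 ≤ t → (c t).2 = z.2 := by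
  obtain ⟨b, hb, hb2, hb1, hbI⟩ := hQ.exists_right hz
  have hsnd : ∀ t, (asymptoticSegment z b t).2 = z.2 := fun t => by simp [asymptoticSegment, hb2]
  refine ⟨asymptoticSegment z b, isPastInextendible_of_tendsto
    (isPastCausalCurve_asymptoticSegment ⟨hb1, hb2.le⟩ fun t ht => ?_) tendsto_asymptoticSegment
    fun hbQ y hy hle => ?_, asymptoticSegment_zero, fun t _ => hsnd t⟩
  · have hm := add_div_mem (a := b.1) (sub_nonneg.2 hb1) ht
    have := hQ.ray_left_mem hz hb hb2 (t := (asymptoticSegment z b t).1) hm.1 (fun hI => ?_)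
      (hm.2.trans_eq (add_sub_cancel _ _))
    · rwa [← hsnd t] at this
    · have : 0 < (z.1 - b.1) / (1 + t) := div_pos (sub_pos.2 (hbI hI)) (by linarith)
      simpa [asymptoticSegment] using this
  · rcases hb with hb | hb
    · exact hQ.eq_of_le_mem hb hy hle
    · exact absurd ⟨hb, hbQ⟩ (fun h => hQ.infinity_disjoint.le_bot h)

/-- A past-inextendible curve which follows the outgoing null ray and then the centre. -/
lemma exists_curve_down (hQ : IsEvolutionaryRegion Q S Γ I) (hz : z ∈ Q) :
    ∃ c, IsPastInextendible Q c ∧ c 0 = z ∧ ∀ t, 0 ≤ t → (c t).1 = z.1 ∨ c t ∈ Γ := by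
  obtain ⟨b, hb, hb1, hb2⟩ := hQ.exists_below hz
  have hfst : ∀ t, (asymptoticSegment z b t).1 = z.1 := fun t => by simp [asymptoticSegment, hb1]
  have hmem : ∀ v ∈ Icc b.2 z.2, (z.1, v) ∈ Q := fun v hv => hQ.ray_down_mem hz hb hb1 hv.1 hv.2
  rcases hb with hb | hb
  · refine ⟨asymptoticSegment z b, isPastInextendible_of_tendsto
      (isPastCausalCurve_asymptoticSegment ⟨hb1.le, hb2⟩ fun t ht => ?_) tendsto_asymptoticSegment
      fun _ y hy hle => hQ.eq_of_le_mem hb hy hle, asymptoticSegment_zero, fun t _ => .inl (hfst t)⟩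
    have hm := add_div_mem (a := b.2) (sub_nonneg.2 hb2) ht
    have := hmem (asymptoticSegment z b t).2 ⟨hm.1, hm.2.trans_eq (add_sub_cancel _ _)⟩
    rwa [← hfst t] at this
  -- A ray ending on `Γ` could be continued down the centre. It is therefore followed by `Γ` as far
  -- as the corner, which has no other point of `Q` in its past.
  · obtain ⟨o, ho⟩ := hQ.exists_corner
    obtain ⟨c, hc, hc0, hct⟩ := hQ.timelike.exists_curve ho.mem_right hb (ho.le b hb)
    have hcQ : IsPastInextendible Q c := isPastInextendible_of_tendsto
      ⟨hc.1, hc.2.1, hc.2.2.mono_right fun x hx => hQ.boundary_subset (Or.inr hx)⟩ hct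
      fun _ y hy hle => hQ.eq_of_le_mem ho.mem_left hy hle
    set d : ℝ → ℝ × ℝ := fun t => (z.1, max (z.2 - t) b.2) with hd
    have hdQ : IsPastCausalCurve Q d := by
      refine ⟨by fun_prop, fun s _ t _ hst => ⟨le_rfl, max_le_max_right _ (by linarith)⟩,
        fun t ht => hmem _ ⟨le_max_right _ _, max_le ?_ hb2⟩⟩
      have : (0 : ℝ) ≤ t := ht
      linarith
    have hT0 : 0 ≤ z.2 - b.2 := sub_nonneg.2 hb2
    have hdT : c 0 = d (z.2 - b.2) := by
      rw [hc0]
      exact Prod.ext hb1 (by simp [hd])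
    refine ⟨concatCurve d c (z.2 - b.2), hcQ.concat hT0 hdQ hdT, ?_, fun t ht => ?_⟩
    · rw [concatCurve_of_le hT0]
      simp [hd, hb2]
    · rcases le_total t (z.2 - b.2) with h | h
      · exact .inl (by rw [concatCurve_of_le h])
      · exact .inr (by rw [concatCurve_of_ge hdT h]; exact hc.2.2 (sub_nonneg.2 h))

/-- A compact set generating `J⁻(p)` reaches at least as far out as any point of `J⁻(p) ∩ Q`. -/
lemma exists_snd_le_of_generates (hQ : IsEvolutionaryRegion Q S Γ I) (hX : Generates Q X p)
    (hx : x ∈ Q) (hxp : x ≤ p) : ∃ y ∈ X, x.2 ≤ y.2 := by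
  rcases hX.2.2 ⟨hxp, hx⟩ with h | ⟨y, hy, hle⟩
  · obtain ⟨c, hc, hc0, hc2⟩ := hQ.exists_curve_left hx
    obtain ⟨t, ht, hm⟩ := h.2 c (by rwa [insert_eq_of_mem hx]) hc0
    exact ⟨c t, hm, (hc2 t ht).ge⟩
  · exact ⟨y, hy, hle.2⟩

end IsEvolutionaryRegion

end Curves

/-! ### First singularities off the closure of the centre -/

namespace IsEvolutionaryRegion

variable {Q S Γ I X : Set (ℝ × ℝ)} {o i c b w z p : ℝ × ℝ}

/-- The outgoing null ray to the past of a first singularity off the closure of the centre ends on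
`S ∪ Γ`. -/
lemma exists_below_of_isFirstSingularity (hQ : IsEvolutionaryRegion Q S Γ I)
    (hp : IsFirstSingularity Q p) (hpΓ : p ∉ closure Γ) :
    ∃ c ∈ S ∪ Γ, c.1 = p.1 ∧ c.2 < p.2 := by
  obtain ⟨o, ho⟩ := hQ.exists_corner
  obtain ⟨w, hwp, hwQ⟩ := hp.2.1.2.1
  obtain ⟨cw, hcw, hcw1, hcw2⟩ := hQ.exists_below hwQ
  have hw1 : w.1 ≤ p.1 := hwp.1
  have hw2 : w.2 ≤ p.2 := hwp.2
  have near := fun {a b c d : ℝ} => exists_mem_of_mem_closure (a := a) (b := b) (c := c) (d := d)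
    hp.1.1
  by_cases hex : ∃ c ∈ S ∪ Γ, c.1 = p.1
  · obtain ⟨c, hc, hc1⟩ := hex
    rcases lt_trichotomy c.2 p.2 with h | h | h
    · exact ⟨c, hc, hc1, h⟩
    · exact absurd (hQ.boundary_subset hc) (by rw [Prod.ext hc1 h]; exact hp.1.2)
    have hlt : cw.1 < c.1 := lt_of_le_of_ne (by linarith) fun e => by
      have := congrArg Prod.snd (hQ.eq_of_fst hcw hc e)
      linarith
    have hcΓ : c ∈ Γ := hc.resolve_left fun hcS => by
      rcases hcw with hcw | hcw
      · linarith [hQ.spacelike.snd_lt hcw hcS hlt]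
      · linarith [ho.fst_le c hcS, (ho.le cw hcw).1]
    have ho2 : o.2 ≤ p.2 := by
      rcases hcw with hcw | hcw
      · linarith [hQ.spacelike.snd_le hcw ho.mem_left (ho.fst_le _ hcw)]
      · linarith [(ho.le cw hcw).2]
    -- If `Γ` passed above `p`, this point of `Γ` would be above `p.2` but at smaller `u`. Points of
    -- `Q` near `p` would then lie below `Γ`, which is impossible.
    obtain ⟨c', hc', e⟩ := hQ.timelike.1.exists_snd_eq ho.mem_right hcΓ (t := (p.2 + c.2) / 2)
      (by linarith) (by linarith)
    have hc'1 := hQ.timelike.fst_lt hc' hcΓ (by linarith)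
    obtain ⟨q, hq, g1, -, -, g4⟩ := near (a := c'.1) (b := p.1 + 1) (c := p.2 - 1) (d := c'.2)
      (by linarith) (by linarith) (by linarith) (by linarith)
    obtain ⟨cq, hcq, hcq1, hcq2⟩ := hQ.exists_below hq
    rcases hcq with hcq | hcq
    · linarith [ho.fst_le cq hcq, (ho.le c' hc').1]
    · linarith [hQ.timelike.snd_lt hc' hcq (by linarith)]
  -- Now `S ∪ Γ` stays strictly at `u < p.1`, so `Γ` accumulates at `(p.1, v)`, with `v` the
  -- supremum of its heights. Either this limit is `p`, contrary to the hypothesis, or it lies below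
  -- `p` and firstness puts it in `Q`.
  · push Not at hex
    have hlt : ∀ c ∈ S ∪ Γ, c.1 < p.1 := fun c hc => by
      by_contra! hle
      obtain ⟨x, hx, e, -⟩ := hQ.exists_fst_eq hcw hc (hcw1.trans_le hw1) hle
      exact hex x hx e
    have hbelow : ∀ q ∈ Q, o.1 < q.1 → q.1 < p.1 ∧ ∃ c ∈ Γ, c.1 = q.1 ∧ c.2 ≤ q.2 := by
      intro q hq h
      obtain ⟨cq, hcq, hcq1, hcq2⟩ := hQ.exists_below hq
      exact ⟨hcq1 ▸ hlt cq hcq, cq, hcq.resolve_left fun h' => by linarith [ho.fst_le cq h'],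
        hcq1, hcq2⟩
    have ho1 := hlt o (Or.inl ho.mem_left)
    have hle : ∀ c ∈ Γ, c.2 ≤ p.2 := by
      intro c hc
      by_contra! h
      obtain ⟨q, hq, g1, -, -, g4⟩ := near (a := c.1) (b := p.1 + 1) (c := p.2 - 1) (d := c.2)
        (hlt c (Or.inr hc)) (by linarith) (by linarith) (by linarith)
      obtain ⟨-, cq, hcq, hcq1, hcq2⟩ := hbelow q hq ((ho.le c hc).1.trans_lt g1)
      linarith [hQ.timelike.snd_lt hc hcq (by linarith)]
    have hlub : IsLUB (Prod.snd '' Γ) (sSup (Prod.snd '' Γ)) :=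
      isLUB_csSup ⟨_, mem_image_of_mem _ ho.mem_right⟩ ⟨p.2, by rintro _ ⟨c, hc, rfl⟩; exact hle c hc⟩
    set v := sSup (Prod.snd '' Γ) with hv
    have hvle : ∀ c ∈ Γ, c.2 ≤ v := fun c hc => hlub.1 (mem_image_of_mem _ hc)
    have hvp : v ≤ p.2 := hlub.2 (by rintro _ ⟨c, hc, rfl⟩; exact hle c hc)
    have hcl : (p.1, v) ∈ closure Γ := by
      rw [Metric.mem_closure_iff]
      intro ε hε
      obtain ⟨q, hq, g1, -, -, -⟩ := near (a := max o.1 (p.1 - ε)) (b := p.1 + 1) (c := p.2 - 1)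
        (d := p.2 + 1) (max_lt ho1 (by linarith)) (by linarith) (by linarith) (by linarith)
      obtain ⟨-, c₁, hc₁, e₁, -⟩ := hbelow q hq ((le_max_left _ _).trans_lt g1)
      have g2 := (le_max_right _ _).trans_lt g1
      obtain ⟨_, ⟨c₂, hc₂, rfl⟩, e₂, -⟩ := hlub.exists_between (sub_lt_self v hε)
      have : ∃ c ∈ Γ, p.1 - ε < c.1 ∧ v - ε < c.2 := by
        rcases le_total c₁.1 c₂.1 with h | h
        · exact ⟨c₂, hc₂, by linarith, e₂⟩
        · exact ⟨c₁, hc₁, by linarith, e₂.trans_le (hQ.timelike.snd_le hc₂ hc₁ h)⟩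
      obtain ⟨c, hc, h1, h2⟩ := this
      refine ⟨c, hc, ?_⟩
      have h3 := hlt c (Or.inr hc)
      have h4 := hvle c hc
      rw [Prod.dist_eq, Real.dist_eq, Real.dist_eq]
      exact max_lt (abs_lt.2 ⟨by linarith, by linarith⟩)
        (abs_lt.2 ⟨by linarith, by linarith⟩)
    have hvlt : v < p.2 := lt_of_le_of_ne hvp fun e => hpΓ (by rwa [e] at hcl)
    -- The past of `(p.1, v)` is strictly smaller than that of `p`, since `Q` has points of `J⁻(p)`
    -- above height `v`. Membership in `Q` would give `S ∪ Γ` a point over `p.1`, a contradiction.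
    have hmem : (p.1, v) ∈ Q := by
      refine hp.mem_of_le ⟨le_rfl, hvp⟩ (closure_mono (fun c hc => ?_) hcl) ?_
      · exact ⟨⟨(hlt c (Or.inr hc)).le, hvle c hc⟩, hQ.boundary_subset (Or.inr hc)⟩
      · obtain ⟨q, hq, g1, -, g3, -⟩ := near (a := o.1) (b := p.1 + 1) (c := v)
          (d := p.2 + 1) ho1 (by linarith) hvlt (by linarith)
        obtain ⟨hqp, cq, hcq, hcq1, hcq2⟩ := hbelow q hq g1
        exact ⟨_, hQ.ray_down_mem hq (Or.inr hcq) hcq1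
          (le_min hcq2 ((hvle _ hcq).trans hvp)) (min_le_left _ _), ⟨hqp.le, min_le_right _ _⟩,
          fun h => (lt_min g3 hvlt).not_ge h.2⟩
    obtain ⟨c, hc, e, -⟩ := hQ.exists_below hmem
    exact absurd e (hex c hc)

/-- The ingoing null ray to the past of a first singularity off the closure of the centre ends on
`S ∪ I`. -/
lemma exists_right_of_isFirstSingularity (hQ : IsEvolutionaryRegion Q S Γ I)
    (hp : IsFirstSingularity Q p) (hc : c ∈ S ∪ Γ) (hc1 : c.1 = p.1) (hc2 : c.2 < p.2) :
    ∃ b ∈ S ∪ I, b.2 = p.2 ∧ b.1 < p.1 := by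
  obtain ⟨w, hwp, hwQ⟩ := hp.2.1.2.1
  obtain ⟨bw, hbw, hbw2, hbw1, hbwI⟩ := hQ.exists_right hwQ
  have hw1 : w.1 ≤ p.1 := hwp.1
  have hw2 : w.2 ≤ p.2 := hwp.2
  have near := fun {a b c d : ℝ} => exists_mem_of_mem_closure (a := a) (b := b) (c := c) (d := d)
    hp.1.1
  have hIS : ∀ d ∈ I, ∀ s ∈ S, s.2 < d.2 := fun d hd s hs => by
    obtain ⟨i, hi⟩ := hQ.exists_isStart ⟨d, hd⟩
    exact (hi.snd_lt s hs).trans_le (hi.le d hd).2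
  by_cases hex : ∃ b ∈ S ∪ I, b.2 = p.2
  · obtain ⟨b, hb, hb2⟩ := hex
    refine ⟨b, hb, hb2, ?_⟩
    by_contra! hle
    rcases hb with hb | hb
    · have e := hQ.eq_of_le_mem hb hwQ ⟨hw1.trans hle, hw2.trans hb2.ge⟩
      subst e
      have e' : w = p := le_antisymm hwp ⟨hle, hb2.ge⟩
      exact hp.1.2 (e' ▸ hwQ)
    obtain ⟨i, hi⟩ := hQ.exists_isStart ⟨b, hb⟩
    have hi1 : i.1 < w.1 := by
      rcases hbw with h | h
      · linarith [hi.lt_fst bw h]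
      · linarith [(hi.le bw h).1, hbwI h]
    rcases hle.lt_or_eq with hlt | heq
    · obtain ⟨b', hb', e⟩ := hQ.timelike_infinity.1.exists_fst_eq hi.mem hb
        (t := (p.1 + b.1) / 2) (by linarith) (by linarith)
      have h2 := hQ.timelike_infinity.snd_lt hb' hb (by linarith)
      obtain ⟨q, hq, -, g2, g3, -⟩ := near (a := p.1 - 1) (b := b'.1) (c := b'.2) (d := p.2 + 1)
        (by linarith) (by linarith) (by linarith) (by linarith)
      obtain ⟨bq, hbq, hbq2, hbq1, -⟩ := hQ.exists_right hq
      rcases hbq with hbq | hbq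
      · linarith [hIS b' hb' bq hbq]
      · linarith [hQ.timelike_infinity.fst_lt hb' hbq (by linarith)]
    -- The remaining bad case is a singularity on `I` itself. Slightly earlier points `j` of `I` are
    -- then limits of points of `Q` in their own past, so firstness would place `j` in `Q`, from
    -- which `I` is disjoint.
    · have hpI : p ∈ I := by rwa [Prod.ext heq hb2.symm]
      have hip : i.1 < p.1 := by linarith
      have hip2 := hQ.timelike_infinity.snd_lt hi.mem hpI hip
      have hZ : ∀ j ∈ I, c.2 < j.2 → j.2 < p.2 → ∀ t, j.1 < t → t < p.1 → (t, j.2) ∈ Q := by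
        intro j hj h1 h2 t h3 h4
        obtain ⟨q, hq, g1, -, g3, -⟩ := near (a := t) (b := p.1 + 1) (c := j.2) (d := p.2 + 1)
          h4 (by linarith) h2 (by linarith)
        obtain ⟨s, hs, hs1, -⟩ := hi.exists_left ((hi.le j hj).1.trans_lt h3) (sub_one_lt i.2)
        obtain ⟨x, hx, hx1, hx2⟩ := hQ.exists_fst_eq (Or.inl hs) hc hs1.le (h4.le.trans hc1.ge)
        exact hQ.past_closed q hq _ (mem_region hx hx1
          (hx2.trans (max_le (hIS j hj s hs).le h1.le)) (Or.inr hj) rfl h3.le fun _ => h3)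
          ⟨g1.le, g3.le⟩
      have hm : max i.2 c.2 < p.2 := max_lt hip2 hc2
      obtain ⟨j, hj, e⟩ := hQ.timelike_infinity.1.exists_snd_eq hi.mem hpI
        (t := (max i.2 c.2 + p.2) / 2) (by linarith [le_max_left i.2 c.2]) (by linarith)
      have hjp := hQ.timelike_infinity.fst_lt hj hpI (by linarith)
      have hij : max i.2 c.2 < j.2 := by linarith
      refine hQ.infinity_disjoint.le_bot ⟨hj, hp.mem_of_le (p₁ := j) ⟨hjp.le, by linarith⟩ ?_ ?_⟩
      · rw [Metric.mem_closure_iff]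
        intro ε hε
        obtain ⟨v, hv1, hv2⟩ := exists_between (max_lt hij (sub_lt_self j.2 hε))
        have hv3 := (le_max_left _ _).trans_lt hv1
        have hv4 := (le_max_right _ _).trans_lt hv1
        obtain ⟨j', hj', e'⟩ := hQ.timelike_infinity.1.exists_snd_eq hi.mem hj (t := v)
          ((le_max_left _ _).trans hv3.le) hv2.le
        have := hZ j' hj' (e' ▸ (le_max_right _ _).trans_lt hv3) (by linarith) j.1
          (hQ.timelike_infinity.fst_lt hj' hj (by linarith)) hjp
        refine ⟨(j.1, j'.2), ⟨⟨le_rfl, e' ▸ hv2.le⟩, this⟩, ?_⟩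
        rw [Prod.dist_eq, Real.dist_eq, Real.dist_eq]
        exact max_lt (by simpa using hε) (abs_lt.2 ⟨by linarith, by linarith⟩)
      · exact ⟨_, hZ j hj ((le_max_right _ _).trans_lt hij) (by linarith) ((j.1 + p.1) / 2)
          (by linarith) (by linarith), ⟨by simp only; linarith, by simp only; linarith⟩,
          fun h => by have := h.1; simp only at this; linarith⟩
  · push Not at hex
    exfalso
    have hlt : ∀ d ∈ S ∪ I, d.2 < p.2 := fun d hd => by
      by_contra! hle
      obtain ⟨x, hx, e, -⟩ := hQ.exists_snd_eq hbw hd (hbw2.trans_le hw2) hle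
      exact hex x hx e
    have hQlt : ∀ q ∈ Q, q.2 < p.2 := fun q hq => by
      obtain ⟨d, hd, e, -⟩ := hQ.exists_right hq
      exact e ▸ hlt d hd
    -- Compactness enters here. All of `Q` lies at `v < p.2`, so `X` attains a maximal height below
    -- `p.2`. But a generating set must reach as high as every point of `J⁻(p) ∩ Q`.
    obtain ⟨-, -, X, hX⟩ := hp.2.1
    obtain ⟨x₀, hx₀, -⟩ := hQ.exists_snd_le_of_generates hX hwQ hwp
    obtain ⟨y, hy, hmax⟩ := hX.1.exists_isMaxOn ⟨x₀, hx₀⟩ continuous_snd.continuousOn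
    have hyp := hQlt y (hX.2.1 hy)
    have hex' : ∃ x ∈ Q, x ≤ p ∧ y.2 < x.2 := by
      obtain ⟨q, hq, -, -, g3, -⟩ := near (a := p.1 - 1) (b := p.1 + 1) (c := max y.2 w.2)
        (d := p.2 + 1) (by linarith) (by linarith) (max_lt hyp (hQlt w hwQ)) (by linarith)
      have g1 := (le_max_left _ _).trans_lt g3
      have g2 := (le_max_right _ _).trans_lt g3
      rcases le_or_gt q.1 p.1 with h | h
      · exact ⟨q, hq, ⟨h, (hQlt q hq).le⟩, g1⟩
      -- The approximating point may have `u > p.1`. It is then moved along its ingoing ray to `u =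
      -- p.1`, once the ray is known to start no further right than that.
      obtain ⟨d, hd, hd2, hd1, hdI⟩ := hQ.exists_right hq
      have hdS : d ∈ S → d.1 ≤ p.1 := fun hdS => by
        rcases hbw with hbw | hbw
        · linarith [hQ.spacelike.fst_lt hbw hdS (by linarith)]
        · linarith [hIS bw hbw d hdS]
      -- `I` moves strictly to larger `u` as `v` grows. If it had reached `u = p.1` at this height,
      -- `Q` could not approach `p` from below.
      have hdI : d ∈ I → d.1 < p.1 := fun hdI => by
        by_contra! hle
        obtain ⟨q₂, hq₂, -, -, k3, -⟩ := near (a := p.1 - 1) (b := p.1 + 1) (c := q.2)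
          (d := p.2 + 1) (by linarith) (by linarith) (hQlt q hq) (by linarith)
        obtain ⟨d₂, hd₂, e₂, -⟩ := hQ.exists_right hq₂
        have hd₂ : d₂ ∈ I := hd₂.resolve_left fun h' => by linarith [hIS d hdI d₂ h']
        have l₂ := hQ.timelike_infinity.fst_lt hdI hd₂ (by linarith)
        obtain ⟨q₃, hq₃, -, m2, m3, -⟩ := near (a := p.1 - 1) (b := d₂.1) (c := q₂.2)
          (d := p.2 + 1) (by linarith) (by linarith) (hQlt q₂ hq₂) (by linarith)
        obtain ⟨d₃, hd₃, e₃, f₃, -⟩ := hQ.exists_right hq₃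
        have hd₃ : d₃ ∈ I := hd₃.resolve_left fun h' => by linarith [hIS d hdI d₃ h']
        linarith [hQ.timelike_infinity.fst_lt hd₂ hd₃ (by linarith)]
      exact ⟨(p.1, q.2), hQ.ray_left_mem hq hd hd2 (hd.elim hdS fun h' => (hdI h').le) hdI h.le,
        ⟨le_rfl, (hQlt q hq).le⟩, g1⟩
    obtain ⟨x, hx, hxp, hyx⟩ := hex'
    obtain ⟨y', hy', hle⟩ := hQ.exists_snd_le_of_generates hX hx hxp
    exact (hyx.trans_le hle).not_ge (hmax hy')

/-- A first singularity off the closure of the centre belongs to the region bounded by `S`, `Γ` and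
`I`, and it is the only point of its causal past near it which is missing from `Q`. -/
theorem exists_rect_of_isFirstSingularity (hQ : IsEvolutionaryRegion Q S Γ I)
    (hp : IsFirstSingularity Q p) (hpΓ : p ∉ closure Γ) :
    p ∈ boundedRegion S Γ I ∧ ∃ a : ℝ × ℝ, a.1 < p.1 ∧ a.2 < p.2 ∧
      ∀ z, z ≤ p → z ≠ p → a.1 < z.1 → a.2 < z.2 → z ∈ Q \ (S ∪ Γ) := by
  obtain ⟨c, hc, hc1, hc2⟩ := hQ.exists_below_of_isFirstSingularity hp hpΓ
  obtain ⟨b, hb, hb2, hb1⟩ := hQ.exists_right_of_isFirstSingularity hp hc hc1 hc2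
  obtain ⟨o, ho⟩ := hQ.exists_corner
  -- A point of `S` strictly to the past of `p`. With `b` and `c` it brackets both coordinates of
  -- points near `p` in its past, so the chord properties of `S ∪ Γ` and `S ∪ I` apply to all of
  -- them.
  have hs : ∃ s ∈ S, s.1 < p.1 ∧ s.2 < p.2 := by
    by_cases hcS : c ∈ S
    · have : ∃ x ∈ S, x.1 < p.1 := by
        rcases hb with hb | hb
        · exact ⟨b, hb, hb1⟩
        · obtain ⟨i, hi⟩ := hQ.exists_isStart ⟨b, hb⟩
          obtain ⟨s, hs, h, -⟩ := hi.exists_left ((hi.le b hb).1.trans_lt hb1) (sub_one_lt i.2)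
          exact ⟨s, hs, h⟩
      obtain ⟨x, hx, hx1⟩ := this
      rcases lt_or_ge x.2 p.2 with h | h
      · exact ⟨x, hx, hx1, h⟩
      · obtain ⟨s, hs, e⟩ := hQ.spacelike.1.exists_snd_eq hcS hx (t := (c.2 + p.2) / 2)
          (by linarith) (by linarith)
        exact ⟨s, hs, hc1 ▸ hQ.spacelike.fst_lt hcS hs (by linarith), by linarith⟩
    · have hcΓ := hc.resolve_left hcS
      refine ⟨o, ho.mem_left, lt_of_le_of_ne (hc1 ▸ (ho.le c hcΓ).1) fun e => hcS ?_,
        (ho.le c hcΓ).2.trans_lt hc2⟩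
      rw [← hQ.eq_of_fst (Or.inl ho.mem_left) hc (e.trans hc1.symm)]
      exact ho.mem_left
  obtain ⟨s, hs, hs1, hs2⟩ := hs
  have hreg : ∀ z, z ≤ p → max s.1 b.1 < z.1 → max s.2 c.2 < z.2 →
      z ∈ boundedRegion S Γ I ∧ z ∉ S ∪ Γ := by
    intro z hz h1 h2
    obtain ⟨x, hx, hx1, hx2⟩ := hQ.exists_fst_eq (Or.inl hs) hc
      ((le_max_left _ _).trans h1.le) (hz.1.trans hc1.ge)
    obtain ⟨y, hy, hy2, hy1⟩ := hQ.exists_snd_eq (Or.inl hs) hb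
      ((le_max_left _ _).trans h2.le) (hz.2.trans hb2.ge)
    refine ⟨mem_region hx hx1 (hx2.trans h2.le) hy hy2 (hy1.trans h1.le)
      fun _ => hy1.trans_lt h1, fun hzm => ?_⟩
    have := hQ.eq_of_fst hx hzm hx1
    exact (hx2.trans_lt h2).ne (congrArg Prod.snd this)
  have ha1 : max s.1 b.1 < p.1 := max_lt hs1 hb1
  have ha2 : max s.2 c.2 < p.2 := max_lt hs2 hc2
  have hcl : ∀ z, z ≤ p → max s.1 b.1 < z.1 → max s.2 c.2 < z.2 → z ∈ closure (Iic z ∩ Q) := by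
    intro z hz h1 h2
    have hU : IsOpen (Ioi (max s.1 b.1) ×ˢ Ioi (max s.2 c.2)) := isOpen_Ioi.prod isOpen_Ioi
    have hmem := hU.inter_closure ⟨⟨ha1, ha2⟩, hp.1.1⟩
    -- The map `q ↦ q ⊓ z` is continuous, sends `p` to `z`, and by past-closedness sends points of
    -- `Q` near `p` to points of `Q` in the past of `z`.
    have hcont : Continuous fun q : ℝ × ℝ => q ⊓ z :=
      (continuous_fst.min continuous_const).prodMk (continuous_snd.min continuous_const)
    have := hcont.continuousWithinAt.mem_closure hmem (t := Iic z ∩ Q) fun q hq =>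
        ⟨mem_Iic.2 inf_le_right, hQ.past_closed q hq.2 _
          (hreg _ (inf_le_right.trans hz) (lt_min hq.1.1 h1) (lt_min hq.1.2 h2)).1 inf_le_left⟩
    rwa [inf_eq_right.2 hz] at this
  refine ⟨(hreg p le_rfl ha1 ha2).1, (max s.1 b.1, max s.2 c.2), ha1, ha2,
    fun z hz hne h1 h2 => ⟨hp.mem_of_le hz (hcl z hz h1 h2) ?_, (hreg z hz h1 h2).2⟩⟩
  -- If all of `J⁻(p) ∩ Q` were below `z`, its limit point `p` would be too.
  by_contra! h
  exact hne (le_antisymm hz (closure_minimal (fun q hq => h q hq.2 hq.1) isClosed_Iic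
    (hcl p le_rfl ha1 ha2)))

/-- Points of `J⁻(p) ∩ Q` near a first singularity `p` belong to the domain of dependence of any
set generating `J⁻(p)`. -/
lemma eventually_mem_dPlus (hQ : IsEvolutionaryRegion Q S Γ I) (hpQ : p ∉ Q)
    (hpr : p ∈ boundedRegion S Γ I) (hX : Generates Q X p) :
    ∀ᶠ z in 𝓝 p, z ∈ Iic p ∩ Q → z ∈ DPlus Q X := by
  -- `p` is not in `J⁻(X)`, since past-closedness would put it in `Q`. As `X` is compact, this
  -- persists in a neighbourhood.
  have : ∀ᶠ z in 𝓝 p, ∀ x ∈ X, ¬ z ≤ x := by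
    refine hX.1.eventually_forall_of_forall_eventually fun x hx => ?_
    exact (isClosed_le continuous_fst continuous_snd).isOpen_compl.mem_nhds fun h =>
      hpQ (hQ.past_closed x (hX.2.1 hx) p hpr h)
  filter_upwards [this] with z hz hzp
  exact (hX.2.2 hzp).resolve_right fun ⟨x, hx, hle⟩ => hz x hx hle

end IsEvolutionaryRegion

/-! ### The domain of dependence of the past faces of a rectangle -/

/-- The two null segments bounding the rectangle `J⁺(o) ∩ J⁻(p)` to the past. -/
def pastFaces (o p : ℝ × ℝ) : Set (ℝ × ℝ) := {z ∈ Icc o p | z.1 = o.1 ∨ z.2 = o.2}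

section PastFaces

variable {Q S Γ I : Set (ℝ × ℝ)} {o p x z : ℝ × ℝ}

lemma pastFaces_subset (h1 : o.1 < p.1) (h2 : o.2 < p.2) : pastFaces o p ⊆ puncturedRect o p :=
  fun z hz => ⟨hz.1, fun e => by
    obtain rfl : z = p := e
    rcases hz.2 with h | h <;> linarith⟩

lemma isCompact_pastFaces : IsCompact (pastFaces o p) :=
  isCompact_Icc.inter_right ((isClosed_eq continuous_fst continuous_const).union
    (isClosed_eq continuous_snd continuous_const))

lemma tendsto_of_antitoneOn {f : ℝ → ℝ} {a : ℝ} (hf : AntitoneOn f (Ici 0))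
    (ha : ∀ t, 0 ≤ t → a ≤ f t) : ∃ l, Tendsto f atTop (𝓝 l) := by
  have hanti : Antitone fun t => f (max t 0) := fun s t hst =>
    hf (mem_Ici.2 (le_max_right _ _)) (mem_Ici.2 (le_max_right _ _)) (max_le_max_right 0 hst)
  refine ⟨_, (tendsto_atTop_ciInf hanti ⟨a, ?_⟩).congr' ?_⟩
  · rintro _ ⟨t, rfl⟩
    exact ha _ (le_max_right _ _)
  · filter_upwards [eventually_ge_atTop 0] with t ht
    simp [ht]

/-- A past-inextendible curve does not converge to an interior point. -/
lemma IsPastInextendible.not_tendsto {M O : Set (ℝ × ℝ)} {c : ℝ → ℝ × ℝ}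
    (hc : IsPastInextendible M c) (hO : IsOpen O) (hOM : O ⊆ M) (hz : z ∈ O) :
    ¬ Tendsto c atTop (𝓝 z) := by
  intro ht
  obtain ⟨ε, hε, hball⟩ := Metric.isOpen_iff.1 hO z hz
  -- A short ingoing null segment from the limit is a nonconstant continuation within `M`.
  have hdM : MapsTo (fun t => (z.1 - min t (ε / 2), z.2)) (Ici 0) M := fun t ht => by
    have h0 : 0 ≤ min t (ε / 2) := le_min ht (by positivity)
    have h1 : min t (ε / 2) ≤ ε / 2 := min_le_right _ _
    refine hOM (hball ?_)
    rw [Metric.mem_ball, Prod.dist_eq, Real.dist_eq, Real.dist_eq]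
    exact max_lt (abs_lt.2 ⟨by linarith, by linarith⟩) (by simpa using hε)
  have h0 : (z.1 - min 0 (ε / 2), z.2) = z := by
    rw [min_eq_left (by positivity), sub_zero]
  have key := hc.2 z (hOM hz) ht (fun t => (z.1 - min t (ε / 2), z.2))
    ⟨by fun_prop, fun s _ t _ hst => ⟨sub_le_sub_left (min_le_min_right _ hst) _, le_rfl⟩, hdM⟩
    h0 (ε / 2) (by positivity)
  have := congrArg Prod.fst key
  simp only [min_self] at this
  linarith

/-- Points of `J⁻(p)` at or before either face lie in the past of the faces. From any other point, a
past curve that missed the faces would be trapped in the rectangle and so, being monotone, would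
converge there. The limit is an interior point of `Q`, so the curve would be extendible. -/
lemma generates_pastFaces (hO : IsOpen (Q \ (S ∪ Γ))) (hpQ : p ∉ Q) (h1 : o.1 < p.1)
    (h2 : o.2 < p.2) (hsub : puncturedRect o p ⊆ Q \ (S ∪ Γ)) : Generates Q (pastFaces o p) p := by
  refine ⟨isCompact_pastFaces, ((pastFaces_subset h1 h2).trans hsub).trans sdiff_subset,
    fun x ⟨hxp, hxQ⟩ => ?_⟩
  rcases le_or_gt x.1 o.1 with hx1 | hx1
  · exact Or.inr ⟨(o.1, p.2), ⟨⟨⟨le_rfl, h2.le⟩, ⟨h1.le, le_rfl⟩⟩, Or.inl rfl⟩, hx1, hxp.2⟩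
  rcases le_or_gt x.2 o.2 with hx2 | hx2
  · exact Or.inr ⟨(p.1, o.2), ⟨⟨⟨h1.le, le_rfl⟩, ⟨le_rfl, h2.le⟩⟩, Or.inr rfl⟩, hxp.1, hx2⟩
  refine Or.inl ⟨subset_closure hxQ, fun c hc hc0 => ?_⟩
  rw [insert_eq_of_mem hxQ] at hc
  by_contra! hav
  have hle : ∀ t, 0 ≤ t → c t ≤ x := fun t ht => hc0 ▸ hc.1.2.1 self_mem_Ici ht ht
  -- The first zero of this minimum would be a crossing of one of the past faces, so the
  -- intermediate value theorem keeps the curve strictly inside.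
  have hpos : ∀ t, 0 ≤ t → 0 < min ((c t).1 - o.1) ((c t).2 - o.2) := by
    intro t ht
    by_contra! hneg
    have hcont : ContinuousOn (fun t => min ((c t).1 - o.1) ((c t).2 - o.2)) (Icc 0 t) :=
      (ContinuousOn.inf (hc.1.1.fst.sub continuousOn_const)
        (hc.1.1.snd.sub continuousOn_const)).mono Icc_subset_Ici_self
    obtain ⟨s, hs, e⟩ := intermediate_value_Icc' ht hcont
      ⟨hneg, by rw [hc0]; exact le_min (sub_nonneg.2 hx1.le) (sub_nonneg.2 hx2.le)⟩
    simp only at e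
    have e1 := min_le_left ((c s).1 - o.1) ((c s).2 - o.2)
    have e2 := min_le_right ((c s).1 - o.1) ((c s).2 - o.2)
    refine hav s hs.1 ⟨⟨⟨by linarith, by linarith⟩, (hle s hs.1).trans hxp⟩, ?_⟩
    rcases min_choice ((c s).1 - o.1) ((c s).2 - o.2) with h | h
    · exact Or.inl (by linarith)
    · exact Or.inr (by linarith)
  have hoc : ∀ t, 0 ≤ t → o ≤ c t := fun t ht =>
    ⟨by linarith [hpos t ht, min_le_left ((c t).1 - o.1) ((c t).2 - o.2)],
      by linarith [hpos t ht, min_le_right ((c t).1 - o.1) ((c t).2 - o.2)]⟩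
  obtain ⟨l1, hl1⟩ := tendsto_of_antitoneOn (f := fun t => (c t).1) (a := o.1)
    (fun s hs t ht hst => (hc.1.2.1 hs ht hst).1) fun t ht => (hoc t ht).1
  obtain ⟨l2, hl2⟩ := tendsto_of_antitoneOn (f := fun t => (c t).2) (a := o.2)
    (fun s hs t ht hst => (hc.1.2.1 hs ht hst).2) fun t ht => (hoc t ht).2
  have hl : Tendsto c atTop (𝓝 (l1, l2)) := hl1.prodMk_nhds hl2
  have hox : (l1, l2) ∈ Icc o x := isClosed_Icc.mem_of_tendsto hl (by
    filter_upwards [eventually_ge_atTop 0] with t ht using ⟨hoc t ht, hle t ht⟩)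
  refine hc.not_tendsto hO sdiff_subset (hsub ⟨⟨hox.1, hox.2.trans hxp⟩, fun e => ?_⟩) hl
  have e' : (l1, l2) = p := e
  -- The limit is below `x ≤ p`, so it could equal `p` only if `x = p`, and `p` is not in `Q`.
  exact hpQ (le_antisymm hxp (e' ▸ hox.2) ▸ hxQ)

/-- From a point of `Q` off the rectangle there is a past-inextendible curve which avoids its past
faces. -/
lemma IsEvolutionaryRegion.exists_curve_avoiding (hQ : IsEvolutionaryRegion Q S Γ I)
    (hΓ : Disjoint (pastFaces o p) Γ) (hz : z ∈ Q) (hzR : z ∉ Icc o p) :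
    ∃ c, IsPastInextendible Q c ∧ c 0 = z ∧ ∀ t, 0 ≤ t → c t ∉ pastFaces o p := by
  -- If `u` is in the range of the rectangle then `v` is not, and an ingoing ray preserves `v`.
  -- Otherwise an outgoing ray preserves the bad value of `u` until it meets `Γ`, which is disjoint
  -- from the faces.
  by_cases h : o.1 ≤ z.1 ∧ z.1 ≤ p.1
  · obtain ⟨c, hc, hc0, hc2⟩ := hQ.exists_curve_left hz
    refine ⟨c, hc, hc0, fun t ht hm => hzR ?_⟩
    have := hc2 t ht
    exact ⟨⟨h.1, this ▸ hm.1.1.2⟩, ⟨h.2, this ▸ hm.1.2.2⟩⟩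
  · obtain ⟨c, hc, hc0, hc1⟩ := hQ.exists_curve_down hz
    refine ⟨c, hc, hc0, fun t ht hm => ?_⟩
    rcases hc1 t ht with e | e
    · exact h (e ▸ ⟨hm.1.1.1, hm.1.2.1⟩)
    · exact hΓ.le_bot ⟨hm, e⟩

/-- From a point `x` off the closed rectangle some inextendible curve avoids the faces. For `x` in
the closure but not in `Q`, either the constant curve is inextendible, or one can follow any
nonconstant curve briefly into `Q`, still off the rectangle, and continue with an avoiding curve. -/
lemma IsEvolutionaryRegion.dPlus_pastFaces_subset (hQ : IsEvolutionaryRegion Q S Γ I)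
    (h1 : o.1 < p.1) (h2 : o.2 < p.2) (hsub : puncturedRect o p ⊆ Q \ (S ∪ Γ)) :
    DPlus Q (pastFaces o p) ⊆ Icc o p := by
  intro x hx
  by_contra hxR
  have hXQ := (pastFaces_subset h1 h2).trans hsub
  have hΓ : Disjoint (pastFaces o p) Γ :=
    disjoint_left.2 fun z hz hzΓ => (hXQ hz).2 (Or.inr hzΓ)
  by_cases hxQ : x ∈ Q
  · obtain ⟨c, hc, hc0, hav⟩ := hQ.exists_curve_avoiding hΓ hxQ hxR
    obtain ⟨t, ht, hm⟩ := hx.2 c (by rwa [insert_eq_of_mem hxQ]) hc0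
    exact hav t ht hm
  by_cases hd : ∀ d, IsPastCausalCurve (insert x Q) d → d 0 = x → ∀ t, 0 ≤ t → d t = x
  · obtain ⟨t, ht, hm⟩ := hx.2 (fun _ => x) ⟨⟨continuousOn_const, fun _ _ _ _ _ => le_rfl,
      fun _ _ => mem_insert _ _⟩, fun y _ hy => by
        rwa [← tendsto_nhds_unique tendsto_const_nhds hy]⟩ rfl
    exact hxQ (hXQ hm).1
  push Not at hd
  obtain ⟨d, hd, hd0, t, ht, hne⟩ := hd
  have hle : ∀ s, 0 ≤ s → d s ≤ x := fun s hs => hd0 ▸ hd.2.1 self_mem_Ici hs hs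
  obtain ⟨ε, hε, hball⟩ := Metric.isOpen_iff.1 (isClosed_Icc (a := o) (b := p)).isOpen_compl x hxR
  -- `g` measures the descent from `x`. A small positive value of it gives a time `T` at which `x`
  -- has been left, while up to `T` the curve stays within `ε` of `x`.
  set g : ℝ → ℝ := fun s => (x.1 - (d s).1) + (x.2 - (d s).2) with hg
  have hgpos : ∀ s, 0 ≤ s → d s ≠ x → 0 < g s := fun s hs hne => by
    have := hle s hs
    rcases (sub_nonneg.2 this.1).lt_or_eq with h | h
    · exact add_pos_of_pos_of_nonneg h (sub_nonneg.2 this.2)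
    · refine add_pos_of_nonneg_of_pos h.le ((sub_nonneg.2 this.2).lt_of_ne fun h' => hne ?_)
      exact Prod.ext (by linarith) (by linarith)
  have hgc : ContinuousOn g (Icc 0 t) :=
    ((continuousOn_const.sub hd.1.fst).add (continuousOn_const.sub hd.1.snd)).mono
      Icc_subset_Ici_self
  have hm0 : 0 < min (g t) (ε / 2) := lt_min (hgpos t ht hne) (by positivity)
  obtain ⟨T, hT, hgT⟩ := intermediate_value_Icc ht hgc
    ⟨by simpa [hg, hd0] using hm0.le, min_le_left _ (ε / 2)⟩
  have hTε : g T ≤ ε / 2 := hgT ▸ min_le_right _ _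
  have hout : ∀ s, 0 ≤ s → s ≤ T → d s ∉ Icc o p := by
    intro s hs hsT
    apply hball
    have k1 := hle s hs
    have k2 := hd.2.1 hs hT.1 hsT
    have l1 := k1.1
    have l2 := k1.2
    have l3 := k2.1
    have l4 := k2.2
    simp only [hg] at hTε
    rw [Metric.mem_ball, Prod.dist_eq, Real.dist_eq, Real.dist_eq]
    exact max_lt (abs_lt.2 ⟨by linarith, by linarith⟩) (abs_lt.2 ⟨by linarith, by linarith⟩)
  have hTx : d T ≠ x := fun e => by
    have : g T = 0 := by simp [hg, e]
    linarith
  obtain ⟨c, hc, hc0, hav⟩ := hQ.exists_curve_avoiding hΓ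
    ((hd.2.2 hT.1).resolve_left hTx) (hout T hT.1 le_rfl)
  have hc' := hc.insert (x := x) fun h => hTx (le_antisymm (hle T hT.1) (hc0 ▸ h))
  obtain ⟨s, hs, hm⟩ := hx.2 _ (hc'.concat hT.1 hd hc0) (by rw [concatCurve_of_le hT.1, hd0])
  rcases le_total s T with h | h
  · rw [concatCurve_of_le h] at hm
    exact hout s hs h hm.1
  · rw [concatCurve_of_ge hc0 h] at hm
    exact hav _ (sub_nonneg.2 h) hm

end PastFaces

/-! ### The sign of `∂_u r` -/

section Sign

variable {Q S Γ I : Set (ℝ × ℝ)} {Ω r φ e : ℝ × ℝ → ℝ} {x z : ℝ × ℝ}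

/-- Ingoing null rays of `Q \ Γ` avoid the centre and, off their starting point, `S`. -/
lemma IsEvolutionaryRegion.ray_left_mem_interior (hQ : IsEvolutionaryRegion Q S Γ I)
    (hx : x ∈ Q \ Γ) {b : ℝ × ℝ} (hb : b ∈ S ∪ I) (hb2 : b.2 = x.2) {t : ℝ} (h1 : b.1 < t)
    (h2 : t ≤ x.1) : (t, x.2) ∈ Q \ (S ∪ Γ) := by
  refine ⟨hQ.ray_left_mem hx.1 hb hb2 h1.le (fun _ => h1) h2, fun hm => ?_⟩
  obtain ⟨o, ho⟩ := hQ.exists_corner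
  rcases hm with hm | hm
  · rcases hb with hb | hb
    · exact (hQ.spacelike.snd_lt hb hm h1).ne hb2.symm
    · obtain ⟨i, hi⟩ := hQ.exists_isStart ⟨b, hb⟩
      have := hi.snd_lt _ hm
      have := (hi.le b hb).2
      simp only at *
      linarith
  · obtain ⟨c, hc, hc1, hc2⟩ := hQ.exists_below hx.1
    have ht : t < x.1 := lt_of_le_of_ne h2 fun e => hx.2 (by rwa [e] at hm)
    have ho1 : o.1 ≤ t := (ho.le _ hm).1
    rcases hc with hc | hc
    · linarith [ho.fst_le c hc]
    · have := hQ.timelike.snd_lt hm hc (by simp only; linarith)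
      simp only at this
      linarith

/-- Raychaudhuri's equation propagates the sign of `∂_u r` along ingoing null rays. -/
theorem IsEvolutionaryRegion.dU_neg {n : ℕ} (hn : n ≠ 0) (hQ : IsEvolutionaryRegion Q S Γ I)
    (hr : RadiusConditions Q S Γ I r) {O : Set (ℝ × ℝ)} (hO : IsOpen O) (hQO : Q \ Γ ⊆ O)
    (hr2 : ContDiffOn ℝ 2 r O) (hΩ : ContDiffOn ℝ 1 Ω O) (hΩ0 : ∀ z ∈ Q \ Γ, 0 < Ω z)
    (heq : ∀ z ∈ Q \ (S ∪ Γ),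
      n * (dU (dU r) z - 2 * dU Ω z / Ω z * dU r z) = -(r z * dU φ z ^ 2))
    (hx : x ∈ Q \ Γ) : dU r x < 0 := by
  obtain ⟨b, hb, hb2, hb1, hbI⟩ := hQ.exists_right hx.1
  rcases hb1.eq_or_lt with e | hlt
  · have hbx : b = x := Prod.ext e hb2
    have hbS : b ∈ S := hb.resolve_right fun h => (hbI h).ne e
    exact hr.nu_neg_initial x ⟨hbx ▸ hbS, hx.2⟩
  have hray : ∀ t ∈ Ioc b.1 x.1, (t, x.2) ∈ Q \ (S ∪ Γ) := fun t ht =>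
    hQ.ray_left_mem_interior hx hb hb2 ht.1 ht.2
  have hsub : Q \ (S ∪ Γ) ⊆ Q \ Γ := sdiff_subset_sdiff_right subset_union_right
  -- By Raychaudhuri's equation `∂_u r/Ω²` is nonincreasing in `u`, so a negative value persists.
  set F : ℝ → ℝ := fun t => dU r (t, x.2) / Ω (t, x.2) ^ 2 with hF
  have hn0 : (0 : ℝ) < n := Nat.cast_pos.2 (Nat.pos_of_ne_zero hn)
  have hrU : ContDiffOn ℝ 1 (dU r) O := contDiffOn_dU hO (by simpa [one_add_one_eq_two] using hr2)
  have hdiff : ∀ {f : ℝ × ℝ → ℝ}, ContDiffOn ℝ 1 f O → ∀ z ∈ O,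
      HasDerivAt (fun u => f (u, z.2)) (dU f z) z.1 := fun hf z hz =>
    hasDerivAt_left ((hf.differentiableOn (by simp)).differentiableAt (hO.mem_nhds hz)).slice_left
  have hderiv : ∀ t, (t, x.2) ∈ Q \ Γ → HasDerivAt F
      ((dU (dU r) (t, x.2) * Ω (t, x.2) ^ 2 -
        dU r (t, x.2) * (2 * Ω (t, x.2) * dU Ω (t, x.2))) / (Ω (t, x.2) ^ 2) ^ 2) t := by
    intro t ht
    have h1 := hdiff hrU _ (hQO ht)
    have h2 := hdiff hΩ _ (hQO ht)
    exact (h1.div (h2.pow 2) (pow_ne_zero 2 (hΩ0 _ ht).ne')).congr_deriv (by simp)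
  have hnonpos : ∀ t, (t, x.2) ∈ Q \ (S ∪ Γ) → (dU (dU r) (t, x.2) * Ω (t, x.2) ^ 2 -
        dU r (t, x.2) * (2 * Ω (t, x.2) * dU Ω (t, x.2))) / (Ω (t, x.2) ^ 2) ^ 2 ≤ 0 := by
    intro t ht
    have hpos := hΩ0 _ (hsub ht)
    have h1 := heq _ ht
    have h2 : 0 ≤ r (t, x.2) * dU φ (t, x.2) ^ 2 := mul_nonneg (hr.nonneg _ ht.1) (sq_nonneg _)
    have h3 : dU (dU r) (t, x.2) - 2 * dU Ω (t, x.2) / Ω (t, x.2) * dU r (t, x.2) ≤ 0 := by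
      by_contra! h
      have := mul_pos hn0 h
      linarith
    refine div_nonpos_of_nonpos_of_nonneg ?_ (by positivity)
    have : dU (dU r) (t, x.2) * Ω (t, x.2) ^ 2 -
        dU r (t, x.2) * (2 * Ω (t, x.2) * dU Ω (t, x.2)) = Ω (t, x.2) ^ 2 *
        (dU (dU r) (t, x.2) - 2 * dU Ω (t, x.2) / Ω (t, x.2) * dU r (t, x.2)) := by
      field_simp
    rw [this]
    exact mul_nonpos_of_nonneg_of_nonpos (by positivity) h3
  -- The starting point may lie on `S`, where the equation is not assumed here; differentiability
  -- there suffices, since the sign of the derivative is needed only in the open interval.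
  have hanti : ∀ t, b.1 ≤ t → t ≤ x.1 → (t, x.2) ∈ Q \ Γ → F x.1 ≤ F t := by
    intro t h1 h2 ht
    have hmem : ∀ s ∈ Icc t x.1, (s, x.2) ∈ Q \ Γ := fun s hs => by
      rcases hs.1.eq_or_lt with e | h
      · rwa [← e]
      · exact hsub (hray s ⟨h1.trans_lt h, hs.2⟩)
    refine antitoneOn_of_hasDerivWithinAt_nonpos (convex_Icc t x.1)
      (fun s hs => (hderiv s (hmem s hs)).continuousAt.continuousWithinAt)
      (fun s hs => (hderiv s (hmem s (interior_subset hs))).hasDerivWithinAt)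
      (fun s hs => ?_) (left_mem_Icc.2 h2) (right_mem_Icc.2 h2) h2
    rw [interior_Icc] at hs
    exact hnonpos s (hray s ⟨h1.trans_lt hs.1, hs.2.le⟩)
  -- The negative initial value is taken at the starting point of the ray if that is on `S`, and
  -- just after it if the ray comes in from `I`.
  have hend : ∃ t, b.1 ≤ t ∧ t ≤ x.1 ∧ (t, x.2) ∈ Q \ Γ ∧ dU r (t, x.2) < 0 := by
    rcases hb with hb | hb
    · have hbx : (b.1, x.2) = b := by rw [← hb2]
      have hbΓ : b ∉ Γ := fun hbΓ => by
        obtain ⟨o, ho⟩ := hQ.exists_corner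
        obtain ⟨c, hc, hc1, hc2⟩ := hQ.exists_below hx.1
        have ho1 := (ho.le b hbΓ).1
        rcases hc with hc | hc
        · linarith [ho.fst_le c hc]
        · linarith [hQ.timelike.snd_lt hbΓ hc (by linarith)]
      refine ⟨b.1, le_rfl, hb1, ?_⟩
      rw [hbx]
      exact ⟨⟨hQ.boundary_subset (Or.inl hb), hbΓ⟩, hr.nu_neg_initial b ⟨hb, hbΓ⟩⟩
    · have hcont : Tendsto (fun t : ℝ => (t, x.2)) (𝓝[>] b.1) (𝓝[Q \ Γ] b) := by
        refine tendsto_nhdsWithin_iff.2 ⟨?_, ?_⟩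
        · have : Tendsto (fun t : ℝ => (t, x.2)) (𝓝 b.1) (𝓝 (b.1, x.2)) :=
            Continuous.tendsto (by fun_prop) _
          rw [← hb2] at this ⊢
          exact this.mono_left nhdsWithin_le_nhds
        · filter_upwards [Ioc_mem_nhdsGT hlt] with t ht using hsub (hray t ht)
      obtain ⟨t, ht, hneg⟩ := ((Filter.Eventually.and (Ioc_mem_nhdsGT hlt))
        (hcont.eventually (hr.nu_neg_infinity b hb))).exists
      exact ⟨t, ht.1.le, ht.2, hsub (hray t ht), hneg⟩
  obtain ⟨t, h1, h2, h3, h4⟩ := hend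
  have h5 := hanti t h1 h2 h3
  have h6 : F t < 0 := div_neg_of_neg_of_pos h4 (pow_pos (hΩ0 _ h3) 2)
  have h7 : 0 < Ω (x.1, x.2) ^ 2 := pow_pos (hΩ0 _ hx) 2
  by_contra! h8
  exact (h5.trans_lt h6).not_ge (div_nonneg h8 h7.le)

lemma normC0_mono {f : ℝ × ℝ → ℝ} {Y Z : Set (ℝ × ℝ)} (h : Y ⊆ Z) : normC0 f Y ≤ normC0 f Z :=
  biSup_mono h

lemma normC1_mono {f : ℝ × ℝ → ℝ} {Y Z : Set (ℝ × ℝ)} (h : Y ⊆ Z) : normC1 f Y ≤ normC1 f Z :=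
  sup_le_sup (sup_le_sup (normC0_mono h) (normC0_mono h)) (normC0_mono h)

lemma geomNorm_mono {Y Z : Set (ℝ × ℝ)} (h : Y ⊆ Z) : geomNorm Ω r Y ≤ geomNorm Ω r Z :=
  sup_le_sup (sup_le_sup (sup_le_sup (normC1_mono h) (normC0_mono h))
    (sup_le_sup (sup_le_sup (normC0_mono h) (normC1_mono h)) (normC1_mono h))) (normC1_mono h)

end Sign
end

/-! ### Conclusion: contradiction with the extension criterion -/

theorem theorem1 (Δ : ℕ) (hΔ : 4 ≤ Δ) (k : ℝ) (hk : k = 1 ∨ k = 0 ∨ k = -1)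
    (W : Set (Fin (Δ - 2) → ℝ))
    (γ : (Fin (Δ - 2) → ℝ) → Matrix (Fin (Δ - 2)) (Fin (Δ - 2)) ℝ)
    (hγ : IsEinsteinChart k W γ)
    (C : ℝ) (hC : 0 < C) (V : ℝ → ℝ) (hV : ContDiff ℝ 1 V) (hVC : ∀ s, -4 * C ≤ V s)
    (Q S Γ I : Set (ℝ × ℝ)) (hQ : IsEvolutionaryRegion Q S Γ I)
    (Ω r φ e : ℝ × ℝ → ℝ) (qm : ℝ) (hqm : Δ ≠ 4 → qm = 0)
    (hreg : RegularFields (Q \ Γ) Ω r φ e)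
    (hr : RadiusConditions Q S Γ I r)
    (hsol : SolvesEinsteinScalarMaxwell (Q \ Γ) W γ V Ω r φ e qm)
    (hext : ExtensionCriterion Q Γ Ω r)
    (p : ℝ × ℝ) (hp : IsFirstSingularity Q p) :
    p ∈ closure Γ \ Γ ∨
      ∀ X, Generates Q X p →
        (Iic p ∩ Q ∩ DPlus Q X ∩ trappedRegion Q Γ r).Nonempty := by
  obtain ⟨O, hO, hQO, hr2, hΩ, hφ, he, hΩ0⟩ := hreg
  have hn : Δ - 2 ≠ 0 := by omega
  have hsub : Q \ (S ∪ Γ) ⊆ Q \ Γ := sdiff_subset_sdiff_right subset_union_right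
  have hreg : RegularOn Ω r φ e (Q \ (S ∪ Γ)) :=
    { isOpen := hQ.isOpen_interior
      Ω_pos := fun z hz => hΩ0 z (hsub hz)
      r_pos := fun z hz => lt_of_le_of_ne (hr.nonneg z hz.1) fun h =>
        hz.2 (Or.inr ((hr.centre z hz.1).1 h.symm))
      r_reg := hr2.mono (hsub.trans hQO)
      Ω_reg := hΩ.mono (hsub.trans hQO)
      φ_reg := hφ.mono (hsub.trans hQO)
      e_reg := he.mono (hsub.trans hQO) }
  obtain ⟨w, hw⟩ := hγ.nonempty
  have heqs := fun {z} (hz : z ∈ Q \ (S ∪ Γ)) => hreg.reducedEquationsAt hγ hn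
    (fun x hx => hsol x (hsub hx)) hw hz
  by_cases hpΓ : p ∈ closure Γ
  · exact Or.inl ⟨hpΓ, fun h => hp.1.2 (hQ.boundary_subset (Or.inr h))⟩
  refine Or.inr fun X hX => ?_
  by_contra hempty
  obtain ⟨hpr, a, ha1, ha2, ha⟩ := hQ.exists_rect_of_isFirstSingularity hp hpΓ
  obtain ⟨ε, hε, hball⟩ := Metric.eventually_nhds_iff_ball.1
    (hQ.eventually_mem_dPlus hp.1.2 hpr hX)
  -- The past corner is chosen late enough for the rectangle to lie both in the interior of `Q` and
  -- in the neighbourhood of `p` where `J⁻(p) ∩ Q ⊆ D⁺(X)`.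
  obtain ⟨u, hu1, hu2⟩ := exists_between (max_lt ha1 (sub_lt_self p.1 hε))
  obtain ⟨v, hv1, hv2⟩ := exists_between (max_lt ha2 (sub_lt_self p.2 hε))
  rw [max_lt_iff] at hu1 hv1
  have hrect : puncturedRect (u, v) p ⊆ Q \ (S ∪ Γ) := fun z hz =>
    ha z hz.1.2 hz.2 (hu1.1.trans_le hz.1.1.1) (hv1.1.trans_le hz.1.1.2)
  have hmem : ∀ z ∈ puncturedRect (u, v) p, z ∈ DPlus Q X := fun z hz => by
    refine hball z ?_ ⟨hz.1.2, (hrect hz).1⟩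
    have h1 := hz.1.1.1
    have h2 := hz.1.1.2
    have h3 := hz.1.2.1
    have h4 := hz.1.2.2
    simp only at h1 h2
    rw [Metric.mem_ball, Prod.dist_eq, Real.dist_eq, Real.dist_eq]
    exact max_lt (abs_lt.2 ⟨by linarith, by linarith⟩) (abs_lt.2 ⟨by linarith, by linarith⟩)
  have hU : UntrappedRect (Δ - 2) k C (magneticSq qm γ w) (magneticTrace qm γ w) V Ω r φ e
      (Q \ (S ∪ Γ)) (u, v) p :=
    { reg := hreg
      sub := hrect
      corner := ⟨hu2, hv2⟩
      eqs := fun z hz => heqs (hrect hz)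
      ν_neg := fun z hz => hQ.dU_neg hn hr hO hQO hr2 hΩ.contDiffOn hΩ0
        (fun z hz => (heqs hz).raychaudhuri_u) (hsub (hrect hz))
      lam_nonneg := fun z hz => by
        by_contra! h
        exact hempty ⟨z, ⟨⟨hz.1.2, (hrect hz).1⟩, hmem z hz⟩, hsub (hrect hz), h⟩
      one_le := Nat.one_le_iff_ne_zero.2 hn
      V_reg := hV
      V_ge := hVC }
  have hD : DPlus Q (pastFaces (u, v) p) \ {p} ⊆ puncturedRect (u, v) p :=
    sdiff_subset_sdiff_left (hQ.dPlus_pastFaces_subset hu2 hv2 hrect)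
  -- The criterion is applied to the past faces, not to `X`: `X` may meet the centre, and `D⁺(X)`
  -- may extend far beyond the region where the estimates hold.
  have htop := hext p hp hpΓ _ (generates_pastFaces hQ.isOpen_interior hp.1.2 hu2 hv2 hrect)
    (((pastFaces_subset hu2 hv2).trans hrect).trans hsub) ((hD.trans hrect).trans hsub)
  exact ((geomNorm_mono hD).trans_lt hU.geomNorm_lt_top).ne htop
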